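/- An instance of house allocation with lower and upper quotas consists of a bipartite graph $G=(A\,\dot\cup\,P,E)$ with $n$ applicants $A$ and $m$ projects $P$, and of a lower quota $\ell_p\in\mathbb N$ and an upper quota $u_p\in\mathbb N$ for each $p\in P$. A matching $M\subseteq E$ is a set of edges such that each applicant is incident to at most one edge of $M$ and each project $p$ is incident either to no edge of $M$ or to at least $\ell_p$ and at most $u_p$ edges of $M$. We write $M(a)$ for the project assigned to $a$, and $M(a)=a$ if $a$ is unmatched. Let $m_{\mathrm{quota}}$ be the number of projects $p$ with $\ell_p>1$. In w-ha, each edge $e$ also has a weight $w(e)\in\mathbb Q$, and the weight of a matching $M$ is $\sum_{e\in M}w(e)$. The size $|\mathcal I|$ of an instance is $(n+1)(m+1)$ plus the total binary length of the quotas and the edge weights. In the other problems, each applicant $a$ has a strict linear order $\succ_a$ on $N_a\cup\{a\}$, where $N_a$ is the set of her neighbours, and $p\succ_a a$ for all $p\in N_a$; here $|\mathcal I|$ is $(n+1)(m+1)$ plus the total binary length of the quotas. A matching $M'$ dominates $M$ if $M(a)\succ_a M'(a)$ for no applicant $a$ and $M'(a)\succ_a M(a)$ for some applicant $a$; $M$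 is Pareto optimal if no matching dominates it; $M'$ is more popular than $M$ if $|\{a: M'(a)\succ_a M(a)\}|>|\{a: M(a)\succ_a M'(a)\}|$. The problem popv-ha asks, given an instance and a matching $M$, whether some matching is more popular than $M$; pov-ha asks, given an instance and a matching $M$, whether some matching dominates $M$; perpo-ha asks whether there is a Pareto optimal matching that matches all applicants. A parameterized problem is fixed-parameter tractable in a parameter $k$ if an algorithm decides it in time $\mathcal O(f(k)\,|\mathcal I|^{\mathcal O(1)})$ for some computable function $f$. Running times are those of a random access machine with integer arithmetic and logarithmic cost. **Theorem.** There is an algorithm that, given an instance $\mathcal I$ of w-ha, computes a matching of maximum weight in time $\mathcal O(2^{m_{\mathrm{quota}}}\cdot\mathrm{poly}(|\mathcal I|))$. Moreover, popv-ha, perpo-ha and pov-ha are fixed-parameter tractable in the parameter $m_{\mathrm{quota}}$. -/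

import Mathlib

/-! ## Random access machines with logarithmic cost

Programs are while-programs over integer variables and integer arrays. The cost of a computation
is logarithmic: every value that is read, computed or used as an address is charged its binary
length. Running times in this model and on Turing machines are polynomially related. -/

namespace RAM

/-- The number of bits (including one for the sign) of an integer; at least `1`. -/
def len (z : ℤ) : ℕ := z.natAbs.size + 1

/-- A memory state: the contents of the variables and of the cells of the arrays. -/
structure State where
  var : ℕ → ℤ
  arr : ℕ → ℤ → ℤ

/-- Arithmetic expressions; `get A i` is the content of cell `i` of the array `A`,
and `le e₁ e₂` has the value `1` if `e₁ ≤ e₂` and `0` otherwise. -/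
inductive Expr where
  | const (z : ℤ)
  | var (x : ℕ)
  | get (A : ℕ) (i : Expr)
  | add (e₁ e₂ : Expr)
  | sub (e₁ e₂ : Expr)
  | mul (e₁ e₂ : Expr)
  | div (e₁ e₂ : Expr)
  | le (e₁ e₂ : Expr)

/-- The value of an expression. -/
def Expr.eval (s : State) : Expr → ℤ
  | .const z => z
  | .var x => s.var x
  | .get A i => s.arr A (i.eval s)
  | .add e₁ e₂ => e₁.eval s + e₂.eval s
  | .sub e₁ e₂ => e₁.eval s - e₂.eval s
  | .mul e₁ e₂ => e₁.eval s * e₂.eval s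
  | .div e₁ e₂ => e₁.eval s / e₂.eval s
  | .le e₁ e₂ => if e₁.eval s ≤ e₂.eval s then 1 else 0

/-- The logarithmic cost of evaluating an expression: the sum of the binary lengths of the values
of all its subexpressions (so operands, addresses, and results are all charged). -/
def Expr.cost (s : State) : Expr → ℕ
  | .const z => len z
  | .var x => len (s.var x)
  | .get A i => i.cost s + len ((Expr.get A i).eval s)
  | .add e₁ e₂ => e₁.cost s + e₂.cost s + len ((Expr.add e₁ e₂).eval s)
  | .sub e₁ e₂ => e₁.cost s + e₂.cost s + len ((Expr.sub e₁ e₂).eval s)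
  | .mul e₁ e₂ => e₁.cost s + e₂.cost s + len ((Expr.mul e₁ e₂).eval s)
  | .div e₁ e₂ => e₁.cost s + e₂.cost s + len ((Expr.div e₁ e₂).eval s)
  | .le e₁ e₂ => e₁.cost s + e₂.cost s + len ((Expr.le e₁ e₂).eval s)

/-- Programs. `assign x e` is `x := e`, and `store A i e` is `A[i] := e`; a test succeeds if the
value of the tested expression is not `0`. -/
inductive Cmd where
  | skip
  | assign (x : ℕ) (e : Expr)
  | store (A : ℕ) (i e : Expr)
  | seq (c₁ c₂ : Cmd)
  | ite (e : Expr) (c₁ c₂ : Cmd)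
  | while (e : Expr) (c : Cmd)

/-- The state after `x := z`. -/
def State.setVar (s : State) (x : ℕ) (z : ℤ) : State :=
  { s with var := Function.update s.var x z }

/-- The state after `A[i] := z`. -/
def State.setArr (s : State) (A : ℕ) (i z : ℤ) : State :=
  { s with arr := Function.update s.arr A (Function.update (s.arr A) i z) }

/-- `Run c s t s'`: started in state `s`, the program `c` halts in state `s'` after time `t`. -/
inductive Run : Cmd → State → ℕ → State → Prop where
  | skip (s : State) : Run .skip s 1 s
  | assign (s : State) (x : ℕ) (e : Expr) :
      Run (.assign x e) s (e.cost s + 1) (s.setVar x (e.eval s))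
  | store (s : State) (A : ℕ) (i e : Expr) :
      Run (.store A i e) s (i.cost s + e.cost s + 1) (s.setArr A (i.eval s) (e.eval s))
  | seq {c₁ c₂ : Cmd} {s s₁ s₂ : State} {t₁ t₂ : ℕ} :
      Run c₁ s t₁ s₁ → Run c₂ s₁ t₂ s₂ → Run (.seq c₁ c₂) s (t₁ + t₂) s₂
  | ite_true {e : Expr} {c₁ c₂ : Cmd} {s s' : State} {t : ℕ} :
      e.eval s ≠ 0 → Run c₁ s t s' → Run (.ite e c₁ c₂) s (e.cost s + 1 + t) s'
  | ite_false {e : Expr} {c₁ c₂ : Cmd} {s s' : State} {t : ℕ} :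
      e.eval s = 0 → Run c₂ s t s' → Run (.ite e c₁ c₂) s (e.cost s + 1 + t) s'
  | while_true {e : Expr} {c : Cmd} {s s₁ s₂ : State} {t₁ t₂ : ℕ} :
      e.eval s ≠ 0 → Run c s t₁ s₁ → Run (.while e c) s₁ t₂ s₂ →
      Run (.while e c) s (e.cost s + 1 + t₁ + t₂) s₂
  | while_false {e : Expr} {c : Cmd} {s : State} :
      e.eval s = 0 → Run (.while e c) s (e.cost s + 1) s

/-- The initial state: the input words stand in the cells `0, 1, 2, …` of array `0`, their number
in variable `0`, and everything else is `0`. -/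
def init (input : List ℤ) : State where
  var x := if x = 0 then input.length else 0
  arr A i := if A = 0 ∧ 0 ≤ i then input.getD i.toNat 0 else 0

/-- The output is read off from array `1`; its number of words is the value of variable `0`. -/
def State.Outputs (s : State) (output : List ℤ) : Prop :=
  s.var 0 = output.length ∧ ∀ i : Fin output.length, s.arr 1 (i : ℕ) = output.get i

/-- On the given input, the program `c` halts within time `T` and returns the given output. -/
def ComputesWithin (c : Cmd) (input output : List ℤ) (T : ℕ) : Prop :=
  ∃ t s, Run c (init input) t s ∧ s.Outputs output ∧ t ≤ T

end RAM

/-! ## Parameterized problems -/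

/-- A parameterized decision problem: its instances, how they are presented to a machine,
their size and parameter, and which of them are yes-instances. -/
structure ParamProblem where
  Inst : Type
  encode : Inst → List ℤ
  size : Inst → ℕ
  param : Inst → ℕ
  Yes : Inst → Prop

open Classical in
/-- Fixed-parameter tractability: some algorithm decides the problem in time
`O(f(k) · |I| ^ O(1))`, for a computable function `f` of the parameter `k`. -/
def ParamProblem.FPT (Q : ParamProblem) : Prop :=
  ∃ (c : RAM.Cmd) (f : ℕ → ℕ) (C d : ℕ), Computable f ∧ ∀ I : Q.Inst,
    RAM.ComputesWithin c (Q.encode I) [if Q.Yes I then 1 else 0]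
      (C * (f (Q.param I) * Q.size I ^ d))

/-! ## House allocation with lower and upper quotas -/

namespace HouseAllocation

/-- A bipartite graph between `n` applicants and `m` projects, with quotas on the projects. -/
structure Market where
  n : ℕ
  m : ℕ
  adj : Fin n → Fin m → Bool
  lower : Fin m → ℕ
  upper : Fin m → ℕ

namespace Market

/-- Each applicant is assigned a project, or `none` if she stays unmatched. -/
abbrev Assignment (G : Market) : Type := Fin G.n → Option (Fin G.m)

/-- The number `|M(p)|` of applicants that are assigned to the project `p`. -/
def load (G : Market) (M : G.Assignment) (p : Fin G.m) : ℕ :=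
  (Finset.univ.filter fun a => M a = some p).card

/-- Matchings: only edges are used, and each project is closed or meets its quotas. -/
structure IsMatching (G : Market) (M : G.Assignment) : Prop where
  edge : ∀ a p, M a = some p → G.adj a p = true
  quota : ∀ p, G.load M p = 0 ∨ (G.lower p ≤ G.load M p ∧ G.load M p ≤ G.upper p)

/-- A matching is perfect if all applicants are matched. -/
def IsPerfect (G : Market) (M : G.Assignment) : Prop := ∀ a, M a ≠ none

/-- The number `m_quota` of projects with a lower quota greater than `1`. -/
def mQuota (G : Market) : ℕ := (Finset.univ.filter fun p => 1 < G.lower p).card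

/-- The size of the graph together with the binary length of the quotas. -/
def size (G : Market) : ℕ :=
  (G.n + 1) * (G.m + 1) + ∑ p, ((G.lower p).size + (G.upper p).size)

/-- The list of the entries of a matrix, row by row. -/
def rowMajor {n m : ℕ} (f : Fin n → Fin m → ℤ) : List ℤ :=
  List.ofFn fun k : Fin (n * m) => f k.divNat k.modNat

/-- The numbers of applicants and projects, and the quotas. -/
def encodeQuotas (G : Market) : List ℤ :=
  [(G.n : ℤ), (G.m : ℤ)] ++ List.ofFn (fun p => (G.lower p : ℤ)) ++
    List.ofFn (fun p => (G.upper p : ℤ))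

/-- An assignment as a list of `n` words: `0` for an unmatched applicant, `p + 1` for an applicant
who is assigned to project `p`. -/
def encodeAssignment (G : Market) (M : G.Assignment) : List ℤ :=
  List.ofFn fun a => (M a).elim 0 fun p => ((p : ℕ) : ℤ) + 1

end Market

/-! ### Weighted matchings -/

/-- A market with rational edge weights; the values of `w` outside of the edge set play no role. -/
structure WeightedMarket extends Market where
  w : Fin n → Fin m → ℚ

namespace WeightedMarket

/-- The total weight of the edges of `M`. -/
def weight (I : WeightedMarket) (M : I.Assignment) : ℚ :=
  ∑ a, (M a).elim 0 (I.w a)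

/-- `M` is a matching of maximum weight. -/
def IsMaxWeight (I : WeightedMarket) (M : I.Assignment) : Prop :=
  I.IsMatching M ∧ ∀ M' : I.Assignment, I.IsMatching M' → I.weight M' ≤ I.weight M

/-- The size of the graph with its quotas, plus the binary length of the weights of the edges. -/
def size (I : WeightedMarket) : ℕ :=
  I.toMarket.size +
    ∑ a, ∑ p, if I.adj a p then (I.w a p).num.natAbs.size + (I.w a p).den.size else 0

/-- The quotas, the adjacency matrix, and the numerators and denominators of the edge weights. -/
def encode (I : WeightedMarket) : List ℤ :=
  I.encodeQuotas ++ Market.rowMajor (fun a p => if I.adj a p then 1 else 0) ++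
    Market.rowMajor (fun a p => if I.adj a p then (I.w a p).num else 0) ++
    Market.rowMajor (fun a p => if I.adj a p then ((I.w a p).den : ℤ) else 0)

end WeightedMarket

/-! ### Preferences -/

/-- A market in which each applicant strictly orders her neighbours, best first. -/
structure PrefMarket extends Market where
  prefList : Fin n → List (Fin m)
  nodup : ∀ a, (prefList a).Nodup
  mem_iff : ∀ a p, p ∈ prefList a ↔ adj a p = true

namespace PrefMarket

/-- `I.Prefers a x y`: applicant `a` prefers `x` to `y`, where `none` means to be unmatched,
which is worse than every project on her list. -/
def Prefers (I : PrefMarket) (a : Fin I.n) : Option (Fin I.m) → Option (Fin I.m) → Prop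
  | some p, some q =>
      p ∈ I.prefList a ∧ q ∈ I.prefList a ∧ (I.prefList a).idxOf p < (I.prefList a).idxOf q
  | some p, none => p ∈ I.prefList a
  | none, _ => False

instance (I : PrefMarket) (a : Fin I.n) (x y : Option (Fin I.m)) : Decidable (I.Prefers a x y) := by
  cases x <;> cases y <;> unfold Prefers <;> infer_instance

/-- `M'` dominates `M`: nobody is worse off in `M'`, and somebody is better off. -/
def Dominates (I : PrefMarket) (M' M : I.Assignment) : Prop :=
  (¬ ∃ a, I.Prefers a (M a) (M' a)) ∧ ∃ a, I.Prefers a (M' a) (M a)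

/-- `M` is a Pareto optimal matching. -/
def IsParetoOptimal (I : PrefMarket) (M : I.Assignment) : Prop :=
  I.IsMatching M ∧ ¬ ∃ M' : I.Assignment, I.IsMatching M' ∧ I.Dominates M' M

/-- `M'` is more popular than `M`: more applicants prefer `M'` to `M` than `M` to `M'`. -/
def MorePopular (I : PrefMarket) (M' M : I.Assignment) : Prop :=
  (Finset.univ.filter fun a => I.Prefers a (M a) (M' a)).card <
    (Finset.univ.filter fun a => I.Prefers a (M' a) (M a)).card

/-- The position (`1`, `2`, …) of project `p` on the list of applicant `a`, or `0`. -/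
def rank (I : PrefMarket) (a : Fin I.n) (p : Fin I.m) : ℕ :=
  if p ∈ I.prefList a then (I.prefList a).idxOf p + 1 else 0

/-- The quotas and the preferences. -/
def encode (I : PrefMarket) : List ℤ :=
  I.encodeQuotas ++ Market.rowMajor fun a p => (I.rank a p : ℤ)

end PrefMarket

/-- A market with preferences together with one of its matchings. -/
structure MatchedMarket extends PrefMarket where
  M : Fin n → Option (Fin m)
  isMatching : toPrefMarket.IsMatching M

/-- The market and its preferences, followed by the matching. -/
def MatchedMarket.encode (I : MatchedMarket) : List ℤ :=
  I.toPrefMarket.encode ++ I.encodeAssignment I.M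

/-- POPV-HA: is there a matching that is more popular than the given one? -/
def popvHA : ParamProblem where
  Inst := MatchedMarket
  encode I := I.encode
  size I := I.toMarket.size
  param I := I.mQuota
  Yes I := ∃ M' : I.Assignment, I.IsMatching M' ∧ I.MorePopular M' I.M

/-- PERPO-HA: is there a Pareto optimal matching that matches all applicants? -/
def perpoHA : ParamProblem where
  Inst := PrefMarket
  encode I := I.encode
  size I := I.toMarket.size
  param I := I.mQuota
  Yes I := ∃ M : I.Assignment, I.IsParetoOptimal M ∧ I.IsPerfect M

/-- POV-HA: is there a matching that dominates the given one? -/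
def povHA : ParamProblem where
  Inst := MatchedMarket
  encode I := I.encode
  size I := I.toMarket.size
  param I := I.mQuota
  Yes I := ∃ M' : I.Assignment, I.IsMatching M' ∧ I.Dominates M' I.M

end HouseAllocation

/-! The only obstacle to a polynomial algorithm is the choice of the projects to open among those
with a lower quota above `1`. All `2 ^ mQuota` choices are tried, each encoded as a bit mask
(`exists_mask`). The other projects need no decision, because any nonempty set of applicants meets a
lower quota of at most `1`.

For a fixed choice the problem becomes an assignment problem. Every project is split into `n` slots,
of which those below the upper quota are usable, and a dummy block of `n` further slots stands for
staying unmatched; unusable slots have weight `0`. In projects with a lower quota above `1`, each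
usable slot below that quota earns a bonus `K` larger than twice the sum of all absolute weights. If
some matching opens exactly the chosen projects, it fills all their bonus slots. An optimal
assignment must then fill them too, since no gain in ordinary weight makes up for one lost bonus.
Hence it is a matching, and it is at least as heavy as every matching with this set of open projects
(`isMatching_of_slots`). If no matching has the chosen mask, the assignment may violate quotas, so
it is checked and possibly discarded (`round_spec`). The assignment problem is solved by the
Hungarian method, whose optimality is weak duality (`Dual.optimal`); rational weights are first
multiplied by the product of the denominators.

The machine part rests on a small language of counting loops with a denotational semantics.
`run_den` bounds word lengths and running times by the number of steps: stored values are built with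
products only by input cells, so each step lengthens words by a bounded multiple of the input word
length. `steps_le` bounds the steps by a polynomial when all loops are controlled by fixed
variables. These bounds apply to a single round only, as the loop over the masks is exponential.
Each round therefore ends by clearing its scratch memory, and `search_bounded` shows that words are
as short at the start of each round as before the first; `run_search` then multiplies the cost of
one round by `2 ^ mQuota`.

The decision problems compare a maximum weight with a threshold. Edge weights can be chosen so that
the weight of a matching `M'` is a constant, plus the number of applicants who prefer `M'`, minus
`X` times the number who prefer `M` (`intWeight_voteWeight`). Taking `X = 1` expresses popularity
and `X = n + 1` expresses domination. For perfect Pareto optimal matchings, a perfect matching of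
least total rank is Pareto optimal, so it suffices to find a matching of size `n`
(`exists_isParetoOptimal_isPerfect_iff`). -/

namespace RAM

/-! ### Binary lengths -/

theorem one_le_len (z : ℤ) : 1 ≤ len z := Nat.le_add_left _ _

theorem len_mono {a b : ℤ} (h : a.natAbs ≤ b.natAbs) : len a ≤ len b :=
  Nat.succ_le_succ (Nat.size_le_size h)

theorem len_le_iff {z : ℤ} {k : ℕ} : len z ≤ k + 1 ↔ z.natAbs < 2 ^ k := by
  rw [len, Nat.succ_le_succ_iff, Nat.size_le]

theorem natAbs_lt_of_len (z : ℤ) : z.natAbs < 2 ^ (len z - 1) := by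
  rw [← len_le_iff]; have := one_le_len z; omega

theorem len_le_add_one_of_natAbs_le {a b c : ℤ} (h : c.natAbs ≤ a.natAbs + b.natAbs) :
    len c ≤ max (len a) (len b) + 1 := by
  rw [len_le_iff]
  have ha := natAbs_lt_of_len a
  have hb := natAbs_lt_of_len b
  have h1 := one_le_len a
  have h2 := one_le_len b
  obtain ⟨k, hk⟩ : ∃ k, max (len a) (len b) = k + 1 := ⟨max (len a) (len b) - 1, by omega⟩
  have ha' : 2 ^ (len a - 1) ≤ 2 ^ k := Nat.pow_le_pow_right (by norm_num) (by omega)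
  have hb' : 2 ^ (len b - 1) ≤ 2 ^ k := Nat.pow_le_pow_right (by norm_num) (by omega)
  rw [hk, pow_succ]
  omega

theorem len_add_le (a b : ℤ) : len (a + b) ≤ max (len a) (len b) + 1 :=
  len_le_add_one_of_natAbs_le (Int.natAbs_add_le a b)

theorem len_sub_le (a b : ℤ) : len (a - b) ≤ max (len a) (len b) + 1 :=
  len_le_add_one_of_natAbs_le (Int.natAbs_sub_le a b)

theorem len_mul_le (a b : ℤ) : len (a * b) ≤ len a + len b := by
  have ha := natAbs_lt_of_len a
  have hb := natAbs_lt_of_len b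
  have h1 := one_le_len a
  have h2 := one_le_len b
  have : len (a * b) ≤ (len a - 1 + (len b - 1)) + 1 := by
    rw [len_le_iff, Int.natAbs_mul, pow_add]
    exact Nat.mul_lt_mul'' ha hb
  omega

theorem len_ediv_le (a b : ℤ) : len (a / b) ≤ len a :=
  len_mono (Int.natAbs_ediv_le_natAbs a b)

theorem len_ite_le (p : Prop) [Decidable p] : len (if p then 1 else 0) ≤ 2 := by
  split_ifs <;> decide

/-! ### Expressions -/

/-- All words in the memory have binary length at most `B`. -/
structure State.BoundedBy (s : State) (B : ℕ) : Prop where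
  var : ∀ x, len (s.var x) ≤ B
  arr : ∀ A i, len (s.arr A i) ≤ B

theorem State.BoundedBy.mono {s : State} {B B' : ℕ} (h : s.BoundedBy B) (hB : B ≤ B') :
    s.BoundedBy B' :=
  ⟨fun x => (h.var x).trans hB, fun A i => (h.arr A i).trans hB⟩

theorem State.BoundedBy.one_le {s : State} {B : ℕ} (h : s.BoundedBy B) : 1 ≤ B :=
  (one_le_len _).trans (h.var 0)

namespace Expr

/-- A coefficient that bounds the cost of an expression in terms of the word length. -/
def coef : Expr → ℕ
  | const z => len z
  | var _ => 1
  | get _ i => i.coef + 1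
  | add e₁ e₂ => 2 * (e₁.coef + e₂.coef)
  | sub e₁ e₂ => 2 * (e₁.coef + e₂.coef)
  | mul e₁ e₂ => 2 * (e₁.coef + e₂.coef)
  | div e₁ e₂ => 2 * (e₁.coef + e₂.coef)
  | le e₁ e₂ => e₁.coef + e₂.coef + 2

theorem len_eval_le_cost (s : State) (e : Expr) : len (e.eval s) ≤ e.cost s := by
  cases e <;> simp only [cost, eval] <;> omega

/-- A sum or difference is at most one bit longer than its longer operand, and a product is no
longer than both operands together. Lengths are at least `1` and at most the costs, so each such
node at most doubles the cost of its operands. -/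
theorem cost_le {s : State} {B : ℕ} (h : s.BoundedBy B) (e : Expr) : e.cost s ≤ e.coef * B := by
  have hB := h.one_le
  induction e with
  | const z => simpa [cost, coef] using Nat.le_mul_of_pos_right _ hB
  | var x => simpa [cost, coef] using h.var x
  | get A i ih =>
    have := h.arr A (i.eval s)
    simp only [cost, coef, eval, add_mul, one_mul]; omega
  | add e₁ e₂ ih₁ ih₂ =>
    have := len_add_le (e₁.eval s) (e₂.eval s)
    have h1 := len_eval_le_cost s e₁
    have h2 := len_eval_le_cost s e₂
    have h3 := one_le_len (e₁.eval s)
    have h4 := one_le_len (e₂.eval s)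
    simp only [cost, coef, eval, add_mul, mul_assoc]; omega
  | sub e₁ e₂ ih₁ ih₂ =>
    have := len_sub_le (e₁.eval s) (e₂.eval s)
    have h1 := len_eval_le_cost s e₁
    have h2 := len_eval_le_cost s e₂
    have h3 := one_le_len (e₁.eval s)
    have h4 := one_le_len (e₂.eval s)
    simp only [cost, coef, eval, add_mul, mul_assoc]; omega
  | mul e₁ e₂ ih₁ ih₂ =>
    have := len_mul_le (e₁.eval s) (e₂.eval s)
    have h1 := len_eval_le_cost s e₁
    have h2 := len_eval_le_cost s e₂
    simp only [cost, coef, eval, add_mul, mul_assoc]; omega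
  | div e₁ e₂ ih₁ ih₂ =>
    have := len_ediv_le (e₁.eval s) (e₂.eval s)
    have h1 := len_eval_le_cost s e₁
    have h2 := len_eval_le_cost s e₂
    simp only [cost, coef, eval, add_mul, mul_assoc]; omega
  | le e₁ e₂ ih₁ ih₂ =>
    have := len_ite_le (e₁.eval s ≤ e₂.eval s)
    simp only [cost, coef, eval, add_mul]; omega

/-- Expressions whose values are not much longer than the words in the memory: multiplication is
restricted to factors from the input array `0`. -/
def lin : Expr → Bool
  | add e₁ e₂ => e₁.lin && e₂.lin
  | sub e₁ e₂ => e₁.lin && e₂.lin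
  | mul e₁ (get 0 _) => e₁.lin
  | mul _ _ => false
  | div e₁ _ => e₁.lin
  | _ => true

/-- A coefficient that bounds the growth of the word length. -/
def growth : Expr → ℕ
  | const z => len z
  | add e₁ e₂ => e₁.growth + e₂.growth + 1
  | sub e₁ e₂ => e₁.growth + e₂.growth + 1
  | mul e₁ _ => e₁.growth + 1
  | div e₁ _ => e₁.growth
  | le _ _ => 2
  | _ => 0

/-- Sums take the maximum of the operand lengths, so `B` enters only once. Each admitted product has
an input cell as its right factor and adds at most `G` bits. -/
theorem len_eval_le {s : State} {B G : ℕ} (h : s.BoundedBy B) (hG : ∀ i, len (s.arr 0 i) ≤ G)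
    (e : Expr) (he : e.lin = true) : len (e.eval s) ≤ B + e.growth * G := by
  have hG1 : 1 ≤ G := (one_le_len _).trans (hG 0)
  induction e with
  | const z =>
    have : len z * 1 ≤ len z * G := Nat.mul_le_mul_left _ hG1
    simp only [eval, growth]; omega
  | var x => simpa [eval, growth] using h.var x
  | get A i ih => simpa [eval, growth] using h.arr A (i.eval s)
  | add e₁ e₂ ih₁ ih₂ =>
    simp only [lin, Bool.and_eq_true] at he
    have h1 := ih₁ he.1
    have h2 := ih₂ he.2
    have := len_add_le (e₁.eval s) (e₂.eval s)
    simp only [eval, growth, add_mul, one_mul]; omega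
  | sub e₁ e₂ ih₁ ih₂ =>
    simp only [lin, Bool.and_eq_true] at he
    have h1 := ih₁ he.1
    have h2 := ih₂ he.2
    have := len_sub_le (e₁.eval s) (e₂.eval s)
    simp only [eval, growth, add_mul, one_mul]; omega
  | mul e₁ e₂ ih₁ ih₂ =>
    have := len_mul_le (e₁.eval s) (e₂.eval s)
    cases e₂ with
    | get A i =>
      cases A with
      | zero =>
        have h1 := ih₁ he
        have h2 := hG (i.eval s)
        simp only [eval, growth, add_mul, one_mul] at *; omega
      | succ A => simp [lin] at he
    | _ => simp [lin] at he
  | div e₁ e₂ ih₁ ih₂ =>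
    simp only [lin] at he
    have h1 := ih₁ he
    have := len_ediv_le (e₁.eval s) (e₂.eval s)
    simp only [eval, growth]; omega
  | le e₁ e₂ ih₁ ih₂ =>
    have := len_ite_le (e₁.eval s ≤ e₂.eval s)
    simp only [eval, growth]; omega

/-- The test that an expression represents. -/
def Holds (s : State) (e : Expr) : Prop := e.eval s ≠ 0

instance (s : State) (e : Expr) : Decidable (e.Holds s) :=
  inferInstanceAs (Decidable (e.eval s ≠ 0))

/-- The test `e₁ < e₂`. -/
def lt (e₁ e₂ : Expr) : Expr := le (add e₁ (const 1)) e₂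

/-- The conjunction of two tests. -/
def and (e₁ e₂ : Expr) : Expr := mul e₁ e₂

/-- The negation of a test. -/
def not (e : Expr) : Expr := and (le e (const 0)) (le (const 0) e)

/-- The disjunction of two tests. -/
def or (e₁ e₂ : Expr) : Expr := not (and (not e₁) (not e₂))

/-- The test `e₁ = e₂`. -/
def eq (e₁ e₂ : Expr) : Expr := and (le e₁ e₂) (le e₂ e₁)

variable {s : State} {e₁ e₂ : Expr}

@[simp] theorem holds_le : (le e₁ e₂).Holds s ↔ e₁.eval s ≤ e₂.eval s := by
  simp [Holds, eval]

@[simp] theorem holds_lt : (lt e₁ e₂).Holds s ↔ e₁.eval s < e₂.eval s := by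
  simp [lt, eval]

@[simp] theorem holds_and : (and e₁ e₂).Holds s ↔ e₁.Holds s ∧ e₂.Holds s := by
  simp [Holds, eval, and]

@[simp] theorem holds_not : (not e₁).Holds s ↔ ¬ e₁.Holds s := by
  rw [not, holds_and, holds_le, holds_le, Holds]; simp only [eval]; omega

@[simp] theorem holds_or : (or e₁ e₂).Holds s ↔ e₁.Holds s ∨ e₂.Holds s := by
  simp only [or, holds_and, holds_not]; tauto

@[simp] theorem holds_eq : (eq e₁ e₂).Holds s ↔ e₁.eval s = e₂.eval s := by
  simp [eq, le_antisymm_iff]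

attribute [simp] eval

end Expr

namespace State

variable (s : State) (x y A A' : ℕ) (z i : ℤ)

@[simp] theorem var_setVar : (s.setVar x z).var y = if y = x then z else s.var y := by
  simp [setVar, Function.update_apply]

@[simp] theorem arr_setVar : (s.setVar x z).arr = s.arr := rfl

@[simp] theorem var_setArr : (s.setArr A i z).var = s.var := rfl

@[simp] theorem arr_setArr :
    (s.setArr A i z).arr A' = if A' = A then Function.update (s.arr A) i z else s.arr A' := by
  simp [setArr, Function.update_apply]

variable {s}

theorem BoundedBy.setVar {B : ℕ} (h : s.BoundedBy B) {x : ℕ} {z : ℤ} (hz : len z ≤ B) :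
    (s.setVar x z).BoundedBy B := by
  refine ⟨fun y => ?_, h.arr⟩
  rw [var_setVar]; split_ifs
  exacts [hz, h.var y]

theorem BoundedBy.setArr {B : ℕ} (h : s.BoundedBy B) {A : ℕ} {i z : ℤ} (hz : len z ≤ B) :
    (s.setArr A i z).BoundedBy B := by
  refine ⟨h.var, fun A' j => ?_⟩
  rw [arr_setArr]; split_ifs
  · rw [Function.update_apply]; split_ifs
    exacts [hz, h.arr A j]
  · exact h.arr A' j

end State

end RAM

namespace RAM

/-! ### Programs with bounded loops -/

/-- Programs whose only loops are counting loops. `store A i e` has an effect only for addresses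
`i` that are nonnegative and less than the value of variable `5`; `loop x b c` executes `c` for all
values of `x` from `0` up to, but excluding, the value of variable `b`. -/
inductive Prog where
  | skip
  | assign (x : ℕ) (e : Expr)
  | store (A : ℕ) (i e : Expr)
  | seq (c₁ c₂ : Prog)
  | ite (e : Expr) (c₁ c₂ : Prog)
  | loop (x b : ℕ) (c : Prog)

/-- The state after `k` rounds of a counting loop with the body `f`. -/
def loopState (f : State → State) (x : ℕ) (s : State) : ℕ → State
  | 0 => s.setVar x 0
  | k + 1 => (f (loopState f x s k)).setVar x (k + 1)

/-- The counter is set explicitly after each round, so nothing is assumed about `f`. The compiled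
loop increments it instead, which agrees when the body leaves the counter alone. -/
theorem var_loopState (f : State → State) (x : ℕ) (s : State) (k : ℕ) :
    (loopState f x s k).var x = k := by
  cases k <;> simp [loopState]

namespace Prog

/-- The test whether an address may be written to. -/
def guard (i : Expr) : Expr := .and (.le (.const 0) i) (.lt i (.var 5))

/-- The effect of a program. -/
def den : Prog → State → State
  | skip, s => s
  | assign x e, s => s.setVar x (e.eval s)
  | store A i e, s =>
      if 0 ≤ i.eval s ∧ i.eval s < s.var 5 then s.setArr A (i.eval s) (e.eval s) else s
  | seq c₁ c₂, s => c₂.den (c₁.den s)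
  | ite e c₁ c₂, s => if e.Holds s then c₁.den s else c₂.den s
  | loop x b c, s => loopState c.den x s (s.var b).toNat

theorem den_seq (c₁ c₂ : Prog) (s : State) : (seq c₁ c₂).den s = c₂.den (c₁.den s) := rfl

/-- The number of steps of a program. -/
def steps : Prog → State → ℕ
  | seq c₁ c₂, s => c₁.steps s + c₂.steps (c₁.den s)
  | ite e c₁ c₂, s => 1 + if e.Holds s then c₁.steps s else c₂.steps s
  | loop x b c, s =>
      1 + ∑ k ∈ Finset.range (s.var b).toNat, (c.steps (loopState c.den x s k) + 1)
  | _, _ => 1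

/-- The translation of a program into a while-program. -/
def compile : Prog → Cmd
  | skip => .skip
  | assign x e => .assign x e
  | store A i e => .ite (guard i) (.store A i e) .skip
  | seq c₁ c₂ => .seq c₁.compile c₂.compile
  | ite e c₁ c₂ => .ite e c₁.compile c₂.compile
  | loop x b c => .seq (.assign x (.const 0))
      (.while (.lt (.var x) (.var b)) (.seq c.compile (.assign x (.add (.var x) (.const 1)))))

/-- The variables that a program may change. -/
def vars : Prog → List ℕ
  | assign x _ => [x]
  | seq c₁ c₂ => c₁.vars ++ c₂.vars
  | ite _ c₁ c₂ => c₁.vars ++ c₂.vars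
  | loop x _ c => x :: c.vars
  | _ => []

/-- The arrays that a program may change. -/
def arrs : Prog → List ℕ
  | store A _ _ => [A]
  | seq c₁ c₂ => c₁.arrs ++ c₂.arrs
  | ite _ c₁ c₂ => c₁.arrs ++ c₂.arrs
  | loop _ _ c => c.arrs
  | _ => []

/-- The frame rule. Since `vars` is computed from the syntax, its side condition is settled by
`decide` for every concrete program. -/
theorem var_den {y : ℕ} (c : Prog) (s : State) (hy : y ∉ c.vars) :
    (c.den s).var y = s.var y := by
  induction c generalizing s with
  | skip => rfl
  | assign x e => simp only [vars, List.mem_singleton] at hy; simp [den, hy]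
  | store A i e => rw [den]; split_ifs <;> simp
  | seq c₁ c₂ ih₁ ih₂ =>
    simp only [vars, List.mem_append, not_or] at hy
    rw [den, ih₂ _ hy.2, ih₁ _ hy.1]
  | ite e c₁ c₂ ih₁ ih₂ =>
    simp only [vars, List.mem_append, not_or] at hy
    rw [den]; split_ifs
    exacts [ih₁ _ hy.1, ih₂ _ hy.2]
  | loop x b c ih =>
    simp only [vars, List.mem_cons, not_or] at hy
    rw [den]
    generalize (s.var b).toNat = k
    induction k with
    | zero => simp [loopState, hy.1]
    | succ k ihk => simp [loopState, hy.1, ih _ hy.2, ihk]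

theorem arr_den {A : ℕ} (c : Prog) (s : State) (hA : A ∉ c.arrs) :
    (c.den s).arr A = s.arr A := by
  induction c generalizing s with
  | skip => rfl
  | assign x e => rfl
  | store A i e =>
    simp only [arrs, List.mem_singleton] at hA
    rw [den]; split_ifs <;> simp [hA]
  | seq c₁ c₂ ih₁ ih₂ =>
    simp only [arrs, List.mem_append, not_or] at hA
    rw [den, ih₂ _ hA.2, ih₁ _ hA.1]
  | ite e c₁ c₂ ih₁ ih₂ =>
    simp only [arrs, List.mem_append, not_or] at hA
    rw [den]; split_ifs
    exacts [ih₁ _ hA.1, ih₂ _ hA.2]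
  | loop x b c ih =>
    simp only [arrs] at hA
    rw [den]
    generalize (s.var b).toNat = k
    induction k with
    | zero => simp [loopState]
    | succ k ihk => simp [loopState, ih _ hA, ihk]

/-- Cells outside of the range given by variable `5` do not change. -/
theorem arr_den_of_not_mem (c : Prog) (s : State) (hc : 5 ∉ c.vars) {A : ℕ} {i : ℤ}
    (hi : ¬ (0 ≤ i ∧ i < s.var 5)) : (c.den s).arr A i = s.arr A i := by
  induction c generalizing s with
  | skip => rfl
  | assign x e => rfl
  | store B j e =>
    rw [den]; split_ifs with h
    · have hij : i ≠ j.eval s := by rintro rfl; exact hi h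
      rw [State.arr_setArr]; split_ifs with hA
      · subst hA; simp [hij]
      · rfl
    · rfl
  | seq c₁ c₂ ih₁ ih₂ =>
    simp only [vars, List.mem_append, not_or] at hc
    rw [den, ih₂ _ hc.2 (by rwa [var_den _ _ hc.1]), ih₁ _ hc.1 hi]
  | ite e c₁ c₂ ih₁ ih₂ =>
    simp only [vars, List.mem_append, not_or] at hc
    rw [den]; split_ifs
    exacts [ih₁ _ hc.1 hi, ih₂ _ hc.2 hi]
  | loop x b c ih =>
    simp only [vars, List.mem_cons, not_or] at hc
    rw [den]
    generalize (s.var b).toNat = k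
    suffices h : (loopState c.den x s k).var 5 = s.var 5 ∧
        (loopState c.den x s k).arr A i = s.arr A i from h.2
    induction k with
    | zero => simp [loopState, hc.1]
    | succ k ihk =>
      simp only [loopState, State.var_setVar, State.arr_setVar, if_neg hc.1]
      rw [var_den _ _ hc.2, ih _ hc.2 (by rwa [ihk.1])]
      exact ihk

/-- The states `s` and `s'` differ only in what the program `c` may change. -/
structure Frame (c : Prog) (s s' : State) : Prop where
  var : ∀ y, y ∉ c.vars → s'.var y = s.var y
  arr : ∀ A, A ∉ c.arrs → s'.arr A = s.arr A

/-- The rule for loops: what is invariant under the body holds in all rounds. -/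
theorem loopState_induction {c : Prog} {x b : ℕ} {s : State} (I : ℕ → State → Prop)
    (h0 : I 0 (s.setVar x 0))
    (hs : ∀ (k : ℕ) (s' : State), (k : ℤ) < s.var b → s'.var x = k → Frame (loop x b c) s s' →
      I k s' → I (k + 1) ((c.den s').setVar x (k + 1))) (k : ℕ) (hk : k ≤ (s.var b).toNat) :
    Frame (loop x b c) s (loopState c.den x s k) ∧ I k (loopState c.den x s k) := by
  induction k with
  | zero =>
    refine ⟨⟨fun y hy => ?_, fun A _ => rfl⟩, h0⟩
    simp only [vars, List.mem_cons, not_or] at hy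
    simp [loopState, hy.1]
  | succ k ih =>
    obtain ⟨h1, h2⟩ := ih (by omega)
    refine ⟨⟨fun y hy => ?_, fun A hA => ?_⟩, hs k _ (by omega) (var_loopState _ _ _ _) h1 h2⟩
    · rw [← h1.var y hy]
      simp only [vars, List.mem_cons, not_or] at hy
      simp [loopState, hy.1, var_den _ _ hy.2]
    · rw [← h1.arr A hA]
      simp only [arrs] at hA
      simp [loopState, arr_den _ _ hA]

/-- What is invariant under the body of a loop holds at the end. -/
theorem loop_induction {c : Prog} {x b : ℕ} {s : State} (I : ℕ → State → Prop)
    (h0 : I 0 (s.setVar x 0))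
    (hs : ∀ (k : ℕ) (s' : State), (k : ℤ) < s.var b → s'.var x = k → Frame (loop x b c) s s' →
      I k s' → I (k + 1) ((c.den s').setVar x (k + 1))) :
    I (s.var b).toNat ((loop x b c).den s) :=
  (loopState_induction I h0 hs _ le_rfl).2

/-! ### Running times -/

/-- Programs in which only short values are computed and the loops are controlled properly. -/
def lin : Prog → Bool
  | skip => true
  | assign _ e => e.lin
  | store A _ e => A != 0 && e.lin
  | seq c₁ c₂ => c₁.lin && c₂.lin
  | ite _ c₁ c₂ => c₁.lin && c₂.lin
  | loop x b c => c.lin && x != b && !(c.vars.contains x) && !(c.vars.contains b)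

/-- A coefficient that bounds the growth of the word length per step. -/
def growth : Prog → ℕ
  | skip => 0
  | assign _ e => e.growth
  | store _ _ e => e.growth
  | seq c₁ c₂ => c₁.growth + c₂.growth
  | ite _ c₁ c₂ => c₁.growth + c₂.growth
  | loop _ _ c => c.growth

/-- A coefficient that bounds the cost of a single step. -/
def coef : Prog → ℕ
  | skip => 1
  | assign _ e => e.coef + 1
  | store _ i e => (guard i).coef + i.coef + e.coef + 2
  | seq c₁ c₂ => c₁.coef + c₂.coef
  | ite e c₁ c₂ => e.coef + 1 + c₁.coef + c₂.coef
  | loop _ _ c => c.coef + 40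

/-- `lin` forbids stores into array `0`, so the bound on the input words stays valid during the
whole run. -/
theorem arr_zero_den (c : Prog) (hc : c.lin = true) (s : State) : (c.den s).arr 0 = s.arr 0 := by
  apply arr_den
  induction c with
  | skip => simp [arrs]
  | assign x e => simp [arrs]
  | store A i e => simp only [lin, Bool.and_eq_true, bne_iff_ne] at hc; simp [arrs, hc.1.symm]
  | seq c₁ c₂ ih₁ ih₂ =>
    simp only [lin, Bool.and_eq_true] at hc; simp [arrs, ih₁ hc.1, ih₂ hc.2]
  | ite e c₁ c₂ ih₁ ih₂ =>
    simp only [lin, Bool.and_eq_true] at hc; simp [arrs, ih₁ hc.1, ih₂ hc.2]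
  | loop x b c ih =>
    simp only [lin, Bool.and_eq_true] at hc; simp [arrs, ih hc.1.1.1]

/-- The running time of a counting loop, in terms of the running times of the rounds. -/
theorem run_loop {c : Prog} {x b : ℕ} {s : State} {B : ℕ} {T : ℕ → ℕ}
    (hxb : x ≠ b) (hx : x ∉ c.vars) (hb : b ∉ c.vars)
    (hB : ∀ k ≤ (s.var b).toNat, (loopState c.den x s k).BoundedBy B)
    (hT : ∀ k < (s.var b).toNat, ∃ t ≤ T k,
      Run c.compile (loopState c.den x s k) t (c.den (loopState c.den x s k))) :
    ∃ t ≤ 40 * B + ∑ k ∈ Finset.range (s.var b).toNat, (T k + 40 * B),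
      Run (loop x b c).compile s t ((loop x b c).den s) := by
  set N := (s.var b).toNat with hN
  set S := loopState c.den x s
  have hSb : ∀ k, (S k).var b = s.var b := by
    intro k
    induction k with
    | zero => simp [S, loopState, hxb.symm]
    | succ k ih => simp only [S, loopState, State.var_setVar, if_neg hxb.symm, var_den _ _ hb]
                   exact ih
  -- The test and the increment have coefficients at most `16`. With their unit costs they take at
  -- most `17 * B` and `20 * B`, so `40 * B` pays for the overhead of one round.
  have htest : ∀ k ≤ N, (Expr.lt (.var x) (.var b)).cost (S k) + 1 ≤ 17 * B := by
    intro k hk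
    have h1 := Expr.cost_le (hB k hk) (Expr.lt (.var x) (.var b))
    have h2 : (Expr.lt (.var x) (.var b)).coef ≤ 16 := by
      simp only [Expr.lt, Expr.coef]; decide
    have := Nat.mul_le_mul_right B h2
    have := (hB k hk).one_le
    omega
  -- Induction on the number `j` of rounds that remain, since a run of a while-loop is built from
  -- its end.
  have main : ∀ j k, j + k = N → ∃ t ≤ 17 * B + ∑ i ∈ Finset.Ico k N, (T i + 40 * B),
      Run (.while (.lt (.var x) (.var b)) (.seq c.compile (.assign x (.add (.var x) (.const 1)))))
        (S k) t (S N) := by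
    intro j
    induction j with
    | zero =>
      intro k hk
      obtain rfl : k = N := by omega
      refine ⟨_, ?_, Run.while_false ?_⟩
      · simpa using htest N le_rfl
      · rw [← not_ne_iff]
        change ¬ Expr.Holds _ _
        simp [hSb, S, var_loopState]
        omega
    | succ j ih =>
      intro k hk
      obtain ⟨t, ht, hrun⟩ := ih (k + 1) (by omega)
      obtain ⟨t', ht', hrun'⟩ := hT k (by omega)
      have h1 := htest k (by omega)
      have hval : (Expr.add (.var x) (.const 1)).eval (c.den (S k)) = k + 1 := by
        simp [var_den _ _ hx, S, var_loopState]
      have hcost : (Expr.add (.var x) (.const 1)).cost (c.den (S k)) + 1 ≤ 20 * B := by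
        have e1 : (Expr.add (.var x) (.const 1)).cost (c.den (S k)) =
            (Expr.add (.var x) (.const 1)).cost (S k) := by
          simp [Expr.cost, var_den _ _ hx]
        have h1 := Expr.cost_le (hB k (by omega)) (Expr.add (.var x) (.const 1))
        have h2 : (Expr.add (.var x) (.const 1)).coef ≤ 16 := by
          simp only [Expr.coef]; decide
        have := Nat.mul_le_mul_right B h2
        have := (hB k (by omega)).one_le
        omega
      have hass := Run.assign (c.den (S k)) x (.add (.var x) (.const 1))
      rw [hval] at hass
      refine ⟨_, ?_, Run.while_true ?_ (Run.seq hrun' hass) hrun⟩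
      · rw [Finset.sum_eq_sum_Ico_succ_bot (by omega)]
        omega
      · change Expr.Holds _ _
        simp [hSb, S, var_loopState]
        omega
  obtain ⟨t, ht, hrun⟩ := main N 0 (by omega)
  refine ⟨_, ?_, Run.seq (Run.assign s x (.const 0)) hrun⟩
  have : (Expr.const 0).cost s = 1 := rfl
  have := (hB 0 (by omega)).one_le
  rw [Finset.range_eq_Ico]
  omega

/-- Words grow slowly, and the running time is at most proportional to the product of the number
of steps and the word length. -/
theorem run_den (c : Prog) (hc : c.lin = true) {s : State} {B G : ℕ} (h : s.BoundedBy B)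
    (hG : ∀ i, len (s.arr 0 i) ≤ G) :
    (c.den s).BoundedBy (B + c.growth * G * c.steps s) ∧
      ∀ B', B + c.growth * G * c.steps s ≤ B' →
        ∃ t ≤ c.coef * B' * c.steps s, Run c.compile s t (c.den s) := by
  -- The time bound is claimed for every larger `B'` so that the parts of a sequence and the rounds
  -- of a loop can all be charged with the common final word length.
  induction c generalizing s B with
  | skip =>
    refine ⟨h.mono (Nat.le_add_right _ _), fun B' hB' => ⟨1, ?_, Run.skip s⟩⟩
    have := h.one_le
    simp only [coef, steps]; omega
  | assign x e =>
    simp only [lin] at hc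
    have h1 := Expr.len_eval_le h hG e hc
    refine ⟨?_, fun B' hB' => ⟨_, ?_, Run.assign s x e⟩⟩
    · simp only [growth, steps, mul_one, den]
      exact (h.mono (Nat.le_add_right _ _)).setVar h1
    · have h2 := Expr.cost_le (h.mono ((Nat.le_add_right _ _).trans hB')) e
      have := h.one_le
      simp only [coef, steps, mul_one, add_mul, one_mul]; omega
  | store A i e =>
    simp only [lin, Bool.and_eq_true] at hc
    have h1 := Expr.len_eval_le h hG e hc.2
    refine ⟨?_, fun B' hB' => ?_⟩
    · simp only [growth, steps, mul_one, den]
      split_ifs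
      exacts [(h.mono (Nat.le_add_right _ _)).setArr h1, h.mono (Nat.le_add_right _ _)]
    · have hb := h.mono ((Nat.le_add_right _ _).trans hB')
      have h2 := Expr.cost_le hb (guard i)
      have h3 := Expr.cost_le hb i
      have h4 := Expr.cost_le hb e
      have h5 := hb.one_le
      have hg : (guard i).Holds s ↔ 0 ≤ i.eval s ∧ i.eval s < s.var 5 := by simp [guard]
      by_cases hi : (guard i).Holds s
      · refine ⟨_, ?_, by
          rw [den, if_pos (hg.1 hi)]; exact Run.ite_true hi (Run.store s A i e)⟩
        simp only [coef, steps, mul_one, add_mul]; omega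
      · refine ⟨_, ?_, by
          rw [den, if_neg (mt hg.2 hi)]; exact Run.ite_false (not_ne_iff.1 hi) (Run.skip s)⟩
        simp only [coef, steps, mul_one, add_mul]; omega
  | seq c₁ c₂ ih₁ ih₂ =>
    simp only [lin, Bool.and_eq_true] at hc
    obtain ⟨h1, h1'⟩ := ih₁ hc.1 h hG
    obtain ⟨h2, h2'⟩ := ih₂ hc.2 h1 (by rwa [arr_zero_den _ hc.1])
    have key : B + c₁.growth * G * c₁.steps s + c₂.growth * G * c₂.steps (c₁.den s) ≤
        B + (seq c₁ c₂).growth * G * (seq c₁ c₂).steps s := by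
      simp only [growth, steps]; nlinarith [Nat.zero_le (c₁.growth * G * c₂.steps (c₁.den s)),
        Nat.zero_le (c₂.growth * G * c₁.steps s)]
    refine ⟨h2.mono key, fun B' hB' => ?_⟩
    obtain ⟨t1, ht1, hr1⟩ := h1' B' (by omega)
    obtain ⟨t2, ht2, hr2⟩ := h2' B' (by omega)
    refine ⟨_, ?_, Run.seq hr1 hr2⟩
    simp only [coef, steps]
    nlinarith [Nat.zero_le (c₁.coef * B' * c₂.steps (c₁.den s)),
        Nat.zero_le (c₂.coef * B' * c₁.steps s)]
  | ite e c₁ c₂ ih₁ ih₂ =>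
    simp only [lin, Bool.and_eq_true] at hc
    by_cases he : e.Holds s
    · obtain ⟨h1, h1'⟩ := ih₁ hc.1 h hG
      have key : B + c₁.growth * G * c₁.steps s ≤
          B + (ite e c₁ c₂).growth * G * (ite e c₁ c₂).steps s := by
        simp only [growth, steps, if_pos he]; gcongr <;> omega
      refine ⟨by rw [den, if_pos he]; exact h1.mono key, fun B' hB' => ?_⟩
      obtain ⟨t1, ht1, hr1⟩ := h1' B' (by omega)
      refine ⟨_, ?_, by rw [den, if_pos he]; exact Run.ite_true he hr1⟩
      -- The test may contain products that `lin` excludes: its value is not stored, so only its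
      -- cost matters.
      have h2 := Expr.cost_le (h.mono ((Nat.le_add_right _ _).trans hB')) e
      have h3 := h.one_le
      simp only [coef, steps, if_pos he, add_mul, mul_add, mul_one, one_mul]
      have := Nat.zero_le (e.coef * B' * c₁.steps s)
      omega
    · obtain ⟨h1, h1'⟩ := ih₂ hc.2 h hG
      have key : B + c₂.growth * G * c₂.steps s ≤
          B + (ite e c₁ c₂).growth * G * (ite e c₁ c₂).steps s := by
        simp only [growth, steps, if_neg he]; gcongr <;> omega
      refine ⟨by rw [den, if_neg he]; exact h1.mono key, fun B' hB' => ?_⟩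
      obtain ⟨t1, ht1, hr1⟩ := h1' B' (by omega)
      refine ⟨_, ?_, by rw [den, if_neg he]; exact Run.ite_false (not_ne_iff.1 he) hr1⟩
      have h2 := Expr.cost_le (h.mono ((Nat.le_add_right _ _).trans hB')) e
      have h3 := h.one_le
      simp only [coef, steps, if_neg he, add_mul, mul_add, mul_one, one_mul]
      have := Nat.zero_le (e.coef * B' * c₂.steps s)
      omega
  | loop x b c ih =>
    simp only [lin, Bool.and_eq_true, bne_iff_ne, Bool.not_eq_true', List.contains_eq_mem,
      decide_eq_false_iff_not] at hc
    obtain ⟨⟨⟨hc, hxb⟩, hx⟩, hb⟩ := hc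
    set N := (s.var b).toNat
    set S := loopState c.den x s with hS
    set σ : ℕ → ℕ := fun k => ∑ i ∈ Finset.range k, (c.steps (S i) + 1) with hσ
    have hSG : ∀ k i, len ((S k).arr 0 i) ≤ G := by
      intro k
      induction k with
      | zero => exact hG
      | succ k ihk => simpa [hS, loopState, arr_zero_den _ hc] using ihk
    have hSB : ∀ k ≤ N, (S k).BoundedBy (B + c.growth * G * σ k) := by
      intro k
      induction k with
      | zero => exact fun _ => by simpa [hσ, hS, loopState] using h.setVar (x := x) (z := 0) h.one_le
      | succ k ihk =>
        intro hk
        have h1 := (ih hc (ihk (by omega)) (hSG k)).1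
        have h2 : B + c.growth * G * σ k + c.growth * G * c.steps (S k) ≤
            B + c.growth * G * σ (k + 1) := by
          simp only [hσ, Finset.sum_range_succ, mul_add]; omega
        refine (h1.mono h2).setVar ?_
        -- The counter never exceeds variable `b`, so it is no longer than that word and causes no
        -- growth.
        refine ((len_mono ?_).trans (h.var b)).trans (Nat.le_add_right _ _)
        have : N = (s.var b).toNat := rfl
        omega
    have hstep : (loop x b c).steps s = 1 + σ N := rfl
    have hmono : ∀ k ≤ N, σ k ≤ σ N := fun k hk =>
      Finset.sum_le_sum_of_subset (Finset.range_mono hk)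
    have hle : ∀ k ≤ N, B + c.growth * G * σ k ≤
        B + (loop x b c).growth * G * (loop x b c).steps s := by
      intro k hk
      rw [hstep]
      have := Nat.mul_le_mul_left (c.growth * G) (hmono k hk)
      simp only [growth, mul_add]; omega
    refine ⟨(hSB N le_rfl).mono (hle N le_rfl), fun B' hB' => ?_⟩
    obtain ⟨t, ht, hrun⟩ := run_loop (B := B') (T := fun k => c.coef * B' * c.steps (S k)) hxb hx hb
      (fun k hk => (hSB k hk).mono ((hle k hk).trans hB')) (fun k hk => by
        refine (ih hc (hSB k hk.le) (hSG k)).2 B' (le_trans ?_ ((hle (k + 1) hk).trans hB'))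
        simp only [hσ, Finset.sum_range_succ, mul_add]
        omega)
    refine ⟨t, ht.trans ?_, hrun⟩
    rw [hstep, coef]
    have : ∑ k ∈ Finset.range N, (c.coef * B' * c.steps (S k) + 40 * B') ≤
        (c.coef + 40) * B' * σ N := by
      rw [hσ, Finset.mul_sum]
      refine Finset.sum_le_sum fun k _ => ?_
      nlinarith [Nat.zero_le (c.coef * B'), Nat.zero_le (B' * c.steps (S k))]
    rw [mul_add, mul_one]
    nlinarith [Nat.zero_le (c.coef * B')]

/-- The loops are controlled by the variables `1`, …, `6`, which do not change. -/
def static : Prog → Bool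
  | assign x _ => !decide (x ∈ Finset.Icc 1 6)
  | seq c₁ c₂ => c₁.static && c₂.static
  | ite _ c₁ c₂ => c₁.static && c₂.static
  | loop x b c => !decide (x ∈ Finset.Icc 1 6) && decide (b ∈ Finset.Icc 1 6) && c.static
  | _ => true

/-- A polynomial bound for the number of steps. -/
noncomputable def stepsPoly : Prog → Polynomial ℕ
  | seq c₁ c₂ => c₁.stepsPoly + c₂.stepsPoly
  | ite _ c₁ c₂ => 1 + c₁.stepsPoly + c₂.stepsPoly
  | loop _ _ c => 1 + Polynomial.X * (c.stepsPoly + 1)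
  | _ => 1

theorem not_mem_vars_of_static {c : Prog} (hc : c.static = true) {b : ℕ}
    (hb : b ∈ Finset.Icc 1 6) : b ∉ c.vars := by
  induction c with
  | skip => simp [vars]
  | assign x e =>
    simp only [static, Bool.not_eq_true', decide_eq_false_iff_not] at hc
    simp only [vars, List.mem_singleton]; rintro rfl; exact hc hb
  | store A i e => simp [vars]
  | seq c₁ c₂ ih₁ ih₂ =>
    simp only [static, Bool.and_eq_true] at hc; simp [vars, ih₁ hc.1, ih₂ hc.2]
  | ite e c₁ c₂ ih₁ ih₂ =>
    simp only [static, Bool.and_eq_true] at hc; simp [vars, ih₁ hc.1, ih₂ hc.2]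
  | loop x b c ih =>
    simp only [static, Bool.and_eq_true, Bool.not_eq_true', decide_eq_false_iff_not] at hc
    simp only [vars, List.mem_cons, not_or, ih hc.2, not_false_eq_true, and_true]
    rintro rfl; exact hc.1.1 hb

/-- A static program never assigns the variables `1`, …, `6` that control its loops. Hence every
loop, at any depth of nesting, makes at most `R` rounds. -/
theorem steps_le (c : Prog) (hc : c.static = true) {s : State} {R : ℕ}
    (hR : ∀ b ∈ Finset.Icc 1 6, s.var b ≤ R) : c.steps s ≤ c.stepsPoly.eval R := by
  induction c generalizing s with
  | skip => simp [steps, stepsPoly]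
  | assign x e => simp [steps, stepsPoly]
  | store A i e => simp [steps, stepsPoly]
  | seq c₁ c₂ ih₁ ih₂ =>
    simp only [static, Bool.and_eq_true] at hc
    simp only [steps, stepsPoly, Polynomial.eval_add]
    exact Nat.add_le_add (ih₁ hc.1 hR) (ih₂ hc.2 fun b hb => by
      rw [var_den _ _ (not_mem_vars_of_static hc.1 hb)]; exact hR b hb)
  | ite e c₁ c₂ ih₁ ih₂ =>
    simp only [static, Bool.and_eq_true] at hc
    have h1 := ih₁ hc.1 hR
    have h2 := ih₂ hc.2 hR
    simp only [steps, stepsPoly, Polynomial.eval_add, Polynomial.eval_one]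
    split_ifs <;> omega
  | loop x b c ih =>
    simp only [static, Bool.and_eq_true, Bool.not_eq_true', decide_eq_false_iff_not,
      decide_eq_true_eq] at hc
    obtain ⟨⟨hx, hb⟩, hc⟩ := hc
    have hS : ∀ k, ∀ b ∈ Finset.Icc 1 6, (loopState c.den x s k).var b ≤ R := by
      intro k b hb
      have hbx : b ≠ x := by rintro rfl; exact hx hb
      induction k with
      | zero => simpa [loopState, hbx] using hR b hb
      | succ k ihk =>
        simpa [loopState, hbx, var_den _ _ (not_mem_vars_of_static hc hb)] using ihk
    simp only [steps, stepsPoly, Polynomial.eval_add, Polynomial.eval_one, Polynomial.eval_mul,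
      Polynomial.eval_X]
    refine Nat.add_le_add_left ?_ 1
    calc ∑ k ∈ Finset.range (s.var b).toNat, (c.steps (loopState c.den x s k) + 1)
        ≤ ∑ _k ∈ Finset.range (s.var b).toNat, (c.stepsPoly.eval R + 1) :=
          Finset.sum_le_sum fun k _ => Nat.succ_le_succ (ih hc (hS k))
      _ = (s.var b).toNat * (c.stepsPoly.eval R + 1) := by simp
      _ ≤ R * (c.stepsPoly.eval R + 1) :=
          Nat.mul_le_mul_right _ (by have := hR b hb; omega)

end Prog

end RAM

/-! ## The Hungarian method -/

namespace Hungarian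

/-- Feasible dual variables `U`, `V` for the weights `W`; `RM i = j + 1` means that row `i` is
matched to column `j`, and `CM j = i + 1` that column `j` is matched to row `i`. -/
structure Dual (n N : ℤ) (W : ℤ → ℤ → ℤ) (U V RM CM : ℤ → ℤ) : Prop where
  feas : ∀ i j, 0 ≤ i → i < n → 0 ≤ j → j < N → W i j ≤ U i + V j
  nonneg : ∀ j, 0 ≤ j → j < N → 0 ≤ V j
  free : ∀ j, 0 ≤ j → j < N → CM j = 0 → V j = 0
  tight : ∀ i j, 0 ≤ i → i < n → 0 ≤ j → j < N → RM i = j + 1 → U i + V j = W i j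
  row : ∀ i, 0 ≤ i → i < n → 0 ≤ RM i ∧ RM i ≤ N
  col : ∀ j, 0 ≤ j → j < N → 0 ≤ CM j ∧ CM j ≤ n

/-- The two descriptions of the matching agree, except for the column `e`. -/
def Agree (n N : ℤ) (RM CM : ℤ → ℤ) (e : ℤ) : Prop :=
  ∀ i j, 0 ≤ i → i < n → 0 ≤ j → j < N → (RM i = j + 1 ↔ CM j = i + 1 ∧ j ≠ e)

/-- Exactly the rows before `k` are matched. -/
def Rows (n k : ℤ) (RM : ℤ → ℤ) : Prop := ∀ i, 0 ≤ i → i < n → (RM i = 0 ↔ k ≤ i)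

/-- An alternating tree with root `k` and `t` columns. -/
structure Tree (n N : ℤ) (W : ℤ → ℤ → ℤ) (U V CM : ℤ → ℤ) (k : ℤ) (IR IU PA : ℤ → ℤ) (t : ℕ) :
    Prop where
  root : IR k = 1
  row : ∀ i, 0 ≤ i → i < n → IR i = 1 → i = k ∨ ∃ j, 0 ≤ j ∧ j < N ∧ IU j = 1 ∧ CM j = i + 1
  zero_one : ∀ j, 0 ≤ j → j < N → IU j = 0 ∨ IU j = 1
  col : ∀ j, 0 ≤ j → j < N → IU j = 1 → CM j ≠ 0 ∧ IR (CM j - 1) = 1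
  parent : ∀ j, 0 ≤ j → j < N → IU j = 1 →
    0 ≤ PA j ∧ PA j < n ∧ IR (PA j) = 1 ∧ U (PA j) + V j = W (PA j) j
  rank : ∃ rk : ℤ → ℤ, ∀ j, 0 ≤ j → j < N → IU j = 1 → 0 ≤ rk j ∧ rk j < t ∧
    (PA j = k ∨ ∃ j', 0 ≤ j' ∧ j' < N ∧ IU j' = 1 ∧ rk j' < rk j ∧ CM j' = PA j + 1)
  card : ((Finset.Ico 0 N).filter fun j => IU j = 1).card = t

/-- An alternating path of length at most `r` from column `e` to the root `k`. -/
def Path (n N : ℤ) (W : ℤ → ℤ → ℤ) (U V CM : ℤ → ℤ) (k : ℤ) (PA : ℤ → ℤ) (e r : ℤ) : Prop :=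
  ∃ (T : ℤ → Prop) (rk : ℤ → ℤ), T e ∧ rk e < r ∧ ∀ j, T j → rk j ≤ rk e →
    0 ≤ j ∧ j < N ∧ 0 ≤ rk j ∧ 0 ≤ PA j ∧ PA j < n ∧ U (PA j) + V j = W (PA j) j ∧
      (PA j = k ∨ ∃ j', T j' ∧ rk j' < rk j ∧ CM j' = PA j + 1)

variable {n N k : ℤ} {W : ℤ → ℤ → ℤ} {U V RM CM U' V' IR IU PA : ℤ → ℤ} {t : ℕ}

/-- Every column of the tree is matched, to a row before `k`, and distinct columns have distinct
rows. This bounds the number of search steps and leaves a column outside the tree. -/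
theorem Tree.le (hT : Tree n N W U V CM k IR IU PA t) (hD : Dual n N W U V RM CM)
    (hA : Agree n N RM CM (-1)) (hR : Rows n k RM) (hk : 0 ≤ k) : (t : ℤ) ≤ k := by
  have h : ((Finset.Ico 0 N).filter fun j => IU j = 1).card ≤ (Finset.Ico 0 k).card := by
    have h1 : ∀ j, 0 ≤ j → j < N → IU j = 1 →
        0 ≤ CM j - 1 ∧ CM j - 1 < n ∧ RM (CM j - 1) = j + 1 := by
      intro j h0 h1 h2
      have h3 := hD.col j h0 h1
      have h4 := (hT.col j h0 h1 h2).1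
      exact ⟨by omega, by omega, (hA _ j (by omega) (by omega) h0 h1).2 ⟨by omega, by omega⟩⟩
    refine Finset.card_le_card_of_injOn (fun j => CM j - 1) ?_ ?_
    · intro j hj
      simp only [Finset.coe_filter, Finset.mem_Ico, Set.mem_ofPred_eq] at hj
      obtain ⟨h2, h3, h4⟩ := h1 j hj.1.1 hj.1.2 hj.2
      have := hR _ h2 h3
      simp only [Finset.coe_Ico, Set.mem_Ico]
      omega
    · intro j hj j' hj' hjj
      simp only [Finset.coe_filter, Finset.mem_Ico, Set.mem_ofPred_eq] at hj hj'
      obtain ⟨h2, h3, h4⟩ := h1 j hj.1.1 hj.1.2 hj.2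
      obtain ⟨h2', h3', h4'⟩ := h1 j' hj'.1.1 hj'.1.2 hj'.2
      simp only at hjj
      rw [hjj] at h4
      omega
  rw [hT.card, Int.card_Ico] at h
  omega

theorem Tree.exists_unused (hT : Tree n N W U V CM k IR IU PA t) (ht : t < N) :
    ∃ j, 0 ≤ j ∧ j < N ∧ IU j = 0 := by
  by_contra! h
  have h1 : (Finset.Ico 0 N).filter (fun j => IU j = 1) = Finset.Ico 0 N := by
    refine Finset.filter_true_of_mem fun j hj => ?_
    rw [Finset.mem_Ico] at hj
    have := hT.zero_one j hj.1 hj.2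
    have := h j hj.1 hj.2
    tauto
  have h2 := hT.card
  rw [h1, Int.card_Ico] at h2
  omega

theorem tree_singleton (hU : ∀ j, 0 ≤ j → j < N → IU j = 0) (hk : IR k = 1)
    (hI : ∀ i, 0 ≤ i → i < n → i ≠ k → IR i = 0) : Tree n N W U V CM k IR IU PA 0 where
  root := hk
  row i h0 h1 h2 := by have := hI i h0 h1; grind
  zero_one j h0 h1 := .inl (hU j h0 h1)
  col j h0 h1 h2 := by have := hU j h0 h1; omega
  parent j h0 h1 h2 := by have := hU j h0 h1; omega
  rank := ⟨0, fun j h0 h1 h2 => by have := hU j h0 h1; omega⟩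
  card := by
    rw [Finset.card_eq_zero, Finset.filter_eq_empty_iff]
    intro j hj
    rw [Finset.mem_Ico] at hj
    have := hU j hj.1 hj.2
    omega

section Step

variable {i₁ j₁ δ : ℤ}

/-- The dual variables stay feasible when they are shifted by the smallest slack. -/
theorem Tree.dual (hT : Tree n N W U V CM k IR IU PA t) (hD : Dual n N W U V RM CM)
    (hA : Agree n N RM CM (-1)) (hR : Rows n k RM)
    (hi : 0 ≤ i₁ ∧ i₁ < n ∧ IR i₁ = 1) (hj : 0 ≤ j₁ ∧ j₁ < N ∧ IU j₁ = 0)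
    (hδ : δ = U i₁ + V j₁ - W i₁ j₁)
    (hmin : ∀ i j, 0 ≤ i → i < n → 0 ≤ j → j < N → IR i = 1 → IU j = 0 → δ ≤ U i + V j - W i j)
    (hU : ∀ i, 0 ≤ i → i < n → U' i = if IR i = 1 then U i - δ else U i)
    (hV : ∀ j, 0 ≤ j → j < N → V' j = if IU j = 1 then V j + δ else V j) :
    Dual n N W U' V' RM CM := by
  have hδ0 : 0 ≤ δ := by have := hD.feas i₁ j₁ hi.1 hi.2.1 hj.1 hj.2.1; omega
  refine ⟨fun i j h0 h1 h2 h3 => ?_, fun j h2 h3 => ?_, fun j h2 h3 h4 => ?_,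
    fun i j h0 h1 h2 h3 h4 => ?_, hD.row, hD.col⟩
  · have h5 := hD.feas i j h0 h1 h2 h3
    -- Feasibility is at risk only for a row inside and a column outside the tree, where the slack
    -- is at least `δ`.
    have h6 := hmin i j h0 h1 h2 h3
    have h7 := hT.zero_one j h2 h3
    rw [hU i h0 h1, hV j h2 h3]
    split_ifs <;> grind
  · have := hD.nonneg j h2 h3
    rw [hV j h2 h3]; split_ifs <;> omega
  · rw [hV j h2 h3, if_neg fun h => (hT.col j h2 h3 h).1 h4]
    exact hD.free j h2 h3 h4
  · have h5 := hD.tight i j h0 h1 h2 h3 h4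
    have h6 := (hA i j h0 h1 h2 h3).1 h4
    -- A matched pair lies either entirely inside or entirely outside the tree, so the two shifts
    -- cancel and it stays tight. The root is no exception, since it is unmatched.
    have h7 : IR i = 1 ↔ IU j = 1 := by
      constructor
      · intro h
        rcases hT.row i h0 h1 h with rfl | ⟨j', h8, h9, h10, h11⟩
        · have := (hR i h0 h1).2 le_rfl; omega
        · have := (hA i j' h0 h1 h8 h9).2 ⟨h11, by omega⟩
          obtain rfl : j' = j := by omega
          exact h10
      · intro h
        have := (hT.col j h2 h3 h).2
        rwa [h6.1, add_sub_cancel_right] at this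
    rw [hU i h0 h1, hV j h2 h3]
    by_cases h : IU j = 1
    · rw [if_pos (h7.2 h), if_pos h]; omega
    · rw [if_neg (mt h7.1 h), if_neg h, h5]

/-- A matched column is added to the tree. -/
theorem Tree.step (hT : Tree n N W U V CM k IR IU PA t)
    (hi : 0 ≤ i₁ ∧ i₁ < n ∧ IR i₁ = 1) (hj : 0 ≤ j₁ ∧ j₁ < N ∧ IU j₁ = 0)
    (hδ : δ = U i₁ + V j₁ - W i₁ j₁)
    (hU : ∀ i, 0 ≤ i → i < n → U' i = if IR i = 1 then U i - δ else U i)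
    (hV : ∀ j, 0 ≤ j → j < N → V' j = if IU j = 1 then V j + δ else V j)
    (hCM : CM j₁ ≠ 0) :
    Tree n N W U' V' CM k (Function.update IR (CM j₁ - 1) 1) (Function.update IU j₁ 1)
      (Function.update PA j₁ i₁) (t + 1) := by
  obtain ⟨hi0, hi1, hi2⟩ := hi
  obtain ⟨hj0, hj1, hj2⟩ := hj
  refine ⟨?_, fun i h0 h1 h2 => ?_, fun j h2 h3 => ?_, fun j h2 h3 h4 => ?_,
    fun j h2 h3 h4 => ?_, ?_, ?_⟩
  · rw [Function.update_apply]; split_ifs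
    exacts [rfl, hT.root]
  · rw [Function.update_apply] at h2
    split_ifs at h2 with h
    · exact .inr ⟨j₁, hj0, hj1, by simp, by omega⟩
    · rcases hT.row i h0 h1 h2 with h3 | ⟨j, h3, h4, h5, h6⟩
      · exact .inl h3
      · exact .inr ⟨j, h3, h4, by rw [Function.update_apply]; split_ifs <;> simp [h5], h6⟩
  · have := hT.zero_one j h2 h3
    rw [Function.update_apply]; split_ifs <;> simp [this]
  · rw [Function.update_apply] at h4
    split_ifs at h4 with h
    · subst h; simp [hCM]
    · refine ⟨(hT.col j h2 h3 h4).1, ?_⟩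
      rw [Function.update_apply]; split_ifs
      exacts [rfl, (hT.col j h2 h3 h4).2]
  · rw [Function.update_apply] at h4
    by_cases h : j = j₁
    · subst h
      simp only [Function.update_self]
      refine ⟨hi0, hi1, ?_, ?_⟩
      · rw [Function.update_apply]; split_ifs
        exacts [rfl, hi2]
      · rw [hU _ hi0 hi1, if_pos hi2, hV j h2 h3, if_neg (by omega)]; omega
    · rw [if_neg h] at h4
      obtain ⟨h5, h6, h7, h8⟩ := hT.parent j h2 h3 h4
      rw [Function.update_of_ne h]
      refine ⟨h5, h6, ?_, ?_⟩
      · rw [Function.update_apply]; split_ifs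
        exacts [rfl, h7]
      · rw [hU _ h5 h6, if_pos h7, hV j h2 h3, if_pos h4]; omega
  · obtain ⟨rk, hrk⟩ := hT.rank
    -- The new column gets the rank `t`, which is above all earlier ranks; its parent row is the
    -- root or belongs to an earlier column.
    refine ⟨Function.update rk j₁ t, fun j h2 h3 h4 => ?_⟩
    by_cases h : j = j₁
    · subst h
      simp only [Function.update_self]
      refine ⟨by omega, by push_cast; omega, ?_⟩
      rcases hT.row i₁ hi0 hi1 hi2 with h3 | ⟨j', h3, h4, h5, h6⟩
      · exact .inl h3
      · have hne : j' ≠ j := by rintro rfl; omega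
        refine .inr ⟨j', h3, h4, ?_, ?_, h6⟩
        · rw [Function.update_of_ne hne, h5]
        · rw [Function.update_of_ne hne]; exact (hrk j' h3 h4 h5).2.1
    · rw [Function.update_of_ne h] at h4 ⊢
      rw [Function.update_of_ne h]
      obtain ⟨h5, h6, h7⟩ := hrk j h2 h3 h4
      refine ⟨h5, by push_cast; omega, h7.imp_right ?_⟩
      rintro ⟨j', h8, h9, h10, h11, h12⟩
      have hne : j' ≠ j₁ := by rintro rfl; omega
      exact ⟨j', h8, h9, by rw [Function.update_of_ne hne, h10],
        by rwa [Function.update_of_ne hne], h12⟩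
  · rw [← hT.card]
    have : (Finset.Ico 0 N).filter (fun j => Function.update IU j₁ 1 j = 1) =
        insert j₁ ((Finset.Ico 0 N).filter fun j => IU j = 1) := by
      ext j
      simp only [Finset.mem_filter, Finset.mem_Ico, Finset.mem_insert, Function.update_apply]
      by_cases h : j = j₁
      · simp [h, hj0, hj1]
      · simp [h]
    rw [this, Finset.card_insert_of_notMem (by simp [hj2])]

/-- A free column ends the search. -/
theorem Tree.path (hT : Tree n N W U V CM k IR IU PA t) (htn : (t : ℤ) < n)
    (hi : 0 ≤ i₁ ∧ i₁ < n ∧ IR i₁ = 1) (hj : 0 ≤ j₁ ∧ j₁ < N ∧ IU j₁ = 0)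
    (hδ : δ = U i₁ + V j₁ - W i₁ j₁)
    (hU : ∀ i, 0 ≤ i → i < n → U' i = if IR i = 1 then U i - δ else U i)
    (hV : ∀ j, 0 ≤ j → j < N → V' j = if IU j = 1 then V j + δ else V j) :
    Path n N W U' V' CM k (Function.update PA j₁ i₁) j₁ n := by
  obtain ⟨hi0, hi1, hi2⟩ := hi
  obtain ⟨hj0, hj1, hj2⟩ := hj
  obtain ⟨rk, hrk⟩ := hT.rank
  -- The path may use all columns of the tree and the free column `j₁`, which gets the highest rank
  -- `t < n`. Going to parents decreases the rank.
  refine ⟨fun j => 0 ≤ j ∧ j < N ∧ (IU j = 1 ∨ j = j₁), Function.update rk j₁ t,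
    ⟨hj0, hj1, .inr rfl⟩, by simpa using htn, ?_⟩
  rintro j ⟨h0, h1, h2⟩ -
  refine ⟨h0, h1, ?_⟩
  by_cases h : j = j₁
  · subst h
    simp only [Function.update_self]
    refine ⟨by omega, hi0, hi1, ?_, ?_⟩
    · rw [hU _ hi0 hi1, if_pos hi2, hV j h0 h1, if_neg (by omega)]; omega
    · rcases hT.row i₁ hi0 hi1 hi2 with h3 | ⟨j', h3, h4, h5, h6⟩
      · exact .inl h3
      · have hne : j' ≠ j := by rintro rfl; omega
        refine .inr ⟨j', ⟨h3, h4, .inl h5⟩, ?_, h6⟩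
        rw [Function.update_of_ne hne]; exact (hrk j' h3 h4 h5).2.1
  · have h2 : IU j = 1 := by tauto
    obtain ⟨h5, h6, h7, h8⟩ := hT.parent j h0 h1 h2
    obtain ⟨h9, h10, h11⟩ := hrk j h0 h1 h2
    rw [Function.update_of_ne h, Function.update_of_ne h]
    refine ⟨h9, h5, h6, ?_, h11.imp_right ?_⟩
    · rw [hU _ h5 h6, if_pos h7, hV j h0 h1, if_pos h2]; omega
    · rintro ⟨j', h8, h9, h10, h11, h12⟩
      have hne : j' ≠ j₁ := by rintro rfl; omega
      exact ⟨j', ⟨h8, h9, .inl h10⟩, by rwa [Function.update_of_ne hne], h12⟩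

end Step

section Augment

variable {e r : ℤ}

/-- `Dual` does not demand that the two descriptions of the matching agree. A tight pair may
therefore be recorded at any moment, even in the middle of an augmentation. -/
theorem Dual.update (hD : Dual n N W U V RM CM) {i j : ℤ} (hi : 0 ≤ i ∧ i < n)
    (hj : 0 ≤ j ∧ j < N) (h : U i + V j = W i j) :
    Dual n N W U V (Function.update RM i (j + 1)) (Function.update CM j (i + 1)) := by
  refine ⟨hD.feas, hD.nonneg, fun j' h0 h1 h2 => ?_, fun i' j' h0 h1 h2 h3 h4 => ?_,
    fun i' h0 h1 => ?_, fun j' h0 h1 => ?_⟩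
  · rw [Function.update_apply] at h2
    split_ifs at h2 with h3
    · omega
    · exact hD.free j' h0 h1 h2
  · rw [Function.update_apply] at h4
    split_ifs at h4 with h5
    · obtain rfl : j = j' := by omega
      rw [h5, h]
    · exact hD.tight i' j' h0 h1 h2 h3 h4
  · have := hD.row i' h0 h1
    rw [Function.update_apply]; split_ifs <;> omega
  · have := hD.col j' h0 h1
    rw [Function.update_apply]; split_ifs <;> omega

/-- The row at the end of the path is the root: the augmentation is complete. -/
theorem augment_root (hA : Agree n N RM CM e) (hR : Rows n k RM) (hk : 0 ≤ k ∧ k < n)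
    (he : 0 ≤ e ∧ e < N) :
    Agree n N (Function.update RM k (e + 1)) (Function.update CM e (k + 1)) (-1) ∧
      Rows n (k + 1) (Function.update RM k (e + 1)) := by
  have h5 := (hR k hk.1 hk.2).2 le_rfl
  constructor
  · intro i j h0 h1 h2 h3
    have h4 := hA i j h0 h1 h2 h3
    have h6 := hA k j hk.1 hk.2 h2 h3
    simp only [Function.update_apply]
    split_ifs <;> omega
  · intro i h0 h1
    have h4 := hR i h0 h1
    simp only [Function.update_apply]
    split_ifs <;> omega

/-- The row at the end of the path is matched: the augmentation goes on with its column. -/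
theorem augment_step (hP : Path n N W U V CM k PA e r) (hA : Agree n N RM CM e)
    (hR : Rows n k RM) (hp : PA e ≠ k) :
    Agree n N (Function.update RM (PA e) (e + 1)) (Function.update CM e (PA e + 1))
        (RM (PA e) - 1) ∧
      Rows n k (Function.update RM (PA e) (e + 1)) ∧
      Path n N W U V (Function.update CM e (PA e + 1)) k PA (RM (PA e) - 1) (r - 1) := by
  obtain ⟨T, rk, hTe, hr, hT⟩ := hP
  obtain ⟨he0, he1, he2, hi0, hi1, -, h⟩ := hT e hTe le_rfl
  -- The parent row of `e` is not the root, so it is matched to a column `j'` of smaller rank.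
  -- Giving `e` to this row leaves `j'` as the new column to be rematched.
  obtain ⟨j', hj', hlt, hCM⟩ := h.resolve_left hp
  obtain ⟨hj0, hj1, -⟩ := hT j' hj' hlt.le
  have hne : j' ≠ e := by rintro rfl; omega
  have hRM : RM (PA e) = j' + 1 := (hA _ _ hi0 hi1 hj0 hj1).2 ⟨hCM, hne⟩
  rw [hRM, add_sub_cancel_right]
  refine ⟨fun i j h0 h1 h2 h3 => ?_, fun i h0 h1 => ?_, T, rk, hj', by omega, fun j h0 h1 => ?_⟩
  · have h4 := hA i j h0 h1 h2 h3
    have h6 := hA (PA e) j hi0 hi1 h2 h3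
    have h7 := hA i j' h0 h1 hj0 hj1
    simp only [Function.update_apply]
    split_ifs <;> grind
  · have h4 := hR i h0 h1
    simp only [Function.update_apply]
    split_ifs with h
    · subst h; omega
    · exact h4
  · obtain ⟨h2, h3, h4, h5, h6, h7, h8⟩ := hT j h0 (by omega)
    refine ⟨h2, h3, h4, h5, h6, h7, h8.imp_right ?_⟩
    rintro ⟨j'', h9, h10, h11⟩
    refine ⟨j'', h9, h10, ?_⟩
    -- Ranks along the remaining path are smaller than that of `e`, so the overwritten entry is not
    -- met again.
    rwa [Function.update_of_ne]
    rintro rfl; omega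

end Augment

/-- Weak duality: a matching of all rows that satisfies complementary slackness is optimal. -/
theorem Dual.optimal (hD : Dual n N W U V RM CM) (hA : Agree n N RM CM (-1)) (hR : Rows n n RM)
    (σ : ℤ → ℤ) (hσ : ∀ i ∈ Finset.Ico 0 n, σ i ∈ Finset.Ico 0 N)
    (hinj : Set.InjOn σ (Finset.Ico 0 n)) :
    ∑ i ∈ Finset.Ico 0 n, W i (σ i) ≤ ∑ i ∈ Finset.Ico 0 n, W i (RM i - 1) := by
  have hRM : ∀ i ∈ Finset.Ico 0 n, RM i - 1 ∈ Finset.Ico 0 N := by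
    intro i hi
    rw [Finset.mem_Ico] at hi ⊢
    have h1 := hD.row i hi.1 hi.2
    have h2 := hR i hi.1 hi.2
    omega
  calc ∑ i ∈ Finset.Ico 0 n, W i (σ i)
      ≤ ∑ i ∈ Finset.Ico 0 n, (U i + V (σ i)) := by
        refine Finset.sum_le_sum fun i hi => ?_
        have h1 := hσ i hi
        rw [Finset.mem_Ico] at hi h1
        exact hD.feas i _ hi.1 hi.2 h1.1 h1.2
    _ = ∑ i ∈ Finset.Ico 0 n, U i + ∑ j ∈ (Finset.Ico 0 n).image σ, V j := by
        rw [Finset.sum_add_distrib, Finset.sum_image hinj]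
    _ ≤ ∑ i ∈ Finset.Ico 0 n, U i + ∑ j ∈ Finset.Ico 0 N, V j := by
        refine add_le_add le_rfl (Finset.sum_le_sum_of_subset_of_nonneg ?_ fun j hj _ => ?_)
        · intro j hj
          obtain ⟨i, hi, rfl⟩ := Finset.mem_image.1 hj
          exact hσ i hi
        · rw [Finset.mem_Ico] at hj
          exact hD.nonneg j hj.1 hj.2
    _ = ∑ i ∈ Finset.Ico 0 n, U i + ∑ i ∈ Finset.Ico 0 n, V (RM i - 1) := by
        congr 1
        rw [← Finset.sum_image (g := fun i => RM i - 1) (f := V)]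
        · symm
          -- Columns outside the image of the matching are free, so complementary slackness makes
          -- their dual variables vanish.
          refine Finset.sum_subset ?_ fun j hj hj' => ?_
          · intro j hj
            obtain ⟨i, hi, rfl⟩ := Finset.mem_image.1 hj
            exact hRM i hi
          · rw [Finset.mem_Ico] at hj
            refine hD.free j hj.1 hj.2 ?_
            by_contra h
            have h1 := hD.col j hj.1 hj.2
            have h2 := (hA (CM j - 1) j (by omega) (by omega) hj.1 hj.2).2 ⟨by omega, by omega⟩
            exact hj' (Finset.mem_image.2 ⟨CM j - 1, by rw [Finset.mem_Ico]; omega, by omega⟩)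
        · intro i hi i' hi' hii
          have h1 := hRM i hi
          have h1' := hRM i' hi'
          simp only [Finset.coe_Ico, Set.mem_Ico, Finset.mem_Ico] at hi hi' hii h1 h1'
          have h2 := (hA i (RM i - 1) hi.1 hi.2 h1.1 h1.2).1 (by omega)
          have h3 := (hA i' (RM i - 1) hi'.1 hi'.2 h1.1 h1.2).1 (by omega)
          omega
    _ = ∑ i ∈ Finset.Ico 0 n, W i (RM i - 1) := by
        rw [← Finset.sum_add_distrib]
        refine Finset.sum_congr rfl fun i hi => ?_
        have h1 := hRM i hi
        rw [Finset.mem_Ico] at hi h1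
        exact hD.tight i _ hi.1 hi.2 h1.1 h1.2 (by omega)

end Hungarian

/-! ### The search for the smallest slack as a program -/

namespace RAM

infixr:60 " ;; " => Prog.seq

namespace Prog

/-- A loop that computes the cells of an array one after the other. -/
theorem arr_loop {x b A : ℕ} {c : Prog} {s : State} (f : ℤ → ℤ)
    (h : ∀ (k : ℕ) (s' : State), (k : ℤ) < s.var b → s'.var x = k → Frame (loop x b c) s s' →
      s'.arr A k = s.arr A k → (c.den s').arr A = Function.update (s'.arr A) k (f k)) (i : ℤ) :
    ((loop x b c).den s).arr A i = if 0 ≤ i ∧ i < s.var b then f i else s.arr A i := by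
  have key := loop_induction (c := c) (x := x) (b := b) (s := s)
    (fun k s' => ∀ i, s'.arr A i = if 0 ≤ i ∧ i < k then f i else s.arr A i)
    (fun i => by rw [if_neg (by push_cast; omega)]; rfl)
    (fun k s' hk hx hF ih i => by
      rw [State.arr_setVar, h k s' hk hx hF (by rw [ih, if_neg (by omega)]),
        Function.update_apply, ih]
      push_cast
      split_ifs <;> first | rfl | omega | (subst_vars; rfl))
  rw [key i]
  congr 1
  simp only [eq_iff_iff]
  omega

/-- One comparison of the search for the smallest slack. -/
def minCell : Prog :=
  .ite (.eq (.get 11 (.var 22)) (.const 0))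
    (.assign 31 (.sub (.add (.get 6 (.var 21)) (.get 7 (.var 22)))
      (.get 5 (.add (.mul (.var 21) (.var 3)) (.var 22)))) ;;
    .ite (.or (.eq (.var 25) (.const 0)) (.lt (.var 31) (.var 26)))
      (.assign 25 (.const 1) ;; .assign 26 (.var 31) ;; .assign 27 (.var 21) ;;
        .assign 28 (.var 22))
      .skip)
    .skip

/-- The search for the smallest slack in a row of the tree. -/
def minRow : Prog :=
  .ite (.eq (.get 10 (.var 21)) (.const 1)) (.loop 22 3 minCell) .skip

/-- The search for the smallest slack between the rows and the columns outside of the tree. -/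
def minSearch : Prog := .assign 25 (.const 0) ;; .loop 21 1 minRow

/-- The slack of a pair of a row and a column. -/
def slack (s : State) (N i j : ℤ) : ℤ := s.arr 6 i + s.arr 7 j - s.arr 5 (i * N + j)

/-- The state `s'` knows the smallest slack among the pairs lexicographically before `(a, b)`. -/
def MinInv (s : State) (n N : ℤ) (s' : State) (a b : ℤ) : Prop :=
  (s'.var 25 = 0 ∨ s'.var 25 = 1) ∧
  (s'.var 25 = 1 → (0 ≤ s'.var 27 ∧ s'.var 27 < n ∧ s.arr 10 (s'.var 27) = 1) ∧
    (0 ≤ s'.var 28 ∧ s'.var 28 < N ∧ s.arr 11 (s'.var 28) = 0) ∧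
    s'.var 26 = slack s N (s'.var 27) (s'.var 28)) ∧
  ∀ i j, 0 ≤ i → 0 ≤ j → j < N → (i < a ∨ i = a ∧ j < b) → s.arr 10 i = 1 → s.arr 11 j = 0 →
    s'.var 25 = 1 ∧ s'.var 26 ≤ slack s N i j

theorem minCell_spec {s s' : State} {n N k l : ℤ} (harr : s'.arr = s.arr) (h3 : s'.var 3 = N)
    (hk : s'.var 21 = k) (hl : s'.var 22 = l) (hk0 : 0 ≤ k ∧ k < n) (hl0 : 0 ≤ l ∧ l < N)
    (hc : s.arr 10 k = 1) (h : MinInv s n N s' k l) :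
    MinInv s n N (minCell.den s') k (l + 1) := by
  obtain ⟨h1, h2, h4⟩ := h
  have hpair : ∀ i j, (i < k ∨ i = k ∧ j < l + 1) → (i < k ∨ i = k ∧ j < l) ∨ i = k ∧ j = l := by
    omega
  by_cases hd : s.arr 11 l = 0
  · by_cases he : s'.var 25 = 0 ∨ slack s N k l < s'.var 26
    · have he' : s'.var 25 = 0 ∨ s.arr 6 k + s.arr 7 l - s.arr 5 (k * N + l) < s'.var 26 := he
      have hv : (minCell.den s').var 25 = 1 ∧ (minCell.den s').var 26 = slack s N k l ∧
          (minCell.den s').var 27 = k ∧ (minCell.den s').var 28 = l := by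
        simp [minCell, den, hk, hl, harr, hd, h3, he', slack]
      rw [MinInv, hv.1, hv.2.1, hv.2.2.1, hv.2.2.2]
      refine ⟨.inr rfl, fun _ => ⟨⟨hk0.1, hk0.2, hc⟩, ⟨hl0.1, hl0.2, hd⟩, rfl⟩, ?_⟩
      intro i j h5 h6 h7 h8 h9 h10
      rcases hpair i j h8 with h11 | ⟨rfl, rfl⟩
      · have := h4 i j h5 h6 h7 h11 h9 h10
        omega
      · exact ⟨rfl, le_rfl⟩
    · have he' : ¬ (s'.var 25 = 0 ∨
          s.arr 6 k + s.arr 7 l - s.arr 5 (k * N + l) < s'.var 26) := he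
      have hv : (minCell.den s').var 25 = s'.var 25 ∧ (minCell.den s').var 26 = s'.var 26 ∧
          (minCell.den s').var 27 = s'.var 27 ∧ (minCell.den s').var 28 = s'.var 28 := by
        simp [minCell, den, hk, hl, harr, hd, h3, he']
      rw [MinInv, hv.1, hv.2.1, hv.2.2.1, hv.2.2.2]
      refine ⟨h1, h2, fun i j h5 h6 h7 h8 h9 h10 => ?_⟩
      rcases hpair i j h8 with h11 | ⟨rfl, rfl⟩
      · exact h4 i j h5 h6 h7 h11 h9 h10
      · omega
  · have hv : minCell.den s' = s' := by simp [minCell, den, hl, harr, hd]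
    rw [hv]
    refine ⟨h1, h2, fun i j h5 h6 h7 h8 h9 h10 => ?_⟩
    rcases hpair i j h8 with h11 | ⟨rfl, rfl⟩
    · exact h4 i j h5 h6 h7 h11 h9 h10
    · exact absurd h10 hd

theorem MinInv.setVar {s s' : State} {n N a b : ℤ} (h : MinInv s n N s' a b) {x : ℕ} {z : ℤ}
    (hx : x < 25) : MinInv s n N (s'.setVar x z) a b := by
  have h1 : ∀ y, 25 ≤ y → (s'.setVar x z).var y = s'.var y := fun y hy => by
    rw [State.var_setVar, if_neg (by omega)]
  rw [MinInv, h1 25 (by decide), h1 26 (by decide), h1 27 (by decide), h1 28 (by decide)]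
  exact h

theorem minRow_spec {s s' : State} {n N k : ℤ} (harr : s'.arr = s.arr) (h3 : s'.var 3 = N)
    (hk : s'.var 21 = k) (hk0 : 0 ≤ k ∧ k < n) (hN : 0 ≤ N) (h : MinInv s n N s' k 0) :
    MinInv s n N (minRow.den s') (k + 1) 0 := by
  rw [minRow, den]
  by_cases hc : s.arr 10 k = 1
  · rw [if_pos (by simpa [hk, harr] using hc)]
    have key := loop_induction (c := minCell) (s := s') (x := 22) (b := 3)
      (fun l s'' => MinInv s n N s'' k l) (h.setVar (by decide)) ?_
    · rw [h3, Int.toNat_of_nonneg hN] at key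
      refine ⟨key.1, key.2.1, fun i j h4 h5 h6 h7 => key.2.2 i j h4 h5 h6 (by omega)⟩
    · intro l s'' hl hx hF ih
      refine (minCell_spec ?_ ?_ ?_ hx hk0 ⟨by omega, by omega⟩ hc ih).setVar (by decide)
      · ext A i; rw [hF.arr A (by simp [minCell, arrs]), harr]
      · rw [hF.var 3 (by decide), h3]
      · rw [hF.var 21 (by decide), hk]
  · rw [if_neg (by simpa [hk, harr] using hc), den]
    refine ⟨h.1, h.2.1, fun i j h4 h5 h6 h7 h8 h9 => ?_⟩
    -- A row outside the tree contributes no pairs, so the invariant passes over it unchanged.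
    have : i ≠ k := by rintro rfl; exact hc h8
    exact h.2.2 i j h4 h5 h6 (by omega) h8 h9

theorem minSearch_spec {s : State} {n N : ℤ} (h1 : s.var 1 = n) (h3 : s.var 3 = N)
    (hn : 0 ≤ n) (hN : 0 ≤ N) : MinInv s n N (minSearch.den s) n 0 := by
  rw [minSearch, den, den]
  have key := loop_induction (s := s.setVar 25 0) (x := 21) (b := 1) (c := minRow)
    (fun k s' => MinInv s n N s' k 0) ?_ ?_
  · simpa [h1, Int.toNat_of_nonneg hn] using key
  · refine ⟨?_, ?_, fun i j h0 h1 h2 h3 => by omega⟩ <;> simp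
  intro k s' hk hx hF ih
  refine (minRow_spec ?_ ?_ hx ⟨by omega, ?_⟩ hN ih).setVar (by decide)
  · ext A i; rw [hF.arr A (by simp [minRow, minCell, arrs])]; rfl
  · rw [hF.var 3 (by decide)]; simpa
  · simpa [h1] using hk

end Prog

end RAM

/-! ### The phases of the Hungarian method as programs -/

namespace RAM

namespace Prog

open Hungarian

/-- The state provides the numbers `n ≤ N ≤ R` of rows, columns and cells, and the weights `w`. -/
structure Sizes (n N R : ℤ) (w : ℤ → ℤ) (s : State) : Prop where
  zero_le : 0 ≤ n
  le : n ≤ N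
  le' : N ≤ R
  var_one : s.var 1 = n
  var_three : s.var 3 = N
  var_five : s.var 5 = R
  arr_five : s.arr 5 = w

variable {n N R k : ℤ} {w : ℤ → ℤ} {s s' : State} {t : ℕ}

theorem Sizes.of_eq (h : Sizes n N R w s) (h1 : s'.var 1 = s.var 1) (h3 : s'.var 3 = s.var 3)
    (h5 : s'.var 5 = s.var 5) (ha : s'.arr 5 = s.arr 5) : Sizes n N R w s' :=
  ⟨h.1, h.2, h.3, h1.trans h.4, h3.trans h.5, h5.trans h.6, ha.trans h.7⟩

/-- The weight of the pair `(i, j)`. -/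
def weights (w : ℤ → ℤ) (N i j : ℤ) : ℤ := w (i * N + j)

/-- The search for an augmenting path from row `k` has a tree with `t` columns. -/
def Searching (n N k : ℤ) (w : ℤ → ℤ) (t : ℕ) (s : State) : Prop :=
  Dual n N (weights w N) (s.arr 6) (s.arr 7) (s.arr 8) (s.arr 9) ∧
  Agree n N (s.arr 8) (s.arr 9) (-1) ∧ Rows n k (s.arr 8) ∧
  Tree n N (weights w N) (s.arr 6) (s.arr 7) (s.arr 9) k (s.arr 10) (s.arr 11) (s.arr 12) t

/-- There is an augmenting path of length at most `r` from the column in variable `29`. -/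
def Found (n N k : ℤ) (w : ℤ → ℤ) (r : ℤ) (s : State) : Prop :=
  Dual n N (weights w N) (s.arr 6) (s.arr 7) (s.arr 8) (s.arr 9) ∧
  Agree n N (s.arr 8) (s.arr 9) (s.var 29) ∧ Rows n k (s.arr 8) ∧
  Path n N (weights w N) (s.arr 6) (s.arr 7) (s.arr 9) k (s.arr 12) (s.var 29) r

/-- The rows before `k` are matched optimally. -/
def Solved (n N k : ℤ) (w : ℤ → ℤ) (s : State) : Prop :=
  Dual n N (weights w N) (s.arr 6) (s.arr 7) (s.arr 8) (s.arr 9) ∧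
  Agree n N (s.arr 8) (s.arr 9) (-1) ∧ Rows n k (s.arr 8)

/-- The change of the dual variable of a row. -/
def shiftRow : Prog :=
  .ite (.eq (.get 10 (.var 21)) (.const 1))
    (.store 6 (.var 21) (.sub (.get 6 (.var 21)) (.var 26))) .skip

/-- The change of the dual variable of a column. -/
def shiftCol : Prog :=
  .ite (.eq (.get 11 (.var 22)) (.const 1))
    (.store 7 (.var 22) (.add (.get 7 (.var 22)) (.var 26))) .skip

/-- The extension of the tree by a column. -/
def growTree : Prog :=
  .store 12 (.var 28) (.var 27) ;; .store 11 (.var 28) (.const 1) ;;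
  .ite (.eq (.get 9 (.var 28)) (.const 0)) (.assign 24 (.const 1) ;; .assign 29 (.var 28))
    (.store 10 (.sub (.get 9 (.var 28)) (.const 1)) (.const 1))

/-- One step of the search for an augmenting path. -/
def treeStep : Prog := minSearch ;; .loop 21 1 shiftRow ;; .loop 22 3 shiftCol ;; growTree

theorem den_shiftRow (h : Sizes n N R w s) (i : ℤ) :
    ((loop 21 1 shiftRow).den s).arr 6 i =
      if 0 ≤ i ∧ i < n then (if s.arr 10 i = 1 then s.arr 6 i - s.var 26 else s.arr 6 i)
      else s.arr 6 i := by
  rw [arr_loop (fun i => if s.arr 10 i = 1 then s.arr 6 i - s.var 26 else s.arr 6 i), h.var_one]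
  intro k s' hk hx hF hA
  have h1 := h.le
  have h2 := h.le'
  rw [h.var_one] at hk
  have h10 := hF.arr 10 (by decide)
  have h26 := hF.var 26 (by decide)
  have h5 := (hF.var 5 (by decide)).trans h.var_five
  by_cases hc : s.arr 10 k = 1
  · have hk' : (k : ℤ) < R := by omega
    simp [shiftRow, den, hx, h10, hc, h5, h26, hA, hk']
  · simp [shiftRow, den, hx, h10, hc, ← hA]

theorem den_shiftCol (h : Sizes n N R w s) (i : ℤ) :
    ((loop 22 3 shiftCol).den s).arr 7 i =
      if 0 ≤ i ∧ i < N then (if s.arr 11 i = 1 then s.arr 7 i + s.var 26 else s.arr 7 i)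
      else s.arr 7 i := by
  rw [arr_loop (fun i => if s.arr 11 i = 1 then s.arr 7 i + s.var 26 else s.arr 7 i), h.var_three]
  intro k s' hk hx hF hA
  have h2 := h.le'
  rw [h.var_three] at hk
  have h10 := hF.arr 11 (by decide)
  have h26 := hF.var 26 (by decide)
  have h5 := (hF.var 5 (by decide)).trans h.var_five
  by_cases hc : s.arr 11 k = 1
  · have hk' : (k : ℤ) < R := by omega
    simp [shiftCol, den, hx, h10, hc, h5, h26, hA, hk']
  · simp [shiftCol, den, hx, h10, hc, ← hA]

/-- The column of smallest slack becomes tight after the shift. If it is matched, the column and its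
row join the tree; if it is free, it ends an augmenting path. -/
theorem treeStep_spec (h : Sizes n N R w s) (hk : 0 ≤ k ∧ k < n) (h24 : s.var 24 = 0)
    (hS : Searching n N k w t s) :
    (treeStep.den s).var 24 = 0 ∧ Searching n N k w (t + 1) (treeStep.den s) ∨
      (treeStep.den s).var 24 = 1 ∧ Found n N k w n (treeStep.den s) := by
  obtain ⟨hD, hA, hR, hT⟩ := hS
  have htk := hT.le hD hA hR hk.1
  have hnN := h.le
  have hNR := h.le'
  obtain ⟨j₀, hj0, hj1, hj2⟩ := hT.exists_unused (by omega)
  obtain ⟨-, hm2, hm3⟩ := minSearch_spec h.var_one h.var_three h.zero_le (h.zero_le.trans h.le)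
  -- The root together with an unused column is an eligible pair, so the search for the smallest
  -- slack has found something.
  have hf := (hm3 k j₀ hk.1 hj0 hj1 (.inl hk.2) hT.root hj2).1
  obtain ⟨hi, hj, hδ⟩ := hm2 hf
  set i₁ := (minSearch.den s).var 27 with hi₁
  set j₁ := (minSearch.den s).var 28 with hj₁
  set δ := (minSearch.den s).var 26 with hδ'
  have hmin : ∀ i j, 0 ≤ i → i < n → 0 ≤ j → j < N → s.arr 10 i = 1 → s.arr 11 j = 0 →
      δ ≤ s.arr 6 i + s.arr 7 j - weights w N i j := fun i j h0 h1 h2 h3 h4 h5 => by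
    rw [weights, ← h.arr_five]; exact (hm3 i j h0 h2 h3 (.inl h1) h4 h5).2
  replace hδ : δ = s.arr 6 i₁ + s.arr 7 j₁ - weights w N i₁ j₁ := by
    rw [weights, ← h.arr_five]; exact hδ
  have e1 : (minSearch.den s).arr = s.arr := by ext A i; rw [arr_den _ _ (by
    simp [minSearch, minRow, minCell, arrs])]
  set s₁ := minSearch.den s
  have hs₁ : Sizes n N R w s₁ := h.of_eq (var_den _ _ (by decide)) (var_den _ _ (by decide))
    (var_den _ _ (by decide)) (by rw [e1])
  set s₂ := (loop 21 1 shiftRow).den s₁ with hs₂'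
  have hs₂ : Sizes n N R w s₂ := hs₁.of_eq (var_den _ _ (by decide)) (var_den _ _ (by decide))
    (var_den _ _ (by decide)) (arr_den _ _ (by decide))
  set s₃ := (loop 22 3 shiftCol).den s₂ with hs₃'
  have hs₃ : Sizes n N R w s₃ := hs₂.of_eq (var_den _ _ (by decide)) (var_den _ _ (by decide))
    (var_den _ _ (by decide)) (arr_den _ _ (by decide))
  have hU : ∀ i, 0 ≤ i → i < n →
      s₃.arr 6 i = if s.arr 10 i = 1 then s.arr 6 i - δ else s.arr 6 i := by
    intro i h0 h1
    rw [hs₃', arr_den _ _ (by decide), hs₂', den_shiftRow hs₁, if_pos ⟨h0, h1⟩, e1]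
  have hV : ∀ j, 0 ≤ j → j < N →
      s₃.arr 7 j = if s.arr 11 j = 1 then s.arr 7 j + δ else s.arr 7 j := by
    intro j h0 h1
    have e11 : s₂.arr 11 = s₁.arr 11 := arr_den _ _ (by decide)
    have e7 : s₂.arr 7 = s₁.arr 7 := arr_den _ _ (by decide)
    have e26 : s₂.var 26 = s₁.var 26 := var_den _ _ (by decide)
    rw [hs₃', den_shiftCol hs₂, if_pos ⟨h0, h1⟩, e11, e7, e26, e1]
  have ha : ∀ A, A ≠ 6 → A ≠ 7 → s₃.arr A = s.arr A := by
    intro A h6 h7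
    rw [hs₃', arr_den _ _ (by simp [shiftCol, arrs, h7]), hs₂',
      arr_den _ _ (by simp [shiftRow, arrs, h6]), e1]
  have hv : ∀ y, y ≠ 21 → y ≠ 22 → s₃.var y = s₁.var y := by
    intro y h6 h7
    rw [hs₃', var_den _ _ (by simp [shiftCol, vars, h7]), hs₂',
      var_den _ _ (by simp [shiftRow, vars, h6])]
  have e24 : s₁.var 24 = 0 := by rw [var_den _ _ (by decide), h24]
  have hden : treeStep.den s = growTree.den s₃ := rfl
  have hD' := hT.dual hD hA hR hi hj hδ hmin hU hV
  have hj1R : j₁ < R := by omega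
  by_cases hc : s.arr 9 j₁ = 0
  · refine .inr ⟨?_, ?_⟩
    · simp [hden, growTree, den, ha, hv, hs₁.var_five, ← hj₁, ← hi₁, hj.1, hj1R, hc]
    have e6 : (growTree.den s₃).arr 6 = s₃.arr 6 := arr_den _ _ (by decide)
    have e7 : (growTree.den s₃).arr 7 = s₃.arr 7 := arr_den _ _ (by decide)
    have e8 : (growTree.den s₃).arr 8 = s.arr 8 := by
      rw [arr_den _ _ (by decide), ha _ (by decide) (by decide)]
    have e9 : (growTree.den s₃).arr 9 = s.arr 9 := by
      rw [arr_den _ _ (by decide), ha _ (by decide) (by decide)]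
    have e12 : (growTree.den s₃).arr 12 = Function.update (s.arr 12) j₁ i₁ := by
      simp [growTree, den, ha, hv, hs₁.var_five, ← hj₁, ← hi₁, hj.1, hj1R, hc]
    have e29 : (growTree.den s₃).var 29 = j₁ := by
      simp [growTree, den, ha, hv, hs₁.var_five, ← hj₁, ← hi₁, hj.1, hj1R, hc]
    rw [hden, Found, e6, e7, e8, e9, e12, e29]
    -- Before the augmentation no column is exceptional, which `-1` expresses. Excepting `j₁`
    -- instead is harmless, because it is free.
    refine ⟨hD', fun i j h0 h1 h2 h3 => ?_, hR, hT.path (by omega) hi hj hδ hU hV⟩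
    rw [hA i j h0 h1 h2 h3]
    constructor
    · rintro ⟨h4, h5⟩
      refine ⟨h4, ?_⟩
      rintro rfl; omega
    · exact fun h4 => ⟨h4.1, by omega⟩
  · have hcol := hD.col j₁ hj.1 hj.2.1
    have hcR : s.arr 9 j₁ - 1 < R := by omega
    have hc0 : 1 ≤ s.arr 9 j₁ := by omega
    refine .inl ⟨?_, ?_⟩
    · rw [hden]
      simp [growTree, den, ha, hv, hs₁.var_five, ← hj₁, ← hi₁, hj.1, hj1R, hc, hcR, hc0, e24]
    have e6 : (growTree.den s₃).arr 6 = s₃.arr 6 := arr_den _ _ (by decide)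
    have e7 : (growTree.den s₃).arr 7 = s₃.arr 7 := arr_den _ _ (by decide)
    have e8 : (growTree.den s₃).arr 8 = s.arr 8 := by
      rw [arr_den _ _ (by decide), ha _ (by decide) (by decide)]
    have e9 : (growTree.den s₃).arr 9 = s.arr 9 := by
      rw [arr_den _ _ (by decide), ha _ (by decide) (by decide)]
    have e10 : (growTree.den s₃).arr 10 = Function.update (s.arr 10) (s.arr 9 j₁ - 1) 1 := by
      simp [growTree, den, ha, hv, hs₁.var_five, ← hj₁, ← hi₁, hj.1, hj1R, hc, hcR, hc0]
    have e11 : (growTree.den s₃).arr 11 = Function.update (s.arr 11) j₁ 1 := by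
      simp [growTree, den, ha, hv, hs₁.var_five, ← hj₁, ← hi₁, hj.1, hj1R, hc, hcR, hc0]
    have e12 : (growTree.den s₃).arr 12 = Function.update (s.arr 12) j₁ i₁ := by
      simp [growTree, den, ha, hv, hs₁.var_five, ← hj₁, ← hi₁, hj.1, hj1R, hc, hcR, hc0]
    rw [hden, Searching, e6, e7, e8, e9, e10, e11, e12]
    exact ⟨hD', hA, hR, hT.step hi hj hδ hU hV hc⟩

/-- The search for an augmenting path. -/
def searchLoop : Prog := .loop 23 1 (.ite (.eq (.var 24) (.const 0)) treeStep .skip)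

/-- If the search were still going on after `n` rounds, the tree would have `n` columns, whereas
`Tree.le` allows at most `k < n`. -/
theorem searchLoop_spec (h : Sizes n N R w s) (hk : 0 ≤ k ∧ k < n) (h24 : s.var 24 = 0)
    (hS : Searching n N k w 0 s) : Found n N k w n (searchLoop.den s) := by
  have key := loop_induction (s := s) (x := 23) (b := 1)
    (c := .ite (.eq (.var 24) (.const 0)) treeStep .skip)
    (fun t s' => s'.var 24 = 0 ∧ Searching n N k w t s' ∨ s'.var 24 = 1 ∧ Found n N k w n s')
    (.inl ⟨h24, hS⟩) ?_
  · rcases key with ⟨-, hD, hA, hR, hT⟩ | ⟨-, h1⟩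
    · have := hT.le hD hA hR hk.1
      have := h.var_one
      omega
    · exact h1
  · intro t s' ht hx hF ih
    have hs' : Sizes n N R w s' := h.of_eq (hF.var _ (by decide)) (hF.var _ (by decide))
      (hF.var _ (by decide)) (hF.arr _ (by decide))
    rcases ih with ⟨h1, h2⟩ | ⟨h1, h2⟩
    · rw [den, if_pos (by simpa using h1)]
      exact treeStep_spec hs' hk h1 h2
    · rw [den, if_neg (by simp [h1])]
      exact .inr ⟨h1, h2⟩

/-- One step of the augmentation along a path. -/
def augmentStep : Prog :=
  .assign 32 (.get 12 (.var 29)) ;; .assign 33 (.get 8 (.var 32)) ;;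
  .store 8 (.var 32) (.add (.var 29) (.const 1)) ;;
  .store 9 (.var 29) (.add (.var 32) (.const 1)) ;;
  .ite (.eq (.var 32) (.var 20)) (.assign 30 (.const 0))
    (.assign 29 (.sub (.var 33) (.const 1)))

/-- The parent row of the current column takes this column. Either that row is the root and the
matching is consistent again, or its former column is next, with a path bound smaller by one. -/
theorem augmentStep_spec (h : Sizes n N R w s) (hk : 0 ≤ k ∧ k < n) (h20 : s.var 20 = k)
    (h30 : s.var 30 = 1) {r : ℤ} (hS : Found n N k w r s) :
    (augmentStep.den s).var 30 = 1 ∧ Found n N k w (r - 1) (augmentStep.den s) ∨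
      (augmentStep.den s).var 30 = 0 ∧ Solved n N (k + 1) w (augmentStep.den s) := by
  obtain ⟨hD, hA, hR, hP⟩ := hS
  have hnN := h.le
  have hNR := h.le'
  obtain ⟨he0, he1, hi0, hi1, ht⟩ : 0 ≤ s.var 29 ∧ s.var 29 < N ∧ 0 ≤ s.arr 12 (s.var 29) ∧
      s.arr 12 (s.var 29) < n ∧ s.arr 6 (s.arr 12 (s.var 29)) + s.arr 7 (s.var 29) =
        weights w N (s.arr 12 (s.var 29)) (s.var 29) := by
    obtain ⟨T, rk, h1, -, h2⟩ := hP
    obtain ⟨h3, h4, -, h5, h6, h7, -⟩ := h2 _ h1 le_rfl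
    exact ⟨h3, h4, h5, h6, h7⟩
  have hD' := hD.update ⟨hi0, hi1⟩ ⟨he0, he1⟩ ht
  have e6 : (augmentStep.den s).arr 6 = s.arr 6 := arr_den _ _ (by decide)
  have e7 : (augmentStep.den s).arr 7 = s.arr 7 := arr_den _ _ (by decide)
  have e12 : (augmentStep.den s).arr 12 = s.arr 12 := arr_den _ _ (by decide)
  have hg1 : s.arr 12 (s.var 29) < R := by omega
  have hg2 : s.var 29 < R := by omega
  by_cases hc : s.arr 12 (s.var 29) = k
  · have e8 : (augmentStep.den s).arr 8 = Function.update (s.arr 8) k (s.var 29 + 1) := by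
      simp [augmentStep, den, h.var_five, he0, hg2, hc, h20, hk, hc ▸ hg1]
    have e9 : (augmentStep.den s).arr 9 = Function.update (s.arr 9) (s.var 29) (k + 1) := by
      simp [augmentStep, den, h.var_five, he0, hg2, hc, h20, hk, hc ▸ hg1]
    refine .inr ⟨?_, ?_⟩
    · simp [augmentStep, den, h.var_five, he0, hg2, hc, h20, hk, hc ▸ hg1]
    · rw [Solved, e6, e7, e8, e9]
      rw [hc] at hD'
      exact ⟨hD', augment_root hA hR hk ⟨he0, he1⟩⟩
  · have e8 : (augmentStep.den s).arr 8 =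
        Function.update (s.arr 8) (s.arr 12 (s.var 29)) (s.var 29 + 1) := by
      simp [augmentStep, den, h.var_five, hi0, he0, hg1, hg2, hc, h20]
    have e9 : (augmentStep.den s).arr 9 =
        Function.update (s.arr 9) (s.var 29) (s.arr 12 (s.var 29) + 1) := by
      simp [augmentStep, den, h.var_five, hi0, he0, hg1, hg2, hc, h20]
    have e29 : (augmentStep.den s).var 29 = s.arr 8 (s.arr 12 (s.var 29)) - 1 := by
      simp [augmentStep, den, h.var_five, hi0, he0, hg1, hg2, hc, h20]
    obtain ⟨h1, h2, h3⟩ := augment_step hP hA hR hc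
    refine .inl ⟨?_, ?_⟩
    · simp [augmentStep, den, h.var_five, hi0, he0, hg1, hg2, hc, h20, h30]
    · rw [Found, e6, e7, e8, e9, e12, e29]
      exact ⟨hD', h1, h2, h3⟩

/-- The augmentation along a path. -/
def augmentLoop : Prog :=
  .assign 30 (.const 1) ;; .loop 23 1 (.ite (.eq (.var 30) (.const 1)) augmentStep .skip)

/-- The bound on the path drops by one per round. After `n` rounds it would be `0`, but ranks are
nonnegative and lie below the bound, so the root has been reached. -/
theorem augmentLoop_spec (h : Sizes n N R w s) (hk : 0 ≤ k ∧ k < n) (h20 : s.var 20 = k)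
    (hS : Found n N k w n s) : Solved n N (k + 1) w (augmentLoop.den s) := by
  rw [augmentLoop, den, den]
  have key := loop_induction (s := s.setVar 30 1) (x := 23) (b := 1)
    (c := .ite (.eq (.var 30) (.const 1)) augmentStep .skip)
    (fun t s' => s'.var 30 = 1 ∧ Found n N k w (n - t) s' ∨
      s'.var 30 = 0 ∧ Solved n N (k + 1) w s')
    (.inl ⟨by simp, by simpa [Found] using hS⟩) ?_
  · rcases key with ⟨-, hD, hA, hR, T, rk, h1, h2, h3⟩ | ⟨-, h1⟩
    · have h4 := (h3 _ h1 le_rfl).2.2.1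
      have h5 := h.var_one
      have h6 : (s.setVar 30 1).var 1 = s.var 1 := by simp
      rw [h6] at h2
      omega
    · exact h1
  · intro t s' ht hx hF ih
    have hs' : Sizes n N R w s' := h.of_eq (hF.var _ (by decide)) (hF.var _ (by decide))
      (hF.var _ (by decide)) (hF.arr _ (by decide))
    rcases ih with ⟨h1, h2⟩ | ⟨h1, h2⟩
    · rw [den, if_pos (by simpa using h1)]
      have := augmentStep_spec hs' hk ((hF.var 20 (by decide)).trans h20) h1 h2
      rw [sub_sub] at this
      exact this
    · rw [den, if_neg (by simp [h1])]
      exact .inr ⟨h1, h2⟩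

/-- The assignment of one more row. -/
def phase : Prog :=
  .loop 21 1 (.store 10 (.var 21) (.const 0)) ;; .loop 22 3 (.store 11 (.var 22) (.const 0)) ;;
  .store 10 (.var 20) (.const 1) ;; .assign 24 (.const 0) ;; searchLoop ;; augmentLoop

theorem phase_spec (h : Sizes n N R w s) (hk : 0 ≤ k ∧ k < n) (h20 : s.var 20 = k)
    (hS : Solved n N k w s) : Solved n N (k + 1) w (phase.den s) := by
  have hnN := h.le
  have hNR := h.le'
  simp only [phase, den_seq]
  set s₁ := (loop 21 1 (.store 10 (.var 21) (.const 0))).den s with hs₁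
  set s₂ := (loop 22 3 (.store 11 (.var 22) (.const 0))).den s₁ with hs₂
  have h10 : ∀ i, 0 ≤ i → i < n → s₁.arr 10 i = 0 := by
    intro i h0 h1
    rw [hs₁, arr_loop (fun _ => 0), if_pos ⟨h0, by rwa [h.var_one]⟩]
    intro k s' hk hx hF hA
    have h5 := (hF.var 5 (by decide)).trans h.var_five
    rw [h.var_one] at hk
    have hk' : (k : ℤ) < R := by omega
    simp [den, hx, h5, hk']
  have h5 : s₁.var 5 = R := (var_den _ _ (by decide)).trans h.var_five
  have h3 : s₁.var 3 = N := (var_den _ _ (by decide)).trans h.var_three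
  have h11 : ∀ j, 0 ≤ j → j < N → s₂.arr 11 j = 0 := by
    intro i h0 h1
    rw [hs₂, arr_loop (fun _ => 0), if_pos ⟨h0, by rwa [h3]⟩]
    intro k s' hk hx hF hA
    have h5 := (hF.var 5 (by decide)).trans h5
    rw [h3] at hk
    have hk' : (k : ℤ) < R := by omega
    simp [den, hx, h5, hk']
  have ha : ∀ A, A ≠ 10 → A ≠ 11 → s₂.arr A = s.arr A := by
    intro A h0 h1
    rw [hs₂, arr_den _ _ (by simp [arrs, h1]), hs₁, arr_den _ _ (by simp [arrs, h0])]
  have hv : ∀ y, y ≠ 21 → y ≠ 22 → s₂.var y = s.var y := by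
    intro A h0 h1
    rw [hs₂, var_den _ _ (by simp [vars, h1]), hs₁, var_den _ _ (by simp [vars, h0])]
  have h10' : s₂.arr 10 = s₁.arr 10 := arr_den _ _ (by decide)
  have hden : den (assign 24 (.const 0)) (den (store 10 (.var 20) (.const 1)) s₂) =
      (s₂.setArr 10 k 1).setVar 24 0 := by
    have : k < R := by omega
    simp [den, hv, h20, hk.1, h.var_five, this]
  set s₃ := den (assign 24 (.const 0)) (den (store 10 (.var 20) (.const 1)) s₂) with hs₃
  have hz₃ : Sizes n N R w s₃ := h.of_eq (by simp [hden, hv]) (by simp [hden, hv])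
    (by simp [hden, hv]) (by simp [hden, ha])
  obtain ⟨hD, hA, hR⟩ := hS
  have hF : Found n N k w n (searchLoop.den s₃) := by
    refine searchLoop_spec hz₃ hk (by simp [hden]) ⟨?_, ?_, ?_, ?_⟩
    · simpa [hden, ha] using hD
    · simpa [hden, ha] using hA
    · simpa [hden, ha] using hR
    · refine tree_singleton ?_ (by simp [hden]) ?_
      · simpa [hden] using h11
      · intro i h0 h1 h2
        simpa [hden, h2, h10'] using h10 i h0 h1
  refine augmentLoop_spec (hz₃.of_eq (var_den _ _ (by decide)) (var_den _ _ (by decide))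
    (var_den _ _ (by decide)) (arr_den _ _ (by decide))) hk ?_ hF
  rw [var_den _ _ (by decide), hden]
  simp [hv, h20]

/-- The Hungarian method. -/
def hungarian : Prog :=
  .loop 21 1 (.store 6 (.var 21) (.add (.var 7) (.var 7))) ;; .loop 20 1 phase

/-- With row variables `2 * K`, where `K` is variable `7`, column variables `0` and the empty
matching, the initial duals are feasible by `hw`. Each phase then matches one more row. The
assumptions on arrays `7`, `8` and `9` are a reason for clearing the memory between rounds. -/
theorem hungarian_spec (h : Sizes n N R w s) (h7 : s.arr 7 = 0) (h8 : s.arr 8 = 0)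
    (h9 : s.arr 9 = 0)
    (hw : ∀ i j, 0 ≤ i → i < n → 0 ≤ j → j < N → w (i * N + j) ≤ s.var 7 + s.var 7) :
    Solved n N n w (hungarian.den s) := by
  have hn := h.zero_le
  have hnN := h.le
  have hNR := h.le'
  rw [hungarian, den]
  set s₁ := (loop 21 1 (.store 6 (.var 21) (.add (.var 7) (.var 7)))).den s with hs₁
  have hz : Sizes n N R w s₁ := h.of_eq (var_den _ _ (by decide)) (var_den _ _ (by decide))
    (var_den _ _ (by decide)) (arr_den _ _ (by decide))
  have h6 : ∀ i, 0 ≤ i → i < n → s₁.arr 6 i = s.var 7 + s.var 7 := by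
    intro i h0 h1
    rw [hs₁, arr_loop (fun _ => s.var 7 + s.var 7), if_pos ⟨h0, by rwa [h.var_one]⟩]
    intro k s' hk hx hF hA
    have h5 := (hF.var 5 (by decide)).trans h.var_five
    have h7 := hF.var 7 (by decide)
    rw [h.var_one] at hk
    have hk' : (k : ℤ) < R := by omega
    simp [den, hx, h5, hk', h7]
  have e7 : s₁.arr 7 = 0 := by rw [hs₁, arr_den _ _ (by decide), h7]
  have e8 : s₁.arr 8 = 0 := by rw [hs₁, arr_den _ _ (by decide), h8]
  have e9 : s₁.arr 9 = 0 := by rw [hs₁, arr_den _ _ (by decide), h9]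
  have key := loop_induction (s := s₁) (x := 20) (b := 1) (c := phase)
    (fun k s' => Solved n N k w s') ?_ ?_
  · rwa [hz.var_one, Int.toNat_of_nonneg hn] at key
  · simp only [Solved, State.arr_setVar, e7, e8, e9]
    refine ⟨⟨fun i j h0 h1 h2 h3 => ?_, fun j h2 h3 => le_rfl, fun j _ _ _ => rfl,
      fun i j h0 h1 h2 h3 h4 => ?_, fun i h0 h1 => ?_, fun j h0 h1 => ?_⟩,
      fun i j h0 h1 h2 h3 => ?_, fun i h0 h1 => ?_⟩
    · rw [h6 i h0 h1]; simpa [weights] using hw i j h0 h1 h2 h3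
    all_goals simp only [Pi.zero_apply, Nat.cast_zero, true_iff] at *; omega
  · intro k s' hk hx hF ih
    rw [hz.var_one] at hk
    have := phase_spec (k := k) (hz.of_eq (s' := s') (hF.var _ (by decide)) (hF.var _ (by decide))
      (hF.var _ (by decide)) (hF.arr _ (by decide))) ⟨by omega, hk⟩ hx ih
    push_cast
    exact this

end Prog

end RAM

/-! ### The reduction to an assignment problem by slots and bonuses -/

namespace HouseAllocation.Market

variable {G : Market}

/-- The weight of an assignment with respect to integer weights. -/
def intWeight (G : Market) (w : Fin G.n → Fin G.m → ℤ) (M : G.Assignment) : ℤ :=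
  ∑ a, (M a).elim 0 (w a)

open Classical in
/-- The project of applicant `a` when she occupies slot `t` of project number `q`: she stays
unmatched if this is impossible. Projects with a lower quota above `1` are open if they are
in `T`. -/
noncomputable def slotProject (G : Market) (T : Fin G.m → Prop) (a : Fin G.n) (q t : ℕ) :
    Option (Fin G.m) :=
  if h : q < G.m then
    if G.adj a ⟨q, h⟩ = true ∧ t < G.upper ⟨q, h⟩ ∧ (G.lower ⟨q, h⟩ ≤ 1 ∨ T ⟨q, h⟩)
    then some ⟨q, h⟩ else none
  else none

/-- The weight of an applicant in a slot: the slots below a lower quota above `1` are worth an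
additional `K`. -/
def bonusWeight (G : Market) (w : Fin G.n → Fin G.m → ℤ) (K : ℤ) (a : Fin G.n)
    (o : Option (Fin G.m)) (t : ℕ) : ℤ :=
  o.elim 0 fun p => w a p + if 1 < G.lower p ∧ t < G.lower p then K else 0

/-- The number of occupied slots of `p` below its lower quota. -/
def bonusCount (G : Market) (M : G.Assignment) (t : Fin G.n → ℕ) (p : Fin G.m) : ℕ :=
  (Finset.univ.filter fun a => M a = some p ∧ t a < G.lower p).card

theorem slotProject_eq_some {T : Fin G.m → Prop} {a : Fin G.n} {q t : ℕ} {p : Fin G.m} :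
    G.slotProject T a q t = some p ↔
      q = p ∧ G.adj a p = true ∧ t < G.upper p ∧ (G.lower p ≤ 1 ∨ T p) := by
  unfold slotProject
  constructor
  · intro h
    split_ifs at h with h1 h2
    obtain rfl := Option.some.inj h
    exact ⟨rfl, h2⟩
  · rintro ⟨rfl, h⟩
    rw [dif_pos p.2, if_pos h]

/-- Double counting: the bonuses, collected by applicants, are regrouped by projects. -/
theorem sum_bonusWeight (w : Fin G.n → Fin G.m → ℤ) (K : ℤ) (M : G.Assignment)
    (t : Fin G.n → ℕ) :
    ∑ a, G.bonusWeight w K a (M a) (t a) =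
      G.intWeight w M + K * ∑ p with 1 < G.lower p, (G.bonusCount M t p : ℤ) := by
  have h : ∀ a, G.bonusWeight w K a (M a) (t a) = (M a).elim 0 (w a) +
      K * ∑ p with 1 < G.lower p, if M a = some p ∧ t a < G.lower p then 1 else 0 := by
    intro a
    rcases hM : M a with _ | p
    · simp [bonusWeight]
    · simp only [bonusWeight, Option.elim_some, Option.some.injEq, Finset.sum_filter]
      rw [Finset.sum_eq_single p]
      · by_cases h1 : 1 < G.lower p <;> by_cases h2 : t a < G.lower p <;> simp [h1, h2]
      · intro q _ hq
        simp [hq.symm]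
      · simp
  simp only [h, Finset.sum_add_distrib, ← Finset.mul_sum, intWeight, bonusCount]
  rw [Finset.sum_comm]
  simp

theorem abs_intWeight_le (w : Fin G.n → Fin G.m → ℤ) (M : G.Assignment) :
    |G.intWeight w M| ≤ ∑ a, ∑ p, |w a p| := by
  refine (Finset.abs_sum_le_sum_abs _ _).trans (Finset.sum_le_sum fun a _ => ?_)
  rcases M a with _ | p
  · simpa using Finset.sum_nonneg fun p _ => abs_nonneg (w a p)
  · exact Finset.single_le_sum (f := fun p => |w a p|) (fun p _ => abs_nonneg (w a p))
      (Finset.mem_univ p)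

/-- The number of applicants with a smaller index in the same place. -/
def slotIndex (G : Market) (M : G.Assignment) (a : Fin G.n) : ℕ :=
  (Finset.univ.filter fun b => b < a ∧ M b = M a).card

/-- Unmatched applicants are numbered among themselves as well, which gives them distinct slots of
the dummy block. -/
theorem slotIndex_lt (M : G.Assignment) (a : Fin G.n) :
    G.slotIndex M a < (Finset.univ.filter fun b => M b = M a).card := by
  refine Finset.card_lt_card ⟨fun b hb => ?_, fun h => ?_⟩
  · simp only [Finset.mem_filter, Finset.mem_univ, true_and] at hb ⊢
    exact hb.2
  · have := h (show a ∈ _ by simp)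
    simp at this

theorem slotIndex_strictMono (M : G.Assignment) {a b : Fin G.n} (hab : a < b) (h : M a = M b) :
    G.slotIndex M a < G.slotIndex M b := by
  refine Finset.card_lt_card ⟨fun c hc => ?_, fun hs => ?_⟩
  · simp only [Finset.mem_filter, Finset.mem_univ, true_and] at hc ⊢
    exact ⟨hc.1.trans hab, hc.2.trans h⟩
  · have := hs (show a ∈ _ by simp [hab, h])
    simp at this

theorem slotIndex_inj (M : G.Assignment) {a b : Fin G.n} (h : M a = M b)
    (hi : G.slotIndex M a = G.slotIndex M b) : a = b := by
  rcases lt_trichotomy a b with hab | hab | hab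
  · exact absurd hi (slotIndex_strictMono M hab h).ne
  · exact hab
  · exact absurd hi.symm (slotIndex_strictMono M hab h.symm).ne

theorem slotIndex_lt_load {M : G.Assignment} {a : Fin G.n} {p : Fin G.m} (h : M a = some p) :
    G.slotIndex M a < G.load M p := by
  have := slotIndex_lt M a
  rwa [h] at this

/-- The slot indices of the applicants at `p` are exactly the numbers below the load, so a project
that meets its lower quota has all its bonus slots occupied. -/
theorem lower_le_bonusCount {M : G.Assignment} {p : Fin G.m} (h : G.lower p ≤ G.load M p) :
    G.lower p ≤ G.bonusCount M (G.slotIndex M) p := by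
  have h1 : (Finset.univ.filter fun a => M a = some p).image (G.slotIndex M) =
      Finset.range (G.load M p) := by
    refine Finset.eq_of_subset_of_card_le (fun k hk => ?_) ?_
    · obtain ⟨a, ha, rfl⟩ := Finset.mem_image.1 hk
      simp only [Finset.mem_filter, Finset.mem_univ, true_and] at ha
      exact Finset.mem_range.2 (slotIndex_lt_load ha)
    · rw [Finset.card_range, Finset.card_image_of_injOn, load]
      intro a ha b hb hab
      simp only [Finset.coe_filter, Finset.mem_univ, true_and, Set.mem_ofPred_eq] at ha hb
      exact slotIndex_inj M (ha.trans hb.symm) hab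
  have h2 : Finset.range (G.lower p) ⊆
      (Finset.univ.filter fun a => M a = some p ∧ G.slotIndex M a < G.lower p).image
        (G.slotIndex M) := by
    intro k hk
    have hk' := Finset.mem_range.1 hk
    have : k ∈ Finset.range (G.load M p) := Finset.mem_range.2 (hk'.trans_le h)
    rw [← h1] at this
    obtain ⟨a, ha, rfl⟩ := Finset.mem_image.1 this
    simp only [Finset.mem_filter, Finset.mem_univ, true_and] at ha
    exact Finset.mem_image_of_mem _ (by simp [ha, hk'])
  have h3 := (Finset.card_le_card h2).trans Finset.card_image_le
  rwa [Finset.card_range] at h3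

/-- An optimal occupation of the slots yields a matching that is at least as heavy as every
matching with the same set of open projects. -/
theorem isMatching_of_slots {w : Fin G.n → Fin G.m → ℤ} {K : ℤ} {T : Fin G.m → Prop}
    {q t : Fin G.n → ℕ} {M' : G.Assignment} (hM' : G.IsMatching M')
    (hT : ∀ p, 1 < G.lower p → (T p ↔ G.load M' p ≠ 0))
    (hK : 2 * ∑ a, ∑ p, |w a p| < K)
    (hinj : ∀ a b, q a = q b → t a = t b → a = b)
    (hopt : ∀ q' t' : Fin G.n → ℕ, (∀ a, q' a ≤ G.m) → (∀ a, t' a < G.n) →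
      (∀ a b, q' a = q' b → t' a = t' b → a = b) →
      ∑ a, G.bonusWeight w K a (G.slotProject T a (q' a) (t' a)) (t' a) ≤
        ∑ a, G.bonusWeight w K a (G.slotProject T a (q a) (t a)) (t a)) :
    G.IsMatching (fun a => G.slotProject T a (q a) (t a)) ∧
      G.intWeight w M' ≤ G.intWeight w (fun a => G.slotProject T a (q a) (t a)) := by
  set M : G.Assignment := fun a => G.slotProject T a (q a) (t a) with hM
  have hMs : ∀ {a p}, M a = some p →
      q a = p ∧ G.adj a p = true ∧ t a < G.upper p ∧ (G.lower p ≤ 1 ∨ T p) :=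
    fun h => slotProject_eq_some.1 h
  have hload : ∀ {a p}, M' a = some p → G.load M' p ≠ 0 := fun {a p} h =>
    (Finset.card_pos.2 ⟨a, by simp [h]⟩).ne'
  have hquota : ∀ {p}, G.load M' p ≠ 0 → G.lower p ≤ G.load M' p ∧ G.load M' p ≤ G.upper p :=
    fun {p} h => (hM'.quota p).resolve_left h
  -- the given matching as an occupation of the slots
  have hproj : ∀ a, G.slotProject T a ((M' a).elim G.m fun p => p) (G.slotIndex M' a) = M' a := by
    intro a
    rcases ha : M' a with _ | p
    · simp [slotProject]
    · refine slotProject_eq_some.2 ⟨rfl, hM'.edge a p ha, ?_, ?_⟩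
      · exact (slotIndex_lt_load ha).trans_le (hquota (hload ha)).2
      · by_cases h1 : G.lower p ≤ 1
        · exact .inl h1
        · exact .inr ((hT p (by omega)).2 (hload ha))
  have h1 := hopt (fun a => (M' a).elim G.m fun p => p) (G.slotIndex M') ?_ ?_ ?_
  rotate_left
  · intro a
    rcases M' a with _ | p
    exacts [le_rfl, p.2.le]
  · intro a
    refine (slotIndex_lt M' a).trans_le ((Finset.card_le_univ _).trans_eq (by simp))
  · intro a b hab hab'
    refine slotIndex_inj M' ?_ hab'
    rcases ha : M' a with _ | p <;> rcases hb : M' b with _ | p' <;> simp [ha, hb] at hab ⊢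
    · omega
    · omega
    · exact Fin.ext hab
  simp only [hproj] at h1
  rw [sum_bonusWeight, show ∑ a, G.bonusWeight w K a (G.slotProject T a (q a) (t a)) (t a) =
    ∑ a, G.bonusWeight w K a (M a) (t a) from rfl, sum_bonusWeight] at h1
  -- comparison of the numbers of occupied bonus slots
  have hle : ∀ p ∈ Finset.univ.filter (fun p => 1 < G.lower p),
      (G.bonusCount M t p : ℤ) ≤ G.bonusCount M' (G.slotIndex M') p := by
    intro p hp
    simp only [Finset.mem_filter, Finset.mem_univ, true_and] at hp
    by_cases hl : G.load M' p = 0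
    · have : G.bonusCount M t p = 0 := by
        rw [bonusCount, Finset.card_eq_zero, Finset.filter_eq_empty_iff]
        rintro a - ⟨ha, -⟩
        rcases (hMs ha).2.2.2 with h | h
        · omega
        · exact (hT p hp).1 h hl
      rw [this]; positivity
    · have h2 := lower_le_bonusCount (hquota hl).1
      -- Applicants at the same project have distinct slots, so at most `lower p` of them earn a
      -- bonus, while `M'` attains this number.
      have h3 : G.bonusCount M t p ≤ G.lower p := by
        rw [← Finset.card_range (G.lower p)]
        refine Finset.card_le_card_of_injOn t (fun a ha => ?_) fun a ha b hb hab => ?_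
        · simp only [Finset.coe_filter, Finset.mem_univ, true_and, Set.mem_ofPred_eq] at ha
          simpa using ha.2
        · simp only [Finset.coe_filter, Finset.mem_univ, true_and, Set.mem_ofPred_eq] at ha hb
          exact hinj a b ((hMs ha.1).1.trans (hMs hb.1).1.symm) hab
      exact_mod_cast h3.trans h2
  have habs := abs_le.1 (abs_intWeight_le w M)
  have habs' := abs_le.1 (abs_intWeight_le w M')
  have hK0 : 0 < K := lt_of_le_of_lt (by positivity) hK
  -- One missing bonus would cost at least `K`, but the weights of two assignments differ by at most
  -- twice the sum of the absolute weights, which is less than `K`.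
  have hfull : ∀ p, 1 < G.lower p → G.load M' p ≠ 0 → G.lower p ≤ G.bonusCount M t p := by
    intro p hp hl
    by_contra hlt
    have h2 := lower_le_bonusCount (hquota hl).1
    have h3 : ∑ p with 1 < G.lower p, (G.bonusCount M t p : ℤ) <
        ∑ p with 1 < G.lower p, (G.bonusCount M' (G.slotIndex M') p : ℤ) :=
      Finset.sum_lt_sum hle ⟨p, by simp [hp], by omega⟩
    nlinarith
  refine ⟨⟨fun a p h => (hMs h).2.1, fun p => ?_⟩, ?_⟩
  · by_cases hl : G.load M p = 0
    · exact .inl hl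
    refine .inr ⟨?_, ?_⟩
    · by_cases hp : G.lower p ≤ 1
      · omega
      · obtain ⟨a, ha⟩ := Finset.card_pos.1 (Nat.pos_of_ne_zero hl)
        simp only [Finset.mem_filter, Finset.mem_univ, true_and] at ha
        have h2 := (hT p (by omega)).1 ((hMs ha).2.2.2.resolve_left hp)
        refine (hfull p (by omega) h2).trans (Finset.card_le_card fun b hb => ?_)
        simp only [Finset.mem_filter, Finset.mem_univ, true_and] at hb ⊢
        exact hb.1
    · rw [← Finset.card_range (G.upper p)]
      refine Finset.card_le_card_of_injOn t (fun a ha => ?_) fun a ha b hb hab => ?_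
      · simp only [Finset.coe_filter, Finset.mem_univ, true_and, Set.mem_ofPred_eq] at ha
        simpa using (hMs ha).2.2.1
      · simp only [Finset.coe_filter, Finset.mem_univ, true_and, Set.mem_ofPred_eq] at ha hb
        exact hinj a b ((hMs ha).1.trans (hMs hb).1.symm) hab
  -- `M` earns no more bonuses than `M'`, so its optimality for the total weight carries over to the
  -- ordinary weight.
  · have h3 := Finset.sum_le_sum hle
    nlinarith

end HouseAllocation.Market

/-! ### The memory layout and the frame conditions -/

namespace RAM

namespace Prog

open HouseAllocation

variable {G : Market} {w : Fin G.n → Fin G.m → ℤ} {K : ℤ} {s s' : State}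

/-- The number of cells of the arrays that are used. -/
def space (n m : ℕ) : ℕ := n * ((m + 1) * n) + (m + 1) * n + n + m + m * n + 1

/-- The memory holds the market `G`, the weights `w` and the number `K`. -/
structure Data (G : Market) (w : Fin G.n → Fin G.m → ℤ) (K : ℤ) (s : State) : Prop where
  var_one : s.var 1 = G.n
  var_two : s.var 2 = G.m
  var_three : s.var 3 = ((G.m + 1) * G.n : ℕ)
  var_four : s.var 4 = (G.n * ((G.m + 1) * G.n) : ℕ)
  var_five : s.var 5 = (space G.n G.m : ℕ)
  var_six : s.var 6 = (G.m * G.n : ℕ)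
  var_seven : s.var 7 = K
  input_zero : s.arr 0 0 = G.n
  input_one : s.arr 0 1 = G.m
  lower : ∀ p : Fin G.m, s.arr 0 (2 + p) = G.lower p
  upper : ∀ p : Fin G.m, s.arr 0 (2 + G.m + p) = G.upper p
  adj : ∀ (a : Fin G.n) (p : Fin G.m), s.arr 2 (a * G.m + p) = if G.adj a p = true then 1 else 0
  weight : ∀ (a : Fin G.n) (p : Fin G.m), s.arr 3 (a * G.m + p) = w a p

/-- The program does not change the market, the weights and the number `K`. -/
def keeps (c : Prog) : Bool :=
  (List.range 7).all (fun y => !c.vars.contains (y + 1)) && [0, 2, 3].all fun A => !c.arrs.contains A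

theorem frame_den (c : Prog) (s : State) : Frame c s (c.den s) :=
  ⟨fun _ h => var_den c s h, fun _ h => arr_den c s h⟩

theorem Data.of_frame (h : Data G w K s) {c : Prog} (hF : Frame c s s') (hc : c.keeps = true) :
    Data G w K s' := by
  simp only [keeps, Bool.and_eq_true, List.all_eq_true, List.mem_range, Bool.not_eq_true',
    List.contains_eq_mem, decide_eq_false_iff_not] at hc
  have hv : ∀ y, y < 7 → s'.var (y + 1) = s.var (y + 1) := fun y hy => hF.var _ (hc.1 y hy)
  have ha : ∀ A ∈ [0, 2, 3], s'.arr A = s.arr A := fun A hA => hF.arr _ (hc.2 A hA)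
  obtain ⟨h1, h2, h3, h4, h5, h6, h7, h8, h9, h10, h11, h12, h13⟩ := h
  rw [← hv _ (by decide)] at h1 h2 h3 h4 h5 h6 h7
  rw [← ha _ (by decide)] at h8 h9
  simp only [← ha 0 (by decide)] at h10 h11
  simp only [← ha 2 (by decide)] at h12
  simp only [← ha 3 (by decide)] at h13
  exact ⟨h1, h2, h3, h4, h5, h6, h7, h8, h9, h10, h11, h12, h13⟩

theorem Data.den (h : Data G w K s) {c : Prog} (hc : c.keeps = true) : Data G w K (c.den s) :=
  h.of_frame (frame_den c s) hc

theorem le_space (n m : ℕ) : n ≤ space n m ∧ m ≤ space n m ∧ (m + 1) * n ≤ space n m ∧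
    n * ((m + 1) * n) ≤ space n m ∧ m * n ≤ space n m ∧ 0 < space n m := by
  unfold space; omega

/-! ### Slots -/

/-- The project and the slot that belong to the column in variable `37`. -/
def locate : Prog :=
  .assign 35 (.div (.var 37) (.get 0 (.const 0))) ;;
  .assign 36 (.sub (.var 37) (.mul (.var 35) (.get 0 (.const 0))))

/-- The test whether the applicant in variable `34` can be in slot number `36` of project number
`35`, where array `4` contains the open projects. -/
def usable : Expr :=
  .and (.lt (.var 35) (.var 2)) (.and
    (.eq (.get 2 (.add (.mul (.var 34) (.var 2)) (.var 35))) (.const 1)) (.and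
    (.lt (.var 36) (.get 0 (.add (.add (.const 2) (.var 2)) (.var 35))))
    (.or (.le (.get 0 (.add (.const 2) (.var 35))) (.const 1))
      (.eq (.get 4 (.var 35)) (.const 1)))))

/-- The projects that are open according to array `4`. -/
def openProjects (G : Market) (s : State) (p : Fin G.m) : Prop := s.arr 4 p = 1

/-- Columns are numbered project by project, with `n` slots each, and the block with number `m` is
the dummy. The program multiplies by the input cell that holds `n`, because `lin` admits only input
cells as right factors. -/
theorem locate_spec (h : Data G w K s) {j : ℕ} (hj : s.var 37 = j) :
    (locate.den s).var 35 = (j / G.n : ℕ) ∧ (locate.den s).var 36 = (j % G.n : ℕ) := by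
  have h1 : (j : ℤ) - j / G.n * G.n = j % G.n := by
    rw [Int.emod_def, mul_comm (G.n : ℤ)]
  simp [locate, Prog.den, h.input_zero, hj, h1]

theorem holds_usable (h : Data G w K s) {a : Fin G.n} {q t : ℕ} (ha : s.var 34 = (a : ℕ))
    (hq : s.var 35 = q) (ht : s.var 36 = t) :
    usable.Holds s ↔ ∃ p, G.slotProject (openProjects G s) a q t = some p := by
  simp only [Market.slotProject_eq_some, usable, Expr.holds_and, Expr.holds_lt, Expr.holds_eq,
    Expr.holds_or, Expr.holds_le, Expr.eval, ha, hq, ht, h.var_two, openProjects]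
  constructor
  · rintro ⟨h1, h2, h3, h4⟩
    have hqm : q < G.m := by omega
    refine ⟨⟨q, hqm⟩, rfl, ?_⟩
    have e1 := h.adj a ⟨q, hqm⟩
    have e2 := h.lower ⟨q, hqm⟩
    have e3 := h.upper ⟨q, hqm⟩
    simp only at e1 e2 e3
    rw [e1] at h2
    rw [e3] at h3
    rw [e2] at h4
    refine ⟨by by_contra h5; simp [h5] at h2, by omega, h4.imp (by omega) id⟩
  · rintro ⟨p, rfl, h1, h2, h3⟩
    rw [h.adj, h.lower, h.upper, if_pos h1]
    exact ⟨by have := p.2; omega, rfl, by omega, h3.imp (by omega) id⟩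

/-- The column in variable `37` and the applicant that belong to the cell in variable `21`. -/
def locateCell : Prog :=
  .assign 34 (.div (.var 21) (.var 3)) ;;
  .assign 37 (.sub (.var 21)
    (.mul (.add (.mul (.var 34) (.get 0 (.const 1))) (.var 34)) (.get 0 (.const 0)))) ;;
  locate

/-- The computation of the weight of an applicant in a slot. -/
def storeSlot : Prog :=
  .ite usable
    (.ite (.and (.lt (.const 1) (.get 0 (.add (.const 2) (.var 35))))
        (.lt (.var 36) (.get 0 (.add (.const 2) (.var 35)))))
      (.store 5 (.var 21) (.add (.get 3 (.add (.mul (.var 34) (.var 2)) (.var 35))) (.var 7)))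
      (.store 5 (.var 21) (.get 3 (.add (.mul (.var 34) (.var 2)) (.var 35)))))
    (.store 5 (.var 21) (.const 0))

/-- The computation of the weights of all applicants in all slots. -/
def buildWeights : Prog := .loop 21 4 (locateCell ;; storeSlot)

theorem storeSlot_spec (h : Data G w K s) {a : Fin G.n} {q t : ℕ} (ha : s.var 34 = (a : ℕ))
    (hq : s.var 35 = q) (ht : s.var 36 = t) {k : ℕ} (hk : s.var 21 = k)
    (hkR : k < space G.n G.m) :
    (storeSlot.den s).arr 5 = Function.update (s.arr 5) k
      (G.bonusWeight w K a (G.slotProject (openProjects G s) a q t) t) := by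
  have h5 := h.var_five
  by_cases hu : usable.Holds s
  · rw [storeSlot, Prog.den, if_pos hu]
    obtain ⟨p, hp⟩ := (holds_usable h ha hq ht).1 hu
    obtain ⟨rfl, -⟩ := Market.slotProject_eq_some.1 hp
    rw [hp, Prog.den]
    have hw := h.weight a p
    have hl := h.lower p
    by_cases hb : 1 < G.lower p ∧ t < G.lower p
    · rw [if_pos (by simp [hq, hl, ht, hb])]
      simp [Prog.den, hk, h5, hkR, Market.bonusWeight, hb, ha, hq, h.var_two, hw, h.var_seven]
    · rw [if_neg (by simpa [hq, hl, ht] using hb)]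
      simp [Prog.den, hk, h5, hkR, Market.bonusWeight, hb, ha, hq, h.var_two, hw]
  · rw [storeSlot, Prog.den, if_neg hu]
    have hp : G.slotProject (openProjects G s) a q t = none := by
      rw [Option.eq_none_iff_forall_ne_some]
      exact fun p hp => hu ((holds_usable h ha hq ht).2 ⟨p, hp⟩)
    simp [Prog.den, hk, h5, hkR, Market.bonusWeight, hp]

theorem locateCell_spec (h : Data G w K s) {k : ℕ} (hk : s.var 21 = k) :
    (locateCell.den s).var 34 = (k / ((G.m + 1) * G.n) : ℕ) ∧
    (locateCell.den s).var 35 = (k % ((G.m + 1) * G.n) / G.n : ℕ) ∧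
    (locateCell.den s).var 36 = (k % ((G.m + 1) * G.n) % G.n : ℕ) := by
  set s₁ := (assign 37 (.sub (.var 21)
    (.mul (.add (.mul (.var 34) (.get 0 (.const 1))) (.var 34)) (.get 0 (.const 0))))).den
      ((assign 34 (.div (.var 21) (.var 3))).den s) with hs₁
  have hd : Data G w K s₁ := (h.den (by decide)).den (by decide)
  have h37 : s₁.var 37 = (k % ((G.m + 1) * G.n) : ℕ) := by
    rw [Nat.mod_def]
    have : (G.m + 1) * G.n * (k / ((G.m + 1) * G.n)) ≤ k := Nat.mul_div_le _ _
    push_cast [this]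
    simp [hs₁, Prog.den, hk, h.var_three, h.input_zero, h.input_one]
    ring
  have h34 : s₁.var 34 = (k / ((G.m + 1) * G.n) : ℕ) := by
    simp [hs₁, Prog.den, hk, h.var_three]
  obtain ⟨h1, h2⟩ := locate_spec hd h37
  refine ⟨?_, h1, h2⟩
  rw [← h34]
  exact var_den locate s₁ (by decide)

theorem buildWeights_spec (h : Data G w K s) (a : Fin G.n) {j : ℕ} (hj : j < (G.m + 1) * G.n) :
    (buildWeights.den s).arr 5 (a * ((G.m + 1) * G.n : ℕ) + j) =
      G.bonusWeight w K a (G.slotProject (openProjects G s) a (j / G.n) (j % G.n)) (j % G.n) := by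
  set N := (G.m + 1) * G.n with hN
  have hN0 : 0 < N := by omega
  have hlt : (a : ℕ) * N + j < G.n * N := by
    have := a.2
    nlinarith
  have hsp := le_space G.n G.m
  -- The default `0` is never stored: every cell below variable `4` belongs to some row `a < n`.
  rw [buildWeights, arr_loop (fun c => if hc : c.toNat / N < G.n then
    G.bonusWeight w K ⟨_, hc⟩ (G.slotProject (openProjects G s) ⟨_, hc⟩ (c.toNat % N / G.n)
      (c.toNat % N % G.n)) (c.toNat % N % G.n) else 0)]
  · have e1 : ((a : ℤ) * (N : ℕ) + j).toNat = a * N + j := by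
      have : (a : ℤ) * (N : ℕ) + j = ((a * N + j : ℕ) : ℤ) := by push_cast; ring
      rw [this, Int.toNat_natCast]
    have e2 : ((a : ℕ) * N + j) / N = a := by
      rw [add_comm, Nat.add_mul_div_right _ _ hN0, Nat.div_eq_of_lt hj, zero_add]
    have e3 : ((a : ℕ) * N + j) % N = j := by
      rw [add_comm, Nat.add_mul_mod_self_right, Nat.mod_eq_of_lt hj]
    rw [if_pos ⟨by positivity, by rw [h.var_four]; exact_mod_cast hlt⟩]
    simp only [e1, e2, e3, a.2, dif_pos]
  · intro k s' hk hx hF hA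
    have hd := h.of_frame hF (by decide)
    rw [h.var_four] at hk
    have hkN : k < G.n * N := by exact_mod_cast hk
    have hlt : k / N < G.n := Nat.div_lt_of_lt_mul (by rwa [mul_comm])
    obtain ⟨h1, h2, h3⟩ := locateCell_spec hd hx
    have hop : openProjects G (locateCell.den s') = openProjects G s := by
      funext p
      rw [openProjects, openProjects, arr_den _ _ (by decide), hF.arr _ (by decide)]
    rw [den_seq, storeSlot_spec (a := ⟨k / N, hlt⟩) (hd.den (by decide)) h1 h2 h3
      ((var_den _ _ (by decide)).trans hx) (by omega), arr_den locateCell _ (by decide)]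
    simp only [Int.toNat_natCast, hlt, dif_pos]
    rw [hop]

/-! ### Subsets of projects -/

/-- The number of projects before `k` with a lower quota above `1`. -/
def quotaIndex (G : Market) (k : ℕ) : ℕ :=
  (Finset.univ.filter fun p : Fin G.m => (p : ℕ) < k ∧ 1 < G.lower p).card

theorem quotaIndex_succ (G : Market) (p : Fin G.m) :
    quotaIndex G (p + 1) = quotaIndex G p + if 1 < G.lower p then 1 else 0 := by
  split_ifs with h
  · rw [quotaIndex, quotaIndex, ← Finset.card_insert_of_notMem (a := p) (by simp)]
    congr 1
    ext q
    simp only [Finset.mem_filter, Finset.mem_univ, true_and, Finset.mem_insert, Fin.ext_iff]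
    constructor
    · rintro ⟨h1, h2⟩
      by_cases h3 : (q : ℕ) = p
      exacts [.inl h3, .inr ⟨by omega, h2⟩]
    · rintro (h1 | h1)
      · obtain rfl := Fin.ext h1
        exact ⟨by omega, h⟩
      · exact ⟨by omega, h1.2⟩
  · rw [quotaIndex, quotaIndex, add_zero]
    congr 1
    ext q
    simp only [Finset.mem_filter, Finset.mem_univ, true_and]
    constructor
    · rintro ⟨h1, h2⟩
      refine ⟨?_, h2⟩
      by_contra h3
      obtain rfl : q = p := Fin.ext (by omega)
      exact h h2
    · exact fun h1 => ⟨by omega, h1.2⟩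

theorem quotaIndex_zero (G : Market) : quotaIndex G 0 = 0 := by simp [quotaIndex]

theorem quotaIndex_eq_mQuota (G : Market) : quotaIndex G G.m = G.mQuota := by
  simp [quotaIndex, Market.mQuota]

/-- Every set of projects with a lower quota above `1` is represented by a number. -/
theorem exists_mask (G : Market) (T : Fin G.m → Prop) (k : ℕ) (hk : k ≤ G.m) :
    ∃ x < 2 ^ quotaIndex G k, ∀ p : Fin G.m, (p : ℕ) < k → 1 < G.lower p →
      (x / 2 ^ quotaIndex G p % 2 = 1 ↔ T p) := by
  induction k with
  | zero => exact ⟨0, by simp [quotaIndex_zero], fun p hp => absurd hp (Nat.not_lt_zero _)⟩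
  | succ k ih =>
    obtain ⟨x, hx, h⟩ := ih (by omega)
    have hs := quotaIndex_succ G ⟨k, hk⟩
    simp only at hs
    by_cases hl : 1 < G.lower ⟨k, hk⟩
    · rw [if_pos hl] at hs
      classical
      set b := if T ⟨k, hk⟩ then 1 else 0 with hb
      have hb1 : b ≤ 1 := by rw [hb]; split_ifs <;> omega
      refine ⟨x + b * 2 ^ quotaIndex G k, ?_, fun p hp hlp => ?_⟩
      · rw [hs, pow_succ]; nlinarith
      · by_cases hpk : (p : ℕ) = k
        · obtain rfl : p = ⟨k, hk⟩ := Fin.ext hpk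
          simp only
          rw [Nat.add_mul_div_right _ _ (by positivity), Nat.div_eq_of_lt hx, zero_add, hb]
          split_ifs with hT <;> simp [hT]
        · rw [← h p (by omega) hlp]
          have h1 : quotaIndex G (p + 1) ≤ quotaIndex G k :=
            Finset.card_le_card fun q hq => by
              simp only [Finset.mem_filter, Finset.mem_univ, true_and] at hq ⊢
              exact ⟨by omega, hq.2⟩
          rw [quotaIndex_succ, if_pos hlp] at h1
          obtain ⟨d, hd⟩ := Nat.exists_eq_add_of_le h1
          -- The new bit stands above the bit of `p`, so what is added is a multiple of twice the
          -- power that belongs to `p` and does not affect that bit.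
          have : b * 2 ^ quotaIndex G k = b * 2 ^ d * 2 * 2 ^ quotaIndex G p := by
            rw [hd]; ring
          rw [this, Nat.add_mul_div_right _ _ (by positivity), Nat.add_mul_mod_self_right]
    · rw [if_neg hl, add_zero] at hs
      refine ⟨x, by rwa [hs], fun p hp hlp => h p ?_ hlp⟩
      by_contra h3
      obtain rfl : p = ⟨k, hk⟩ := Fin.ext (by simp only; omega)
      exact hl hlp

/-- The next bit of the mask. -/
def maskBit : Prog :=
  .ite (.lt (.const 1) (.get 0 (.add (.const 2) (.var 21))))
    (.assign 39 (.div (.var 38) (.const 2)) ;;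
      .store 4 (.var 21) (.sub (.var 38) (.add (.var 39) (.var 39))) ;; .assign 38 (.var 39))
    .skip

/-- The decoding of the mask in variable `9`. -/
def decodeMask : Prog := .assign 38 (.var 9) ;; .loop 21 2 maskBit

/-- Variable `38` is the mask shifted right by the number of projects with a lower quota above `1`
that have been passed. Only these consume a bit; for the others, array `4` is irrelevant. -/
theorem decodeMask_spec (h : Data G w K s) {x : ℕ} (hx : s.var 9 = x) (p : Fin G.m)
    (hp : 1 < G.lower p) :
    (decodeMask.den s).arr 4 p = (x / 2 ^ quotaIndex G p % 2 : ℕ) := by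
  rw [decodeMask, den_seq]
  set s₁ := (assign 38 (.var 9)).den s with hs₁
  have hd₁ : Data G w K s₁ := h.den (by decide)
  have h38 : s₁.var 38 = x := by simp [hs₁, den, hx]
  have key := loop_induction (s := s₁) (x := 21) (b := 2) (c := maskBit)
    (fun k s' => s'.var 38 = (x / 2 ^ quotaIndex G k : ℕ) ∧ ∀ p : Fin G.m, (p : ℕ) < k →
      1 < G.lower p → s'.arr 4 p = (x / 2 ^ quotaIndex G p % 2 : ℕ)) ?_ ?_
  · rw [hd₁.var_two, Int.toNat_natCast] at key
    exact key.2 p p.2 hp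
  · refine ⟨?_, fun p hp => absurd hp (Nat.not_lt_zero _)⟩
    simp [h38, quotaIndex_zero]
  · rintro k s' hk hx' hF ⟨h1, h2⟩
    have hd := hd₁.of_frame hF (by decide)
    rw [hd₁.var_two] at hk
    have hkm : k < G.m := by omega
    have hl := hd.lower ⟨k, hkm⟩
    have hs := quotaIndex_succ G ⟨k, hkm⟩
    have hsp : k < space G.n G.m := hkm.trans_le (le_space G.n G.m).2.1
    simp only at hl hs
    by_cases hlow : 1 < G.lower ⟨k, hkm⟩
    · rw [if_pos hlow] at hs
      have hdiv : ((x / 2 ^ quotaIndex G (k + 1) : ℕ) : ℤ) = (x / 2 ^ quotaIndex G k : ℕ) / 2 := by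
        rw [hs, pow_succ, ← Nat.div_div_eq_div_mul]; simp
      constructor
      · rw [hdiv]
        simp [maskBit, den, hx', hl, hlow, hd.var_five, hsp, h1]
      · have ha : (den maskBit s').arr 4 = Function.update (s'.arr 4) k
            (x / 2 ^ quotaIndex G k % 2 : ℕ) := by
          have : ((x / 2 ^ quotaIndex G k : ℕ) : ℤ) - ((x / 2 ^ quotaIndex G k : ℕ) / 2 +
              (x / 2 ^ quotaIndex G k : ℕ) / 2) = (x / 2 ^ quotaIndex G k % 2 : ℕ) := by
            generalize x / 2 ^ quotaIndex G k = y
            omega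
          rw [← this]
          simp [maskBit, den, hx', hl, hlow, hd.var_five, hsp, h1]
        intro p hp hlp
        rw [State.arr_setVar, ha, Function.update_apply]
        split_ifs with hpk
        · rw [show (p : ℕ) = k by omega]
        · exact h2 p (by omega) hlp
    · rw [if_neg hlow, add_zero] at hs
      have hden : den maskBit s' = s' := by simp [maskBit, den, hx', hl, hlow]
      rw [hden]
      refine ⟨by simp [h1, hs], fun p hp hlp => h2 p ?_ hlp⟩
      by_contra h3
      obtain rfl : p = ⟨k, hkm⟩ := Fin.ext (by simp only; omega)
      exact hlow hlp

end Prog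

end RAM

/-! ### Sums over applicants as they arise in loops -/

/-- The sum of a function over the elements of `Fin n` below `k`. -/
def Fin.sumBelow {n : ℕ} (f : Fin n → ℤ) (k : ℕ) : ℤ := ∑ a : Fin n, if (a : ℕ) < k then f a else 0

theorem Fin.sumBelow_zero {n : ℕ} (f : Fin n → ℤ) : sumBelow f 0 = 0 := by simp [sumBelow]

theorem Fin.sumBelow_succ {n : ℕ} (f : Fin n → ℤ) (a : Fin n) :
    sumBelow f (a + 1) = sumBelow f a + f a := by
  have : f a = ∑ b, if b = a then f b else 0 := by simp
  rw [sumBelow, sumBelow, this, ← Finset.sum_add_distrib]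
  refine Finset.sum_congr rfl fun b _ => ?_
  rcases lt_trichotomy (b : ℕ) a with h | h | h
  · rw [if_pos (by omega), if_pos h, if_neg (by rintro rfl; omega), add_zero]
  · obtain rfl := Fin.ext h
    simp
  · rw [if_neg (by omega), if_neg (by omega), if_neg (by rintro rfl; omega), add_zero]

theorem Fin.sumBelow_self {n : ℕ} (f : Fin n → ℤ) : sumBelow f n = ∑ a, f a := by
  simp [sumBelow]

theorem Fin.sum_Ico_int {n : ℕ} (f : ℤ → ℤ) :
    ∑ i ∈ Finset.Ico (0 : ℤ) n, f i = ∑ a : Fin n, f (a : ℕ) := by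
  symm
  refine Finset.sum_bij (fun a _ => ((a : ℕ) : ℤ)) (fun a _ => ?_) (fun a _ b _ h => ?_)
    (fun i hi => ?_) fun a _ => rfl
  · have := a.2
    rw [Finset.mem_Ico]; omega
  · exact Fin.ext (by omega)
  · rw [Finset.mem_Ico] at hi
    exact ⟨⟨i.toNat, by omega⟩, Finset.mem_univ _, by simp only; omega⟩

/-! ### Reading an assignment off the columns and evaluating it -/

namespace RAM

namespace Prog

open HouseAllocation

variable {G : Market} {w : Fin G.n → Fin G.m → ℤ} {K : ℤ} {s s' : State}

/-- The code of an applicant's project. -/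
def code {m : ℕ} (o : Option (Fin m)) : ℤ := o.elim 0 fun p => ((p : ℕ) : ℤ) + 1

theorem code_bounds {m : ℕ} (o : Option (Fin m)) : 0 ≤ code o ∧ code o ≤ m := by
  rcases o with _ | p
  · simp [code]
  · have := p.2
    simp only [code, Option.elim_some]; omega

theorem code_eq_iff {m : ℕ} (o : Option (Fin m)) (p : Fin m) :
    code o = ((p : ℕ) : ℤ) + 1 ↔ o = some p := by
  rcases o with _ | q
  · simp only [code, Option.elim_none, reduceCtorEq, iff_false]; omega
  · simp [code, Fin.ext_iff]

/-- The array `A` holds the assignment `M`. -/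
def Stores (G : Market) (s : State) (A : ℕ) (M : G.Assignment) : Prop :=
  ∀ a : Fin G.n, s.arr A (a : ℕ) = code (M a)

/-- The translation of the columns in array `8` into projects. -/
def decodeSlots : Prog :=
  .loop 21 1 (.assign 34 (.var 21) ;; .assign 37 (.sub (.get 8 (.var 21)) (.const 1)) ;; locate ;;
    .ite usable (.store 13 (.var 21) (.add (.var 35) (.const 1))) (.store 13 (.var 21) (.const 0)))

theorem decodeSlots_spec (h : Data G w K s) {j : Fin G.n → ℕ}
    (hj : ∀ a : Fin G.n, s.arr 8 (a : ℕ) = j a + 1) :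
    Stores G (decodeSlots.den s) 13
      fun a => G.slotProject (openProjects G s) a (j a / G.n) (j a % G.n) := by
  intro a
  rw [decodeSlots, arr_loop (fun i => if hi : i.toNat < G.n then
    code (G.slotProject (openProjects G s) ⟨_, hi⟩ (j ⟨_, hi⟩ / G.n) (j ⟨_, hi⟩ % G.n)) else 0)]
  · rw [if_pos ⟨by positivity, by rw [h.var_one]; exact_mod_cast a.2⟩]
    simp
  · intro k s' hk hx hF hA
    have hd := h.of_frame hF (by decide)
    rw [h.var_one] at hk
    have hkn : k < G.n := by omega
    have hks : k < space G.n G.m := hkn.trans_le (le_space _ _).1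
    have h8 := hj ⟨k, hkn⟩
    rw [← hF.arr 8 (by decide)] at h8
    simp only at h8
    simp only [den_seq]
    set s₁ := (assign 37 (.sub (.get 8 (.var 21)) (.const 1))).den
      ((assign 34 (.var 21)).den s') with hs₁
    have hd₁ : Data G w K s₁ := (hd.den (by decide)).den (by decide)
    have h37 : s₁.var 37 = (j ⟨k, hkn⟩ : ℕ) := by simp [hs₁, den, hx, h8]
    have h34 : s₁.var 34 = k := by simp [hs₁, den, hx]
    have h21 : s₁.var 21 = k := by simp [hs₁, den, hx]
    obtain ⟨h35, h36⟩ := locate_spec hd₁ h37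
    set s₂ := locate.den s₁ with hs₂
    have hd₂ : Data G w K s₂ := hd₁.den (by decide)
    have h34' : s₂.var 34 = k := by rw [hs₂, var_den _ _ (by decide), h34]
    have h21' : s₂.var 21 = k := by rw [hs₂, var_den _ _ (by decide), h21]
    have hop : openProjects G s₂ = openProjects G s := by
      funext p
      rw [openProjects, openProjects, hs₂, arr_den _ _ (by decide), hs₁, ← hF.arr 4 (by decide)]
      rfl
    have h13 : s₂.arr 13 = s'.arr 13 := by rw [hs₂, arr_den _ _ (by decide)]; rfl
    have hu := holds_usable hd₂ (a := ⟨k, hkn⟩) h34' h35 h36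
    rw [hop] at hu
    simp only [Int.toNat_natCast, hkn, dif_pos]
    by_cases hc : usable.Holds s₂
    · obtain ⟨p, hp⟩ := hu.1 hc
      obtain ⟨hq, -⟩ := Market.slotProject_eq_some.1 hp
      rw [hp, den, if_pos hc]
      simp [den, h21', hd₂.var_five, hks, h13, code, h35, ← hq]
    · have hp : G.slotProject (openProjects G s) ⟨k, hkn⟩ (j ⟨k, hkn⟩ / G.n) (j ⟨k, hkn⟩ % G.n) =
          none := by
        rw [Option.eq_none_iff_forall_ne_some]
        exact fun p hp => hc (hu.2 ⟨p, hp⟩)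
      rw [hp, den, if_neg hc]
      simp [den, h21', hd₂.var_five, hks, h13, code]

/-! ### The quotas and the weight of an assignment -/

/-- The test of one project. -/
def checkProject : Prog :=
  .assign 41 (.const 0) ;;
  .loop 21 1 (.ite (.eq (.get 13 (.var 21)) (.add (.var 22) (.const 1)))
    (.assign 41 (.add (.var 41) (.const 1))) .skip) ;;
  .ite (.and (.lt (.const 0) (.var 41))
      (.or (.lt (.var 41) (.get 0 (.add (.const 2) (.var 22))))
        (.lt (.get 0 (.add (.add (.const 2) (.var 2)) (.var 22))) (.var 41))))
    (.assign 40 (.const 0)) .skip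

/-- The test whether the assignment in array `13` satisfies the quotas. -/
def check : Prog := .assign 40 (.const 1) ;; .loop 22 2 checkProject

/-- The assignment `M` satisfies the quotas of the project `p`. -/
def QuotaMet (G : Market) (M : G.Assignment) (p : Fin G.m) : Prop :=
  G.load M p = 0 ∨ (G.lower p ≤ G.load M p ∧ G.load M p ≤ G.upper p)

theorem checkProject_spec (h : Data G w K s) {M : G.Assignment} (hM : Stores G s 13 M)
    {p : Fin G.m} (hp : s.var 22 = (p : ℕ)) :
    (QuotaMet G M p → (checkProject.den s).var 40 = s.var 40) ∧
      (¬ QuotaMet G M p → (checkProject.den s).var 40 = 0) := by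
  rw [checkProject, den_seq, den_seq]
  set s₁ := (assign 41 (.const 0)).den s with hs₁
  have hd₁ : Data G w K s₁ := h.den (by decide)
  set c : Prog := .ite (.eq (.get 13 (.var 21)) (.add (.var 22) (.const 1)))
    (.assign 41 (.add (.var 41) (.const 1))) .skip with hc
  set f : Fin G.n → ℤ := fun a => if M a = some p then 1 else 0 with hf
  have key := loop_induction (s := s₁) (x := 21) (b := 1) (c := c)
    (fun k s' => s'.var 41 = Fin.sumBelow f k) ?_ ?_
  · set s₂ := (loop 21 1 c).den s₁
    have hd₂ : Data G w K s₂ := hd₁.den (by decide)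
    rw [hd₁.var_one, Int.toNat_natCast, Fin.sumBelow_self, hf, Finset.sum_boole] at key
    replace key : s₂.var 41 = (G.load M p : ℕ) := key
    have h22 : s₂.var 22 = (p : ℕ) := (var_den _ _ (by decide)).trans ((var_den _ _ (by decide)).trans hp)
    have h40 : s₂.var 40 = s.var 40 := (var_den _ _ (by decide)).trans (var_den _ _ (by decide))
    have hl := hd₂.lower p
    have hu := hd₂.upper p
    simp only [QuotaMet]
    constructor
    · intro hq
      rw [den, if_neg, den, h40]
      simp [key, h22, hl, hu, hd₂.var_two]
      omega
    · intro hq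
      rw [den, if_pos]
      · simp [den]
      · simp [key, h22, hl, hu, hd₂.var_two]
        omega
  · simp [hs₁, den, Fin.sumBelow_zero]
  · intro k s' hk hx hF ih
    rw [hd₁.var_one] at hk
    have hkn : k < G.n := by omega
    have e1 : s'.arr 13 k = code (M ⟨k, hkn⟩) := by
      rw [hF.arr 13 (by decide), ← hM ⟨k, hkn⟩]; rfl
    have e2 : s'.var 22 = (p : ℕ) := by
      rw [hF.var 22 (by decide)]; simp [hs₁, den, hp]
    have hs := Fin.sumBelow_succ f ⟨k, hkn⟩
    simp only at hs
    rw [hs]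
    have e3 : Expr.Holds s' (.eq (.get 13 (.var 21)) (.add (.var 22) (.const 1))) ↔
        M ⟨k, hkn⟩ = some p := by
      simp [hx, e1, e2, code_eq_iff]
    by_cases hm : M ⟨k, hkn⟩ = some p
    · rw [hc, den, if_pos (e3.2 hm)]
      simp [den, ih, hf, hm]
    · rw [hc, den, if_neg (mt e3.1 hm)]
      simp [den, ih, hf, hm]

/-- A violated quota sets the flag to `0` and no later project sets it back, so the flag is the
conjunction over all projects. -/
theorem check_spec (h : Data G w K s) {M : G.Assignment} (hM : Stores G s 13 M) :
    (check.den s).var 40 = 1 ↔ ∀ p, QuotaMet G M p := by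
  rw [check, den_seq]
  set s₁ := (assign 40 (.const 1)).den s with hs₁
  have hd₁ : Data G w K s₁ := h.den (by decide)
  have key := loop_induction (s := s₁) (x := 22) (b := 2) (c := checkProject)
    (fun k s' => (s'.var 40 = 1 ∨ s'.var 40 = 0) ∧
      (s'.var 40 = 1 ↔ ∀ p : Fin G.m, (p : ℕ) < k → QuotaMet G M p)) ?_ ?_
  · rw [hd₁.var_two, Int.toNat_natCast] at key
    rw [key.2]
    exact ⟨fun h p => h p p.2, fun h p _ => h p⟩
  · simp [hs₁, den]
  · rintro k s' hk hx hF ⟨ih, ih'⟩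
    rw [hd₁.var_two] at hk
    have hkm : k < G.m := by omega
    have hM' : Stores G s' 13 M := fun a => by
      rw [hF.arr 13 (by decide), ← hM a]; rfl
    obtain ⟨h1, h2⟩ := checkProject_spec (hd₁.of_frame hF (by decide)) hM' (p := ⟨k, hkm⟩) hx
    have hsucc : (∀ p : Fin G.m, (p : ℕ) < k + 1 → QuotaMet G M p) ↔
        (∀ p : Fin G.m, (p : ℕ) < k → QuotaMet G M p) ∧ QuotaMet G M ⟨k, hkm⟩ := by
      constructor
      · exact fun hp => ⟨fun p hpk => hp p (by omega), hp _ (by simp)⟩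
      · rintro ⟨hp, hp'⟩ p hpk
        by_cases hpk' : (p : ℕ) = k
        · obtain rfl : p = ⟨k, hkm⟩ := Fin.ext hpk'
          exact hp'
        · exact hp p (by omega)
    rw [hsucc, State.var_setVar, if_neg (by decide)]
    by_cases hq : QuotaMet G M ⟨k, hkm⟩
    · rw [h1 hq, ih']
      exact ⟨by rwa [← ih'], by simp [hq]⟩
    · rw [h2 hq]
      simp [hq]

/-- The computation of the weight of the assignment in array `13`. -/
def value : Prog :=
  .assign 42 (.const 0) ;;
  .loop 21 1 (.ite (.lt (.const 0) (.get 13 (.var 21)))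
    (.assign 42 (.add (.var 42) (.get 3 (.add (.mul (.var 21) (.var 2))
      (.sub (.get 13 (.var 21)) (.const 1)))))) .skip)

theorem value_spec (h : Data G w K s) {M : G.Assignment} (hM : Stores G s 13 M) :
    (value.den s).var 42 = G.intWeight w M := by
  rw [value, den_seq]
  set s₁ := (assign 42 (.const 0)).den s with hs₁
  have hd₁ : Data G w K s₁ := h.den (by decide)
  set c : Prog := .ite (.lt (.const 0) (.get 13 (.var 21)))
    (.assign 42 (.add (.var 42) (.get 3 (.add (.mul (.var 21) (.var 2))
      (.sub (.get 13 (.var 21)) (.const 1)))))) .skip with hc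
  set f : Fin G.n → ℤ := fun a => (M a).elim 0 (w a) with hf
  have key := loop_induction (s := s₁) (x := 21) (b := 1) (c := c)
    (fun k s' => s'.var 42 = Fin.sumBelow f k) ?_ ?_
  · rwa [hd₁.var_one, Int.toNat_natCast, Fin.sumBelow_self] at key
  · simp [hs₁, den, Fin.sumBelow_zero]
  · intro k s' hk hx hF ih
    have hd := hd₁.of_frame hF (by decide)
    rw [hd₁.var_one] at hk
    have hkn : k < G.n := by omega
    have e1 : s'.arr 13 k = code (M ⟨k, hkn⟩) := by
      rw [hF.arr 13 (by decide), ← hM ⟨k, hkn⟩]; rfl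
    have hs := Fin.sumBelow_succ f ⟨k, hkn⟩
    simp only at hs
    rw [hs]
    rcases hm : M ⟨k, hkn⟩ with _ | p
    · rw [hm] at e1
      simp [hc, den, hx, e1, code, ih, hf, hm]
    · rw [hm] at e1
      have := hd.weight ⟨k, hkn⟩ p
      have h0 : (0 : ℤ) < (p : ℕ) + 1 := by omega
      simp [hc, den, hx, e1, code, ih, hf, hm, hd.var_two, this, h0]

/-- The weight and the assignment are kept if they are better than what was known before. -/
def update : Prog :=
  .ite (.and (.eq (.var 40) (.const 1)) (.lt (.var 10) (.var 42)))
    (.assign 10 (.var 42) ;; .loop 21 1 (.store 1 (.var 21) (.get 13 (.var 21)))) .skip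

/-- The memory holds a matching and its weight. -/
structure Best (G : Market) (w : Fin G.n → Fin G.m → ℤ) (s : State) (M : G.Assignment) :
    Prop where
  isMatching : G.IsMatching M
  stores : Stores G s 1 M
  zero : ∀ i, ¬ (0 ≤ i ∧ i < (G.n : ℤ)) → s.arr 1 i = 0
  weight : s.var 10 = G.intWeight w M

theorem update_pos (h : Data G w K s) {M M' : G.Assignment} (hM : Best G w s M)
    (hM' : Stores G s 13 M') (hm : G.IsMatching M') (h40 : s.var 40 = 1)
    (h42 : s.var 42 = G.intWeight w M') (hlt : s.var 10 < s.var 42) :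
    Best G w (update.den s) M' := by
  rw [update, den, if_pos (by simp [h40, hlt]), den_seq]
  set s₁ := (assign 10 (.var 42)).den s with hs₁
  have hd₁ : s₁.var 1 = G.n := by simp [hs₁, den, h.var_one]
  have key := arr_loop (x := 21) (b := 1) (A := 1) (c := .store 1 (.var 21) (.get 13 (.var 21)))
    (s := s₁) (s₁.arr 13) (by
      intro k s' hk hx hF hA
      rw [hd₁] at hk
      have hks : k < space G.n G.m := lt_of_lt_of_le (by omega) (le_space _ _).1
      have h5 : s'.var 5 = (space G.n G.m : ℕ) := by
        rw [hF.var 5 (by decide)]; simp [hs₁, den, h.var_five]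
      simp [den, hx, h5, hks, hF.arr 13 (by decide)])
  rw [hd₁] at key
  refine ⟨hm, fun a => ?_, fun i hi => ?_, ?_⟩
  · rw [key, if_pos ⟨by positivity, by have := a.2; omega⟩]
    exact hM' a
  · rw [key, if_neg hi]
    exact hM.zero i hi
  · rw [var_den _ _ (by decide)]
    simp [hs₁, den, h42]

theorem update_neg (h : ¬ (s.var 40 = 1 ∧ s.var 10 < s.var 42)) : update.den s = s := by
  rw [update, den, if_neg (by simpa using h), den]

end Prog

end RAM

/-! ### One round, and the loop over all masks -/

namespace RAM

namespace Prog

open HouseAllocation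

variable {G : Market} {w : Fin G.n → Fin G.m → ℤ} {K : ℤ} {s s' : State}

/-! ### Clearing the memory -/

/-- The current cell of some arrays is set to `0`. -/
def clearCells : List ℕ → Prog
  | [] => skip
  | A :: l => .store A (.var 21) (.const 0) ;; clearCells l

/-- Some variables are set to `0`. -/
def clearVars : List ℕ → Prog
  | [] => skip
  | x :: l => .assign x (.const 0) ;; clearVars l

theorem clearCells_spec (l : List ℕ) {k : ℤ} (hk : s.var 21 = k) (hk0 : 0 ≤ k ∧ k < s.var 5)
    {A : ℕ} (hA : A ∈ l) :
    ((clearCells l).den s).arr A = Function.update (s.arr A) k 0 := by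
  induction l generalizing s with
  | nil => simp at hA
  | cons B l ih =>
    rw [clearCells, den_seq]
    have hs : (store B (.var 21) (.const 0)).den s = s.setArr B k 0 := by
      simp [den, hk, hk0]
    rw [hs]
    by_cases hl : A ∈ l
    · rw [ih (by simpa) (by simpa) hl, State.arr_setArr]
      split_ifs with hAB
      · rw [hAB]; simp
      · rfl
    · have hAB : A = B := by simpa [hl] using hA
      have : A ∉ (clearCells l).arrs := by
        clear ih hA hs hAB
        induction l with
        | nil => simp [clearCells, arrs]
        | cons C l ih => simp_all [clearCells, arrs]
      rw [arr_den _ _ this, hAB]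
      simp

theorem clearVars_spec (l : List ℕ) (s : State) (y : ℕ) :
    ((clearVars l).den s).var y = if y ∈ l then 0 else s.var y := by
  induction l generalizing s with
  | nil => simp [clearVars, den]
  | cons x l ih =>
    rw [clearVars, den_seq, ih]
    by_cases h1 : y ∈ l <;> by_cases h2 : y = x <;> simp [h1, h2, den]

/-- The arrays that are used in a round. -/
def scratchArrs : List ℕ := [4, 5, 6, 7, 8, 9, 10, 11, 12, 13]

/-- The variables that are used in a round. -/
def scratchVars : List ℕ :=
  [20, 21, 22, 23, 24, 25, 26, 27, 28, 29, 30, 31, 32, 33, 34, 35, 36, 37, 38, 39, 40, 41, 42]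

/-- The memory is ready for the next round. -/
structure Ready (G : Market) (w : Fin G.n → Fin G.m → ℤ) (K : ℤ) (s : State) : Prop where
  data : Data G w K s
  arr : ∀ A ∈ scratchArrs, s.arr A = 0
  var : ∀ y ∈ scratchVars, s.var y = 0

/-- The search for the best matching for the mask in variable `9`. -/
def round : Prog :=
  decodeMask ;; buildWeights ;; hungarian ;; decodeSlots ;; check ;; value ;; update

/-- All auxiliary arrays and variables are set to `0`. -/
def clear : Prog := .loop 21 5 (clearCells scratchArrs) ;; clearVars scratchVars

/-- This is the hypothesis of `hungarian_spec`: a single weight is below `K` and a bonus adds at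
most `K`, so `K + K` is a feasible start for the row variables. -/
theorem bonusWeight_le (hK : 2 * ∑ a, ∑ p, |w a p| < K) (a : Fin G.n) (o : Option (Fin G.m))
    (t : ℕ) : G.bonusWeight w K a o t ≤ K + K := by
  have h0 : 0 ≤ ∑ a, ∑ p, |w a p| := by positivity
  rcases o with _ | p
  · simp only [Market.bonusWeight, Option.elim_none]; omega
  · have h1 : |w a p| ≤ ∑ p, |w a p| :=
      Finset.single_le_sum (f := fun p => |w a p|) (fun _ _ => abs_nonneg _) (Finset.mem_univ p)
    have h2 : ∑ p, |w a p| ≤ ∑ a, ∑ p, |w a p| :=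
      Finset.single_le_sum (f := fun a => ∑ p, |w a p|) (fun _ _ => by positivity)
        (Finset.mem_univ a)
    have h3 := le_abs_self (w a p)
    simp only [Market.bonusWeight, Option.elim_some]
    split_ifs <;> omega

/-- The columns that are found are an optimal occupation of the slots. -/
theorem hungarian_slots (h : Data G w K s) (hK : 2 * ∑ a, ∑ p, |w a p| < K)
    (h7 : s.arr 7 = 0) (h8 : s.arr 8 = 0) (h9 : s.arr 9 = 0) {T : Fin G.m → Prop}
    (hw : ∀ (a : Fin G.n) (j : ℕ), j < (G.m + 1) * G.n →
      s.arr 5 ((a : ℕ) * ((G.m + 1) * G.n : ℕ) + j) =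
        G.bonusWeight w K a (G.slotProject T a (j / G.n) (j % G.n)) (j % G.n)) :
    ∃ j : Fin G.n → ℕ, (∀ a : Fin G.n, (hungarian.den s).arr 8 (a : ℕ) = j a + 1) ∧
      (∀ a b, j a / G.n = j b / G.n → j a % G.n = j b % G.n → a = b) ∧
      ∀ q' t' : Fin G.n → ℕ, (∀ a, q' a ≤ G.m) → (∀ a, t' a < G.n) →
        (∀ a b, q' a = q' b → t' a = t' b → a = b) →
        ∑ a, G.bonusWeight w K a (G.slotProject T a (q' a) (t' a)) (t' a) ≤
          ∑ a, G.bonusWeight w K a (G.slotProject T a (j a / G.n) (j a % G.n)) (j a % G.n) := by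
  set N := (G.m + 1) * G.n with hN
  have hsp := le_space G.n G.m
  have hnN : G.n ≤ N := by rw [hN]; nlinarith
  have hS : Sizes G.n N (space G.n G.m) (s.arr 5) s :=
    ⟨by positivity, by exact_mod_cast hnN, by exact_mod_cast hsp.2.2.1, h.var_one, h.var_three,
      h.var_five, rfl⟩
  obtain ⟨hD, hA, hR⟩ := hungarian_spec hS h7 h8 h9 (fun i j h0 h1 h2 h3 => by
    obtain ⟨j, rfl⟩ := Int.eq_ofNat_of_zero_le h2
    obtain ⟨i, rfl⟩ := Int.eq_ofNat_of_zero_le h0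
    have := hw ⟨i, by omega⟩ j (by omega)
    simp only at this
    rw [this, h.var_seven]
    exact bonusWeight_le hK _ _ _)
  set s' := hungarian.den s
  have hcol : ∀ a : Fin G.n, 1 ≤ s'.arr 8 (a : ℕ) ∧ s'.arr 8 (a : ℕ) ≤ N := by
    intro a
    have h1 := hD.row (a : ℕ) (by omega) (by have := a.2; omega)
    have h2 := hR (a : ℕ) (by omega) (by have := a.2; omega)
    have := a.2
    omega
  set j : Fin G.n → ℕ := fun a => (s'.arr 8 (a : ℕ) - 1).toNat with hj
  have hj1 : ∀ a : Fin G.n, s'.arr 8 (a : ℕ) = j a + 1 := fun a => by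
    have := hcol a; simp only [hj]; omega
  have hjN : ∀ a, j a < N := fun a => by have := hcol a; have := hj1 a; omega
  refine ⟨j, hj1, fun a b hq ht => ?_, fun q' t' hq' ht' hinj => ?_⟩
  · have hjj : j a = j b := by
      rw [← Nat.div_add_mod (j a) G.n, hq, ht, Nat.div_add_mod]
    have h1 := (hA (a : ℕ) (j a) (by omega) (by omega) (by omega) (by have := hjN a; omega)).1
      (hj1 a)
    have h2 := (hA (b : ℕ) (j a) (by omega) (by omega) (by omega) (by have := hjN a; omega)).1
      (by rw [hjj]; exact hj1 b)
    exact Fin.ext (by omega)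
  -- Columns are decoded by division by `n`, so the case without applicants is treated apart; there
  -- both sums are empty.
  · rcases Nat.eq_zero_or_pos G.n with hn | hn
    · have : IsEmpty (Fin G.n) := by rw [hn]; infer_instance
      simp
    have hcolN : ∀ a, q' a * G.n + t' a < N := fun a => by
      have := hq' a
      have := ht' a
      rw [hN]; nlinarith
    -- The competing occupation as a choice of columns; the value `0` outside the rows is not used.
    set σ : ℤ → ℤ := fun i => if hi : i.toNat < G.n then
      (q' ⟨_, hi⟩ * G.n + t' ⟨_, hi⟩ : ℕ) else 0 with hσ
    have hσa : ∀ a : Fin G.n, σ (a : ℕ) = (q' a * G.n + t' a : ℕ) := fun a => by simp [hσ]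
    have key := hD.optimal hA hR σ (fun i hi => ?_) ?_
    · rw [Fin.sum_Ico_int (fun i => weights (s.arr 5) N i (σ i)),
        Fin.sum_Ico_int (fun i => weights (s.arr 5) N i (s'.arr 8 i - 1))] at key
      convert key using 2 with a _ a _
      · rw [hσa, weights, hw a _ (hcolN a), add_comm, Nat.add_mul_div_right _ _ hn,
          Nat.add_mul_mod_self_right, Nat.div_eq_of_lt (ht' a), Nat.mod_eq_of_lt (ht' a), zero_add]
      · rw [hj1, weights, add_sub_cancel_right, hw a _ (hjN a)]
    · rw [Finset.mem_Ico] at hi ⊢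
      have : i = ((⟨i.toNat, by omega⟩ : Fin G.n) : ℕ) := by simp only; omega
      rw [this, hσa]
      exact ⟨by positivity, by exact_mod_cast hcolN _⟩
    · intro i hi i' hi' hii
      rw [Finset.coe_Ico, Set.mem_Ico] at hi hi'
      obtain ⟨a, rfl⟩ : ∃ a : Fin G.n, i = (a : ℕ) := ⟨⟨i.toNat, by omega⟩, by simp only; omega⟩
      obtain ⟨b, rfl⟩ : ∃ b : Fin G.n, i' = (b : ℕ) := ⟨⟨i'.toNat, by omega⟩, by simp only; omega⟩
      rw [hσa, hσa, Nat.cast_inj] at hii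
      have e1 := congrArg (· / G.n) hii
      have e2 := congrArg (· % G.n) hii
      simp only [add_comm _ (t' _), Nat.add_mul_div_right _ _ hn, Nat.add_mul_mod_self_right,
        Nat.div_eq_of_lt (ht' _), Nat.mod_eq_of_lt (ht' _), zero_add] at e1 e2
      rw [hinj a b e1 e2]

/-- If some matching realizes the mask, `isMatching_of_slots` guarantees that the assignment passes
the check and is at least as heavy. If none does, the claim about the mask is vacuous, and the check
protects the stored matching from an invalid one. -/
theorem round_spec (h : Ready G w K s) (hK : 2 * ∑ a, ∑ p, |w a p| < K) {x : ℕ}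
    (hx : s.var 9 = x) {M : G.Assignment} (hM : Best G w s M) :
    ∃ M', Best G w (round.den s) M' ∧ G.intWeight w M ≤ G.intWeight w M' ∧
      ∀ M₁, G.IsMatching M₁ →
        (∀ p, 1 < G.lower p → (x / 2 ^ quotaIndex G p % 2 = 1 ↔ G.load M₁ p ≠ 0)) →
        G.intWeight w M₁ ≤ G.intWeight w M' := by
  simp only [round, den_seq]
  set s₁ := decodeMask.den s with hs₁
  set s₂ := buildWeights.den s₁ with hs₂
  set s₃ := hungarian.den s₂ with hs₃
  set s₄ := decodeSlots.den s₃ with hs₄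
  set s₅ := check.den s₄ with hs₅
  set s₆ := value.den s₅ with hs₆
  have hd₁ : Data G w K s₁ := h.data.den (by decide)
  have hd₂ : Data G w K s₂ := hd₁.den (by decide)
  have hd₃ : Data G w K s₃ := hd₂.den (by decide)
  have hd₄ : Data G w K s₄ := hd₃.den (by decide)
  have hd₅ : Data G w K s₅ := hd₄.den (by decide)
  have hd₆ : Data G w K s₆ := hd₅.den (by decide)
  have hz : ∀ A ∈ [7, 8, 9], s₂.arr A = 0 := by
    intro A hA
    have : A ∉ decodeMask.arrs ∧ A ∉ buildWeights.arrs ∧ A ∈ scratchArrs := by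
      revert A; decide
    rw [hs₂, arr_den _ _ this.2.1, hs₁, arr_den _ _ this.1, h.arr A this.2.2]
  obtain ⟨j, hj, hinj, hopt⟩ := hungarian_slots hd₂ hK (hz 7 (by decide)) (hz 8 (by decide))
    (hz 9 (by decide)) (fun a j hj => buildWeights_spec hd₁ a hj)
  have hop : openProjects G s₃ = openProjects G s₁ := by
    funext p
    rw [openProjects, openProjects, hs₃, arr_den _ _ (by decide), hs₂, arr_den _ _ (by decide)]
  have hM' := decodeSlots_spec hd₃ hj
  rw [hop] at hM'
  set M' : G.Assignment :=
    fun a => G.slotProject (openProjects G s₁) a (j a / G.n) (j a % G.n) with hM'def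
  have h40 : s₆.var 40 = 1 ↔ ∀ p, QuotaMet G M' p := by
    rw [hs₆, var_den _ _ (by decide)]; exact check_spec hd₄ hM'
  have hM'₅ : Stores G s₅ 13 M' := fun a => by
    rw [hs₅, arr_den _ _ (by decide)]; exact hM' a
  have hM'₆ : Stores G s₆ 13 M' := fun a => by
    rw [hs₆, arr_den _ _ (by decide)]; exact hM'₅ a
  have h42 := value_spec hd₅ hM'₅
  have e10 : s₆.var 10 = s.var 10 := by
    simp only [hs₆, hs₅, hs₄, hs₃, hs₂, hs₁]
    iterate 6 rw [var_den _ _ (by decide)]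
  have e1 : s₆.arr 1 = s.arr 1 := by
    simp only [hs₆, hs₅, hs₄, hs₃, hs₂, hs₁]
    iterate 6 rw [arr_den _ _ (by decide)]
  have hB : Best G w s₆ M := ⟨hM.isMatching, fun a => by rw [e1]; exact hM.stores a,
    fun i hi => by rw [e1]; exact hM.zero i hi, by rw [e10, hM.weight]⟩
  have hbest : ∀ M₁, G.IsMatching M₁ →
      (∀ p, 1 < G.lower p → (x / 2 ^ quotaIndex G p % 2 = 1 ↔ G.load M₁ p ≠ 0)) →
      (∀ p, QuotaMet G M' p) ∧ G.intWeight w M₁ ≤ G.intWeight w M' := by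
    intro M₁ h1 h2
    have h3 := Market.isMatching_of_slots h1 (T := openProjects G s₁) (fun p hp => by
      rw [← h2 p hp, openProjects, hs₁, decodeMask_spec h.data hx p hp]
      norm_cast) hK hinj hopt
    exact ⟨h3.1.quota, h3.2⟩
  by_cases hq : ∀ p, QuotaMet G M' p
  · have hm : G.IsMatching M' := ⟨fun a p hap => (Market.slotProject_eq_some.1 hap).2.1, hq⟩
    by_cases hlt : s₆.var 10 < s₆.var 42
    · refine ⟨M', update_pos hd₆ hB hM'₆ hm (h40.2 hq) h42 hlt, ?_,
        fun M₁ h1 h2 => (hbest M₁ h1 h2).2⟩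
      rw [hB.weight, h42] at hlt
      exact hlt.le
    · rw [update_neg (by tauto)]
      refine ⟨M, hB, le_rfl, fun M₁ h1 h2 => (hbest M₁ h1 h2).2.trans ?_⟩
      rw [hB.weight, h42] at hlt
      exact not_lt.1 hlt
  · rw [update_neg (by tauto)]
    -- A failed check shows that no matching has this mask.
    exact ⟨M, hB, le_rfl, fun M₁ h1 h2 => absurd (hbest M₁ h1 h2).1 hq⟩

/-- The loop clears exactly the cells to which guarded stores can write; `hz` covers all others. -/
theorem clear_spec (h : Data G w K s)
    (hz : ∀ A ∈ scratchArrs, ∀ i, ¬ (0 ≤ i ∧ i < s.var 5) → s.arr A i = 0) :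
    Ready G w K (clear.den s) := by
  rw [clear, den_seq]
  have hd₁ : Data G w K ((loop 21 5 (clearCells scratchArrs)).den s) := h.den (by decide)
  refine ⟨hd₁.den (by decide), fun A hA => ?_, fun y hy => ?_⟩
  · rw [arr_den (clearVars scratchVars) _ (by revert A; decide)]
    ext i
    rw [arr_loop (fun _ => 0)]
    · split_ifs with hi
      · rfl
      · rw [hz A hA i hi]; rfl
    · intro k s' hk hx hF _
      refine clearCells_spec _ hx ⟨by omega, ?_⟩ hA
      rwa [hF.var 5 (by decide)]
  · rw [clearVars_spec, if_pos hy]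

/-- One round with the mask in variable `9`. -/
def body : Prog := round ;; clear

theorem body_spec (h : Ready G w K s) (hK : 2 * ∑ a, ∑ p, |w a p| < K) {x : ℕ}
    (hx : s.var 9 = x) {M : G.Assignment} (hM : Best G w s M) :
    Ready G w K (body.den s) ∧ ∃ M', Best G w (body.den s) M' ∧
      G.intWeight w M ≤ G.intWeight w M' ∧ ∀ M₁, G.IsMatching M₁ →
        (∀ p, 1 < G.lower p → (x / 2 ^ quotaIndex G p % 2 = 1 ↔ G.load M₁ p ≠ 0)) →
        G.intWeight w M₁ ≤ G.intWeight w M' := by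
  rw [body, den_seq]
  obtain ⟨M', hM', h1, h2⟩ := round_spec h hK hx hM
  refine ⟨clear_spec (h.data.den (by decide)) fun A hA i hi => ?_, M', ?_, h1, h2⟩
  · rw [var_den _ _ (by decide)] at hi
    -- The round cannot write outside the range given by variable `5`, so these cells are still `0`
    -- from the previous clearing.
    rw [arr_den_of_not_mem _ _ (by decide) hi, h.arr A hA]
    rfl
  · have e1 : (clear.den (round.den s)).arr 1 = (round.den s).arr 1 := arr_den _ _ (by decide)
    have e2 : (clear.den (round.den s)).var 10 = (round.den s).var 10 := var_den _ _ (by decide)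
    exact ⟨hM'.isMatching, fun a => by rw [e1]; exact hM'.stores a,
      fun i hi => by rw [e1]; exact hM'.zero i hi, by rw [e2]; exact hM'.weight⟩

/-- All masks are tried. -/
def search : Prog := .loop 9 8 body

theorem Ready.setVar (h : Ready G w K s) (z : ℤ) : Ready G w K (s.setVar 9 z) := by
  have hF : Frame (assign 9 (.const 0)) s (s.setVar 9 z) :=
    ⟨fun y hy => by simp only [vars, List.mem_singleton] at hy; simp [hy], fun A _ => rfl⟩
  refine ⟨h.data.of_frame hF (by decide), h.arr, fun y hy => ?_⟩
  rw [hF.var y (by revert y; decide)]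
  exact h.var y hy

theorem Best.setVar {M : G.Assignment} (h : Best G w s M) (z : ℤ) : Best G w (s.setVar 9 z) M :=
  ⟨h.isMatching, h.stores, h.zero, by simpa using h.weight⟩

/-- What holds before round `k`. -/
def SearchInv (G : Market) (w : Fin G.n → Fin G.m → ℤ) (K : ℤ) (k : ℕ) (s : State) : Prop :=
  Ready G w K s ∧ ∃ M, Best G w s M ∧ ∀ M₁, G.IsMatching M₁ → ∀ x < k,
    (∀ p, 1 < G.lower p → (x / 2 ^ quotaIndex G p % 2 = 1 ↔ G.load M₁ p ≠ 0)) →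
    G.intWeight w M₁ ≤ G.intWeight w M

/-- The invariant is recorded for every intermediate `k`, since the bound on the word lengths is
needed at the start of each round and not only at the end. -/
theorem search_inv (h : Ready G w K s) (hK : 2 * ∑ a, ∑ p, |w a p| < K) {M : G.Assignment}
    (hM : Best G w s M) (k : ℕ) (hk : k ≤ (s.var 8).toNat) :
    Frame search s (loopState body.den 9 s k) ∧
      SearchInv G w K k (loopState body.den 9 s k) := by
  refine loopState_induction (SearchInv G w K) ?_ ?_ k hk
  · exact ⟨h.setVar 0, M, hM.setVar 0, fun _ _ x hx => absurd hx (Nat.not_lt_zero x)⟩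
  · rintro k s' hk hx hF ⟨h1, M, h2, h3⟩
    obtain ⟨h4, M', h5, h6, h7⟩ := body_spec h1 hK hx h2
    refine ⟨h4.setVar _, M', h5.setVar _, fun M₁ hM₁ x hx' hmask => ?_⟩
    by_cases hxk : x < k
    · exact (h3 M₁ hM₁ x hxk hmask).trans h6
    · obtain rfl : x = k := by omega
      exact h7 M₁ hM₁ hmask

theorem search_spec (h : Ready G w K s) (hK : 2 * ∑ a, ∑ p, |w a p| < K) {M : G.Assignment}
    (hM : Best G w s M) (hq : s.var 8 = (2 ^ G.mQuota : ℕ)) :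
    ∃ M', Best G w (search.den s) M' ∧
      ∀ M₁, G.IsMatching M₁ → G.intWeight w M₁ ≤ G.intWeight w M' := by
  obtain ⟨-, -, M', h1, h2⟩ := search_inv h hK hM _ le_rfl
  refine ⟨M', h1, fun M₁ hM₁ => ?_⟩
  -- Every matching has a mask, that of its open projects, and this mask is among those that were
  -- tried.
  obtain ⟨x, hx, hmask⟩ := exists_mask G (fun p => G.load M₁ p ≠ 0) G.m le_rfl
  rw [quotaIndex_eq_mQuota] at hx
  refine h2 M₁ hM₁ x ?_ fun p hp => hmask p p.2 hp
  rw [hq, Int.toNat_natCast]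
  exact hx

end Prog

end RAM

namespace RAM

namespace Prog

open HouseAllocation

variable {G : Market} {w : Fin G.n → Fin G.m → ℤ} {K : ℤ} {s s' : State}

/-! ### Preparation -/

/-- The memory holds the market `G` without its edges, and the derived sizes. -/
structure Base (G : Market) (s : State) : Prop where
  var_one : s.var 1 = G.n
  var_two : s.var 2 = G.m
  var_three : s.var 3 = ((G.m + 1) * G.n : ℕ)
  var_four : s.var 4 = (G.n * ((G.m + 1) * G.n) : ℕ)
  var_five : s.var 5 = (space G.n G.m : ℕ)
  var_six : s.var 6 = (G.m * G.n : ℕ)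
  input_zero : s.arr 0 0 = G.n
  input_one : s.arr 0 1 = G.m
  lower : ∀ p : Fin G.m, s.arr 0 (2 + p) = G.lower p
  upper : ∀ p : Fin G.m, s.arr 0 (2 + G.m + p) = G.upper p

/-- The program does not change the input and the derived sizes. -/
def keepsBase (c : Prog) : Bool :=
  (List.range 6).all (fun y => !c.vars.contains (y + 1)) && !c.arrs.contains 0

theorem Base.of_frame (h : Base G s) {c : Prog} (hF : Frame c s s') (hc : c.keepsBase = true) :
    Base G s' := by
  simp only [keepsBase, Bool.and_eq_true, List.all_eq_true, List.mem_range, Bool.not_eq_true',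
    List.contains_eq_mem, decide_eq_false_iff_not] at hc
  have hv : ∀ y, y < 6 → s'.var (y + 1) = s.var (y + 1) := fun y hy => hF.var _ (hc.1 y hy)
  have ha : s'.arr 0 = s.arr 0 := hF.arr _ hc.2
  obtain ⟨h1, h2, h3, h4, h5, h6, h8, h9, h10, h11⟩ := h
  rw [← hv _ (by decide)] at h1 h2 h3 h4 h5 h6
  rw [← ha] at h8 h9
  simp only [← ha] at h10 h11
  exact ⟨h1, h2, h3, h4, h5, h6, h8, h9, h10, h11⟩

theorem Base.den (h : Base G s) {c : Prog} (hc : c.keepsBase = true) : Base G (c.den s) :=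
  h.of_frame (frame_den c s) hc

theorem Base.data (h : Base G s)
    (hadj : ∀ (a : Fin G.n) (p : Fin G.m),
      s.arr 2 (a * G.m + p) = if G.adj a p = true then 1 else 0)
    (hw : ∀ (a : Fin G.n) (p : Fin G.m), s.arr 3 (a * G.m + p) = w a p) :
    Data G w (s.var 7) s :=
  ⟨h.var_one, h.var_two, h.var_three, h.var_four, h.var_five, h.var_six, rfl, h.input_zero,
    h.input_one, h.lower, h.upper, hadj, hw⟩

theorem Data.base (h : Data G w K s) : Base G s :=
  ⟨h.var_one, h.var_two, h.var_three, h.var_four, h.var_five, h.var_six, h.input_zero,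
    h.input_one, h.lower, h.upper⟩

/-- This provides the hypothesis of `steps_le`: `space` is chosen above all sizes that control
loops. -/
theorem Base.var_le (h : Base G s) : ∀ b ∈ Finset.Icc 1 6, s.var b ≤ (space G.n G.m : ℕ) := by
  have := le_space G.n G.m
  intro b hb
  fin_cases hb
  · simp only [h.var_one]; omega
  · simp only [h.var_two]; omega
  · simp only [h.var_three]; omega
  · simp only [h.var_four]; omega
  · simp only [h.var_five]; omega
  · simp only [h.var_six]; omega

/-- The computation of the sizes. -/
def setup : Prog :=
  .assign 1 (.get 0 (.const 0)) ;; .assign 2 (.get 0 (.const 1)) ;;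
  .assign 3 (.mul (.add (.get 0 (.const 1)) (.const 1)) (.get 0 (.const 0))) ;;
  .assign 4 (.mul (.var 3) (.get 0 (.const 0))) ;;
  .assign 6 (.mul (.get 0 (.const 1)) (.get 0 (.const 0))) ;;
  .assign 5 (.add (.add (.add (.add (.add (.var 4) (.var 3)) (.var 1)) (.var 2)) (.var 6))
    (.const 1))

theorem setup_spec (h0 : s.arr 0 0 = G.n) (h1 : s.arr 0 1 = G.m)
    (hl : ∀ p : Fin G.m, s.arr 0 (2 + p) = G.lower p)
    (hu : ∀ p : Fin G.m, s.arr 0 (2 + G.m + p) = G.upper p) : Base G (setup.den s) := by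
  have ha : (setup.den s).arr 0 = s.arr 0 := rfl
  refine ⟨?_, ?_, ?_, ?_, ?_, ?_, by rw [ha, h0], by rw [ha, h1], by rwa [ha], by rwa [ha]⟩ <;>
    simp [setup, den, h0, h1, space] <;> ring

/-- The computation of the bonus for the slots below the lower quotas. -/
def computeBonus : Prog :=
  .assign 7 (.const 1) ;;
  .loop 21 6 (.ite (.lt (.get 3 (.var 21)) (.const 0))
    (.assign 7 (.sub (.sub (.var 7) (.get 3 (.var 21))) (.get 3 (.var 21))))
    (.assign 7 (.add (.add (.var 7) (.get 3 (.var 21))) (.get 3 (.var 21)))))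

/-- The computation of the number of masks. -/
def countMasks : Prog :=
  .assign 8 (.const 1) ;;
  .loop 21 2 (.ite (.lt (.const 1) (.get 0 (.add (.const 2) (.var 21))))
    (.assign 8 (.add (.var 8) (.var 8))) .skip)

/-- The preparation of the search. -/
def prepare : Prog := computeBonus ;; countMasks ;; clearVars scratchVars

theorem sum_rowMajor (n m : ℕ) (f : ℕ → ℤ) :
    ∑ a : Fin n, ∑ p : Fin m, f (a * m + p) = ∑ c ∈ Finset.range (m * n), f c := by
  rw [← Fintype.sum_prod_type', mul_comm m n, ← Fin.sum_univ_eq_sum_range,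
    ← finProdFinEquiv.sum_comp]
  refine Finset.sum_congr rfl fun x _ => ?_
  rw [finProdFinEquiv_apply_val]
  congr 1
  ring

/-- The summand `1` makes `K` strictly larger than twice the sum of the absolute weights. Absolute
values are formed by adding or subtracting each weight twice according to its sign. -/
theorem computeBonus_spec (h : Data G w K s) :
    (computeBonus.den s).var 7 = 1 + 2 * ∑ a, ∑ p, |w a p| := by
  have key := loop_induction (s := s.setVar 7 1) (x := 21) (b := 6)
    (c := .ite (.lt (.get 3 (.var 21)) (.const 0))
    (.assign 7 (.sub (.sub (.var 7) (.get 3 (.var 21))) (.get 3 (.var 21))))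
    (.assign 7 (.add (.add (.var 7) (.get 3 (.var 21))) (.get 3 (.var 21)))))
    (fun k s' => s'.var 7 = 1 + 2 * ∑ c ∈ Finset.range k, |s.arr 3 c|) (by simp) ?_
  · have h6 : ((s.setVar 7 1).var 6).toNat = G.m * G.n := by
      rw [State.var_setVar, if_neg (by decide), h.var_six, Int.toNat_natCast]
    rw [h6] at key
    rw [computeBonus, den_seq]
    refine key.trans ?_
    rw [← sum_rowMajor G.n G.m fun c => |s.arr 3 c|]
    congr 2
    refine Finset.sum_congr rfl fun a _ => Finset.sum_congr rfl fun p _ => ?_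
    rw [← h.weight a p]
    push_cast
    rfl
  · intro k s' hk hx hF ih
    have e3 : s'.arr 3 = s.arr 3 := hF.arr 3 (by decide)
    rw [Finset.sum_range_succ, mul_add, ← add_assoc, ← ih]
    by_cases hneg : s.arr 3 k < 0
    · simp [den, hx, e3, hneg, abs_of_neg hneg]; ring
    · simp [den, hx, e3, hneg, abs_of_nonneg (not_lt.1 hneg)]; ring

theorem countMasks_spec (h : Base G s) :
    (countMasks.den s).var 8 = (2 ^ G.mQuota : ℕ) := by
  have key := loop_induction (s := s.setVar 8 1) (x := 21) (b := 2)
    (c := .ite (.lt (.const 1) (.get 0 (.add (.const 2) (.var 21))))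
    (.assign 8 (.add (.var 8) (.var 8))) .skip)
    (fun k s' => s'.var 8 = (2 ^ quotaIndex G k : ℕ)) (by simp [quotaIndex_zero]) ?_
  · have h2 : ((s.setVar 8 1).var 2).toNat = G.m := by
      rw [State.var_setVar, if_neg (by decide), h.var_two, Int.toNat_natCast]
    rw [h2, quotaIndex_eq_mQuota] at key
    exact key
  · intro k s' hk hx hF ih
    have e0 : s'.arr 0 = s.arr 0 := hF.arr 0 (by decide)
    rw [State.var_setVar, if_neg (by decide), h.var_two] at hk
    have hkm : k < G.m := by omega
    have hl := h.lower ⟨k, hkm⟩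
    have hs := quotaIndex_succ G ⟨k, hkm⟩
    simp only at hl hs
    by_cases hlow : 1 < G.lower ⟨k, hkm⟩
    · rw [if_pos hlow] at hs
      rw [hs, pow_succ]
      simp [den, hx, e0, hl, hlow, ih]; ring
    · rw [if_neg hlow, add_zero] at hs
      rw [hs]
      simp [den, hx, e0, hl, hlow, ih]

theorem arrs_clearVars (l : List ℕ) : (clearVars l).arrs = [] := by
  induction l with
  | nil => rfl
  | cons A l ih => simp [clearVars, arrs, ih]

theorem prepare_spec (h : Data G w K s) (hz : ∀ A ∈ scratchArrs, s.arr A = 0) :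
    Ready G w (1 + 2 * ∑ a, ∑ p, |w a p|) (prepare.den s) ∧
      (prepare.den s).var 8 = (2 ^ G.mQuota : ℕ) := by
  have ha : (prepare.den s).arr = s.arr := by
    ext A i
    rw [arr_den]
    simp [prepare, computeBonus, countMasks, arrs, arrs_clearVars]
  have hb : Base G (prepare.den s) := h.base.den (by decide)
  have h7 : (prepare.den s).var 7 = 1 + 2 * ∑ a, ∑ p, |w a p| := by
    rw [← computeBonus_spec h, prepare, den_seq, den_seq, var_den _ _ (by decide),
      var_den _ _ (by decide)]
  refine ⟨⟨?_, fun A hA => by rw [ha, hz A hA], fun y hy => ?_⟩, ?_⟩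
  · rw [← h7]
    exact hb.data (by rw [ha]; exact h.adj) (by rw [ha]; exact h.weight)
  · rw [prepare, den_seq, den_seq, clearVars_spec, if_pos hy]
  · rw [prepare, den_seq, den_seq, var_den (clearVars scratchVars) _ (by decide)]
    exact countMasks_spec (h.base.den (by decide))

/-! ### The running time of the search -/

/-- The stored value is at most `K` in absolute value, and the output cells are project codes
between `0` and `m` or are `0`. Their lengths are thus bounded by those of variables `7` and `2`,
however many rounds have passed. -/
theorem Best.bounded {M : G.Assignment} (h : Best G w s M) {B : ℕ} (hd : Data G w K s)
    (hK : 2 * ∑ a, ∑ p, |w a p| < K) (h7 : len (s.var 7) ≤ B) (h2 : len (s.var 2) ≤ B) :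
    len (s.var 10) ≤ B ∧ ∀ i, len (s.arr 1 i) ≤ B := by
  constructor
  · refine (len_mono ?_).trans h7
    rw [h.weight, hd.var_seven]
    have h1 := abs_le.1 (Market.abs_intWeight_le w M)
    omega
  · intro i
    refine (len_mono ?_).trans h2
    rw [hd.var_two]
    by_cases hi : 0 ≤ i ∧ i < (G.n : ℤ)
    · have h1 := h.stores ⟨i.toNat, by omega⟩
      simp only [Int.toNat_of_nonneg hi.1] at h1
      have h2 := code_bounds (M ⟨i.toNat, by omega⟩)
      omega
    · rw [h.zero i hi]; simp

/-- `run_den` for the whole loop would let words grow with the exponential number of rounds. Between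
rounds, however, the scratch memory is `0`, the mask is at most variable `8`, the best matching and
its value are bounded by `Best.bounded`, and everything else is unchanged. -/
theorem search_bounded (h : Ready G w K s) (hK : 2 * ∑ a, ∑ p, |w a p| < K) {M : G.Assignment}
    (hM : Best G w s M) {B : ℕ} (hB : s.BoundedBy B) {k : ℕ} (hk : k ≤ (s.var 8).toNat) :
    (loopState body.den 9 s k).BoundedBy B := by
  obtain ⟨hF, hR, M', hM', -⟩ := search_inv h hK hM k hk
  have hB1 := hM'.bounded hR.data hK (B := B) (by rw [hF.var 7 (by decide)]; exact hB.var 7)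
    (by rw [hF.var 2 (by decide)]; exact hB.var 2)
  refine ⟨fun y => ?_, fun A i => ?_⟩
  · by_cases hy : y ∈ search.vars
    · have : y = 9 ∨ y = 10 ∨ y ∈ scratchVars := by
        have h1 : search.vars.all (fun y => y = 9 ∨ y = 10 ∨ y ∈ scratchVars) = true := by decide
        simpa using List.all_eq_true.1 h1 y hy
      rcases this with rfl | rfl | hy
      · rw [var_loopState]
        refine (len_mono ?_).trans (hB.var 8)
        omega
      · exact hB1.1
      · rw [hR.var y hy]; exact hB.one_le
    · rw [hF.var y hy]; exact hB.var y
  · by_cases hA : A ∈ search.arrs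
    · have : A = 1 ∨ A ∈ scratchArrs := by
        have h1 : search.arrs.all (fun A => A = 1 ∨ A ∈ scratchArrs) = true := by decide
        simpa using List.all_eq_true.1 h1 A hA
      rcases this with rfl | hA
      · exact hB1.2 i
      · rw [hR.arr A hA]; exact hB.one_le
    · rw [hF.arr A hA]; exact hB.arr A i

/-- Each round starts with words of length at most `B`, so `run_den` and `steps_le` give the same
polynomial bound for every round. The exponential factor is merely the number of rounds. -/
theorem run_search (h : Ready G w K s) (hK : 2 * ∑ a, ∑ p, |w a p| < K) {M : G.Assignment}
    (hM : Best G w s M) (hq : s.var 8 = (2 ^ G.mQuota : ℕ)) {B C : ℕ} (hB : s.BoundedBy B)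
    (hC : ∀ i, len (s.arr 0 i) ≤ C) {R σ : ℕ} (hR : space G.n G.m ≤ R)
    (hσ : body.stepsPoly.eval R = σ) :
    ∃ t ≤ 2 ^ G.mQuota * (80 * B + body.coef * (B + body.growth * C * σ) * σ),
      Run search.compile s t (search.den s) := by
  have hq' : (s.var 8).toNat = 2 ^ G.mQuota := by rw [hq, Int.toNat_natCast]
  obtain ⟨t, ht, hrun⟩ := run_loop (c := body) (x := 9) (b := 8) (s := s) (B := B)
    (T := fun _ => body.coef * (B + body.growth * C * σ) * σ) (by decide) (by decide) (by decide)
    (fun k hk => search_bounded h hK hM hB hk) (fun k hk => by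
      obtain ⟨hF, hR', -⟩ := search_inv h hK hM k hk.le
      have hb := search_bounded h hK hM hB hk.le
      have hst : body.steps (loopState body.den 9 s k) ≤ σ :=
        (steps_le body (by decide) fun b hb =>
          (hR'.data.base.var_le b hb).trans (by exact_mod_cast hR)).trans_eq hσ
      obtain ⟨t, ht, hrun⟩ := (run_den body (by decide) hb
        (fun i => by rw [hF.arr 0 (by decide)]; exact hC i)).2 (B + body.growth * C * σ)
        (by gcongr)
      exact ⟨t, ht.trans (by gcongr), hrun⟩)
  refine ⟨t, ht.trans ?_, hrun⟩
  rw [hq', Finset.sum_const, Finset.card_range, smul_eq_mul]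
  -- The overhead of the loop outside its rounds is absorbed by turning `40 * B` per round into `80
  -- * B`.
  have : 1 ≤ 2 ^ G.mQuota := Nat.one_le_two_pow
  nlinarith

end Prog

end RAM

/-! ### The assembled solver and its running time -/

namespace RAM

namespace Prog

open HouseAllocation

variable {G : Market} {w : Fin G.n → Fin G.m → ℤ}

/-- The preparation of the search for an optimal matching. -/
def front (pre : Prog) : Prog := setup ;; pre ;; prepare

/-- The computation of an optimal matching, where `pre` computes the edges and the weights, and
`post` the output. -/
def solver (pre post : Prog) : Prog := front pre ;; search ;; post

/-- The program `pre` computes only edges, weights and auxiliary variables. -/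
def admissible (pre : Prog) : Bool :=
  pre.lin && pre.static && pre.arrs.all (fun A => A == 2 || A == 3) && !pre.vars.contains 10

/-- A bound for the sizes that control the loops. -/
noncomputable def spacePoly : Polynomial ℕ := .X ^ 2 + 4 * .X + 1

theorem space_le {n m S : ℕ} (h : (n + 1) * (m + 1) ≤ S) : space n m ≤ spacePoly.eval S := by
  have h1 : n ≤ S := by nlinarith
  have h2 : (m + 1) * n ≤ S := by nlinarith
  have h3 : m ≤ S := by nlinarith
  have h4 : m * n ≤ S := by nlinarith
  have h5 := Nat.mul_le_mul h1 h2
  simp only [space, spacePoly, Polynomial.eval_add, Polynomial.eval_pow, Polynomial.eval_X,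
    Polynomial.eval_mul, Polynomial.eval_ofNat, Polynomial.eval_one]
  nlinarith

theorem len_natCast_le (k : ℕ) : len (k : ℤ) ≤ k + 1 := by
  rw [len_le_iff, Int.natAbs_natCast]
  exact Nat.lt_two_pow_self

theorem init_bounded {input : List ℤ} {S : ℕ} (hlen : input.length ≤ S)
    (hin : ∀ z ∈ input, len z ≤ S + 1) : (init input).BoundedBy (S + 1) := by
  constructor
  · intro x
    simp only [init]
    split_ifs
    · exact (len_natCast_le _).trans (by omega)
    · exact Nat.le_add_left 1 S
  · intro A i
    simp only [init]
    split_ifs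
    · rw [List.getD_eq_getElem?_getD]
      rcases hz : input[i.toNat]? with _ | z
      · exact Nat.le_add_left 1 S
      · exact hin z (List.mem_of_getElem? hz)
    · exact Nat.le_add_left 1 S

theorem isMatching_none (G : Market) : G.IsMatching fun _ => none :=
  ⟨fun a p h => by simp at h, fun p => .inl (by simp [Market.load])⟩

/-- What precedes and follows the search makes polynomially many steps, so `run_den` applies to it
as a whole; the search itself is covered by `run_search`. The polynomial depends only on the
programs `pre` and `post`. -/
theorem solver_spec {pre post : Prog} (hpre : pre.admissible = true) (hpost : post.lin = true)
    (hpost' : post.static = true) :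
    ∃ P : Polynomial ℕ, ∀ (G : Market) (w : Fin G.n → Fin G.m → ℤ) (input : List ℤ) (S : ℕ),
      (G.n + 1) * (G.m + 1) ≤ S → input.length ≤ 3 * S → (∀ z ∈ input, len z ≤ 3 * S + 1) →
      Base G (setup.den (init input)) →
      Data G w ((pre.den (setup.den (init input))).var 7) (pre.den (setup.den (init input))) →
      ∃ M s, Best G w s M ∧ (∀ M₁, G.IsMatching M₁ → G.intWeight w M₁ ≤ G.intWeight w M) ∧
        Base G s ∧ s.var 12 = (pre.den (setup.den (init input))).var 12 ∧
        ∃ t ≤ 2 ^ G.mQuota * P.eval S, Run (solver pre post).compile (init input) t (post.den s) := by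
  simp only [admissible, Bool.and_eq_true, Bool.not_eq_true', List.contains_eq_mem,
    decide_eq_false_iff_not, List.all_eq_true, Bool.or_eq_true, beq_iff_eq] at hpre
  obtain ⟨⟨⟨hlin, hstat⟩, harr⟩, h10⟩ := hpre
  set B₀ : Polynomial ℕ := 3 * .X + 1 with hB₀
  -- The `6` counts the assignments of `setup`. They are treated separately, because `setup` writes
  -- the very variables that static programs must leave alone.
  set σ₁ : Polynomial ℕ := 6 + (seq pre prepare).stepsPoly.comp spacePoly with hσ₁
  set B₁ : Polynomial ℕ := B₀ + .C (front pre).growth * B₀ * σ₁ with hB₁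
  set σ₂ : Polynomial ℕ := body.stepsPoly.comp spacePoly with hσ₂
  set σ₃ : Polynomial ℕ := post.stepsPoly.comp spacePoly with hσ₃
  refine ⟨.C (front pre).coef * B₁ * σ₁ +
    (80 * B₁ + .C body.coef * (B₁ + .C body.growth * B₀ * σ₂) * σ₂) +
    .C post.coef * (B₁ + .C post.growth * B₀ * σ₃) * σ₃,
    fun G w input S hS hlen hin hbase hdata => ?_⟩
  set s₀ := init input with hs₀
  set s₁ := setup.den s₀ with hs₁
  set s₂ := pre.den s₁ with hs₂
  set s₃ := prepare.den s₂ with hs₃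
  have hfront : (front pre).den s₀ = s₃ := rfl
  have hsp := space_le hS
  have hbd₀ : s₀.BoundedBy (B₀.eval S) := by
    simpa [hB₀] using init_bounded hlen hin
  have hG : ∀ i, len (s₀.arr 0 i) ≤ B₀.eval S := fun i => hbd₀.arr 0 i
  have hlin₁ : (front pre).lin = true := by
    simp only [front, lin, hlin, Bool.true_and, Bool.and_eq_true]
    decide
  have hst₁ : (front pre).steps s₀ ≤ σ₁.eval S := by
    have h1 : (seq pre prepare).steps s₁ ≤ (seq pre prepare).stepsPoly.eval (spacePoly.eval S) :=
      steps_le _ (by simp only [static, hstat, Bool.true_and]; decide)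
        fun b hb => (hbase.var_le b hb).trans (by exact_mod_cast hsp)
    have h2 : (front pre).steps s₀ = 6 + (seq pre prepare).steps s₁ := rfl
    rw [h2, hσ₁, Polynomial.eval_add, Polynomial.eval_comp, Polynomial.eval_ofNat]
    omega
  obtain ⟨hbd₃, hrun₁⟩ := run_den (front pre) hlin₁ hbd₀ hG
  have hB₁' : B₀.eval S + (front pre).growth * B₀.eval S * (front pre).steps s₀ ≤ B₁.eval S := by
    simp only [hB₁, Polynomial.eval_add, Polynomial.eval_mul, Polynomial.eval_C]
    gcongr
  replace hbd₃ := hbd₃.mono hB₁'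
  rw [hfront] at hbd₃
  obtain ⟨t₁, ht₁, hrun₁⟩ := hrun₁ _ hB₁'
  rw [hfront] at hrun₁
  have hs₂a : ∀ A, 1 ≤ A → A ≠ 2 → A ≠ 3 → s₂.arr A = 0 := by
    intro A h1 h2 h3
    rw [hs₂, arr_den _ _ fun hA => by rcases harr A hA with h | h <;> omega]
    ext i
    have : s₁.arr = s₀.arr := rfl
    rw [this, hs₀, init]
    simp only [Pi.zero_apply]
    rw [if_neg (by omega)]
  obtain ⟨hR, h8⟩ := prepare_spec hdata fun A hA => by
    have : 1 ≤ A ∧ A ≠ 2 ∧ A ≠ 3 := by revert A; decide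
    exact hs₂a A this.1 this.2.1 this.2.2
  -- The search starts from the empty matching of weight `0`: array `1` is untouched, and `pre` does
  -- not assign variable `10`.
  have hM₀ : Best G w s₃ fun _ => none := by
    have e1 : s₃.arr 1 = 0 := by
      rw [hs₃, arr_den _ _ (by decide), hs₂a 1 le_rfl (by decide) (by decide)]
    refine ⟨isMatching_none G, fun a => by rw [e1]; rfl, fun i _ => by rw [e1]; rfl, ?_⟩
    rw [hs₃, var_den _ _ (by decide), hs₂, var_den _ _ h10]
    simp [hs₁, setup, den, hs₀, init, Market.intWeight]
  have hK : 2 * ∑ a, ∑ p, |w a p| < 1 + 2 * ∑ a, ∑ p, |w a p| := by omega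
  obtain ⟨M, hM, hopt⟩ := search_spec hR hK hM₀ h8
  have hG₃ : ∀ i, len (s₃.arr 0 i) ≤ B₀.eval S := fun i => by
    rw [← hfront, arr_zero_den _ hlin₁]; exact hG i
  obtain ⟨t₂, ht₂, hrun₂⟩ := run_search hR hK hM₀ h8 hbd₃ hG₃ hsp rfl
  set s₄ := search.den s₃ with hs₄
  have hbase₄ : Base G s₄ := hR.data.base.den (by decide)
  have hbd₄ : s₄.BoundedBy (B₁.eval S) := search_bounded hR hK hM₀ hbd₃ le_rfl
  have hG₄ : ∀ i, len (s₄.arr 0 i) ≤ B₀.eval S := fun i => by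
    rw [hs₄, arr_den _ _ (by decide)]; exact hG₃ i
  have hst₃ : post.steps s₄ ≤ σ₃.eval S := by
    rw [hσ₃, Polynomial.eval_comp]
    exact steps_le post hpost' fun b hb => (hbase₄.var_le b hb).trans (by exact_mod_cast hsp)
  obtain ⟨t₃, ht₃, hrun₃⟩ := (run_den post hpost hbd₄ hG₄).2
    (B₁.eval S + post.growth * B₀.eval S * σ₃.eval S) (by gcongr)
  refine ⟨M, s₄, hM, hopt, hbase₄, ?_, _, ?_, Run.seq hrun₁ (Run.seq hrun₂ hrun₃)⟩
  · rw [hs₄, var_den _ _ (by decide), hs₃, var_den _ _ (by decide)]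
  · have h2 : 1 ≤ 2 ^ G.mQuota := Nat.one_le_two_pow
    simp only [Polynomial.eval_add, Polynomial.eval_mul, Polynomial.eval_C, Polynomial.eval_ofNat]
    rw [hσ₂, Polynomial.eval_comp, mul_add, mul_add, add_assoc]
    refine Nat.add_le_add ?_ (Nat.add_le_add ht₂ ?_)
    · refine (ht₁.trans (Nat.mul_le_mul_left _ hst₁)).trans ?_
      exact Nat.le_mul_of_pos_left _ h2
    · refine (ht₃.trans (Nat.mul_le_mul_left _ hst₃)).trans ?_
      exact Nat.le_mul_of_pos_left _ h2

end Prog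

end RAM

/-! ### The presentation of instances -/

namespace HouseAllocation.Market

theorem getD_rowMajor {n m : ℕ} (f : Fin n → Fin m → ℤ) (a : Fin n) (p : Fin m) :
    (rowMajor f).getD (a * m + p) 0 = f a p := by
  have hlt : (a : ℕ) * m + p < n * m := by
    have := a.2
    have := p.2
    nlinarith
  have hm : 0 < m := by have := p.2; omega
  rw [rowMajor, List.getD_eq_getElem _ _ (by simpa using hlt), List.getElem_ofFn]
  congr 1 <;> ext
  · simp [Fin.divNat, add_comm _ (p : ℕ), Nat.add_mul_div_right _ _ hm, Nat.div_eq_of_lt p.2]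
  · simp [Fin.modNat, add_comm _ (p : ℕ), Nat.mod_eq_of_lt p.2]

theorem length_rowMajor {n m : ℕ} (f : Fin n → Fin m → ℤ) : (rowMajor f).length = n * m := by
  simp [rowMajor]

theorem forall_mem_rowMajor {n m : ℕ} {f : Fin n → Fin m → ℤ} {P : ℤ → Prop}
    (h : ∀ a p, P (f a p)) : ∀ z ∈ rowMajor f, P z := by
  intro z hz
  obtain ⟨k, rfl⟩ := List.mem_ofFn.1 hz
  exact h _ _

variable (G : Market)

theorem length_encodeQuotas : G.encodeQuotas.length = 2 + 2 * G.m := by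
  simp only [encodeQuotas, List.length_append, List.length_ofFn, List.length_cons, List.length_nil]
  omega

theorem le_size : (G.n + 1) * (G.m + 1) ≤ G.size := Nat.le_add_right _ _

theorem len_quota_le (p : Fin G.m) :
    RAM.len (G.lower p) ≤ G.size + 1 ∧ RAM.len (G.upper p) ≤ G.size + 1 := by
  have h1 := Finset.single_le_sum (f := fun p => (G.lower p).size + (G.upper p).size)
    (fun _ _ => Nat.zero_le _) (Finset.mem_univ p)
  simp only [RAM.len, Int.natAbs_natCast, size]
  omega

theorem len_le_size {k : ℤ} (h0 : 0 ≤ k) (h : k ≤ G.n ∨ k ≤ G.m) : RAM.len k ≤ G.size + 1 := by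
  have h1 := G.le_size
  have h2 : k.natAbs ≤ G.size := by
    have h3 : G.n ≤ (G.n + 1) * (G.m + 1) := by nlinarith
    have h4 : G.m ≤ (G.n + 1) * (G.m + 1) := by nlinarith
    rcases h with h | h <;> omega
  have h5 := RAM.Prog.len_natCast_le k.natAbs
  rw [Int.natAbs_of_nonneg h0] at h5
  omega

theorem len_encodeQuotas_le : ∀ z ∈ G.encodeQuotas, RAM.len z ≤ G.size + 1 := by
  intro z hz
  simp only [encodeQuotas, List.mem_append, List.mem_cons, List.not_mem_nil, or_false,
    List.mem_ofFn] at hz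
  rcases hz with ((rfl | rfl) | ⟨p, rfl⟩) | ⟨p, rfl⟩
  · exact G.len_le_size (by omega) (.inl le_rfl)
  · exact G.len_le_size (by omega) (.inr le_rfl)
  · exact (G.len_quota_le p).1
  · exact (G.len_quota_le p).2

end HouseAllocation.Market

namespace RAM

theorem arr_init (l : List ℤ) (k : ℕ) : (init l).arr 0 k = l.getD k 0 := by
  simp [init]

namespace Prog

open HouseAllocation

variable {G : Market}

/-- The memory after the computation of the sizes. -/
def start (input : List ℤ) : State := setup.den (init input)

theorem base_start (G : Market) (l : List ℤ) : Base G (start (G.encodeQuotas ++ l)) := by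
  have h1 : ∀ p : Fin G.m, 2 + (p : ℕ) < G.encodeQuotas.length := fun p => by
    rw [G.length_encodeQuotas]; omega
  have h2 : ∀ p : Fin G.m, 2 + G.m + (p : ℕ) < G.encodeQuotas.length := fun p => by
    rw [G.length_encodeQuotas]; omega
  refine setup_spec ?_ ?_ (fun p => ?_) (fun p => ?_)
  · exact (arr_init _ 0).trans (by simp [Market.encodeQuotas])
  · exact (arr_init _ 1).trans (by simp [Market.encodeQuotas])
  · refine (by push_cast; rfl : _ = _).trans ((arr_init _ (2 + p)).trans ?_)
    rw [List.getD_append _ _ _ _ (h1 p), Market.encodeQuotas,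
      List.getD_append _ _ _ _ (by simp; omega), List.getD_append_right _ _ _ _ (by simp)]
    simp
  · refine (by push_cast; rfl : _ = _).trans ((arr_init _ (2 + G.m + p)).trans ?_)
    rw [List.getD_append _ _ _ _ (h2 p), Market.encodeQuotas,
      List.getD_append_right _ _ _ _ (by simp; omega)]
    simp [add_comm 2 G.m]

/-- The cells behind the quotas. -/
theorem arr_start (G : Market) (l : List ℤ) (k : ℕ) :
    (start (G.encodeQuotas ++ l)).arr 0 (2 * G.m + 2 + k) = l.getD k 0 := by
  have h := arr_init (G.encodeQuotas ++ l) (2 + 2 * G.m + k)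
  rw [List.getD_append_right _ _ _ _ (by rw [G.length_encodeQuotas]; omega),
    G.length_encodeQuotas, Nat.add_sub_cancel_left] at h
  rw [← h, add_comm (2 : ℕ)]
  push_cast
  rfl

theorem exists_cell {n m k : ℕ} (hk : k < m * n) :
    ∃ (a : Fin n) (p : Fin m), k = a * m + p := by
  have hm : 0 < m := Nat.pos_of_ne_zero (by rintro rfl; simp at hk)
  exact ⟨⟨k / m, Nat.div_lt_of_lt_mul hk⟩, ⟨k % m, Nat.mod_lt _ hm⟩, (Nat.div_add_mod' k m).symm⟩

theorem cell_lt {n m : ℕ} (a : Fin n) (p : Fin m) : (a : ℕ) * m + p < m * n := by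
  have := a.2
  have := p.2
  nlinarith

/-! ### Weighted markets -/

/-- The address of the cell number `21` of the first matrix of the input. -/
def address : Expr := .add (.add (.add (.var 2) (.var 2)) (.const 2)) (.var 21)

/-- The computation of a common denominator, of the edges, and of integer weights. -/
def scaleWeights : Prog :=
  .assign 11 (.const 1) ;;
  .loop 21 6 (.ite (.eq (.get 0 address) (.const 0)) .skip
    (.assign 11 (.mul (.var 11) (.get 0 (.add address (.add (.var 6) (.var 6))))))) ;;
  .loop 21 6 (.store 2 (.var 21) (.get 0 address) ;;
    .store 3 (.var 21) (.mul (.div (.var 11) (.get 0 (.add address (.add (.var 6) (.var 6)))))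
      (.get 0 (.add address (.var 6)))))

/-- The scaled weights. -/
def scaled (I : WeightedMarket) (D : ℤ) (a : Fin I.n) (p : Fin I.m) : ℤ :=
  if I.adj a p = true then D / (I.w a p).den * (I.w a p).num else 0

/-- `D` is the product of the denominators of all edges. Non-edges contribute the factor `1`, as
their encoded denominator is `0`. Each factor is an input cell, so the product is admitted by `lin`.
-/
theorem scaleWeights_spec (I : WeightedMarket) :
    ∃ D : ℤ, 0 < D ∧ (∀ a p, I.adj a p = true → ((I.w a p).den : ℤ) ∣ D) ∧
      Data I.toMarket (scaled I D) ((scaleWeights.den (start I.encode)).var 7)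
        (scaleWeights.den (start I.encode)) := by
  set G := I.toMarket with hG
  set f₀ : Fin I.n → Fin I.m → ℤ := fun a p => if I.adj a p then 1 else 0 with hf₀
  set f₁ : Fin I.n → Fin I.m → ℤ := fun a p => if I.adj a p then (I.w a p).num else 0 with hf₁
  set f₂ : Fin I.n → Fin I.m → ℤ :=
    fun a p => if I.adj a p then ((I.w a p).den : ℤ) else 0 with hf₂
  have henc : I.encode = G.encodeQuotas ++
      (Market.rowMajor f₀ ++ (Market.rowMajor f₁ ++ Market.rowMajor f₂)) := by
    simp only [WeightedMarket.encode, List.append_assoc]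
    rfl
  set s := start I.encode with hs
  have hb : Base G s := by rw [hs, henc]; exact base_start _ _
  have hlt : ∀ (a : Fin I.n) (p : Fin I.m), (a : ℕ) * I.m + p < I.n * I.m := fun a p => by
    rw [mul_comm I.n]; exact cell_lt a p
  have h0 : ∀ (a : Fin I.n) (p : Fin I.m),
      s.arr 0 (2 * I.m + 2 + (a * I.m + p : ℕ)) = f₀ a p := fun a p => by
    rw [hs, henc, arr_start, List.getD_append _ _ _ _ (by
      rw [Market.length_rowMajor]; exact hlt a p), Market.getD_rowMajor]
  have h1 : ∀ (a : Fin I.n) (p : Fin I.m),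
      s.arr 0 (2 * I.m + 2 + (I.n * I.m + (a * I.m + p) : ℕ)) = f₁ a p := fun a p => by
    rw [hs, henc, arr_start, List.getD_append_right _ _ _ _ (by
      rw [Market.length_rowMajor]; omega), Market.length_rowMajor, Nat.add_sub_cancel_left,
      List.getD_append _ _ _ _ (by rw [Market.length_rowMajor]; exact hlt a p),
      Market.getD_rowMajor]
  have h2 : ∀ (a : Fin I.n) (p : Fin I.m),
      s.arr 0 (2 * I.m + 2 + (I.n * I.m + (I.n * I.m + (a * I.m + p)) : ℕ)) = f₂ a p :=
    fun a p => by
    rw [hs, henc, arr_start, List.getD_append_right _ _ _ _ (by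
      rw [Market.length_rowMajor]; omega), Market.length_rowMajor, Nat.add_sub_cancel_left,
      List.getD_append_right _ _ _ _ (by rw [Market.length_rowMajor]; omega),
      Market.length_rowMajor, Nat.add_sub_cancel_left, Market.getD_rowMajor]
  clear_value s
  have hm2 : G.m = I.m := rfl
  have hn2 : G.n = I.n := rfl
  have e0 : ∀ k : ℕ, (G.m + G.m + 2 + k : ℤ) = 2 * I.m + 2 + k := fun k => by rw [hm2]; ring
  have e1 : ∀ k : ℕ, (G.m + G.m + 2 + k + (G.m * G.n : ℕ) : ℤ) =
      2 * I.m + 2 + (I.n * I.m + k : ℕ) := fun k => by rw [hm2, hn2]; push_cast; ring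
  have e2 : ∀ k : ℕ, (G.m + G.m + 2 + k + ((G.m * G.n : ℕ) + (G.m * G.n : ℕ)) : ℤ) =
      2 * I.m + 2 + (I.n * I.m + (I.n * I.m + k) : ℕ) := fun k => by
    rw [hm2, hn2]; push_cast; ring
  set s₁ := (assign 11 (.const 1)).den s with hs₁
  have hb₁ : Base G s₁ := hb.den (by decide)
  set c₂ : Prog := .loop 21 6 (.ite (.eq (.get 0 address) (.const 0)) .skip
    (.assign 11 (.mul (.var 11) (.get 0 (.add address (.add (.var 6) (.var 6))))))) with hc₂
  set s₂ := c₂.den s₁ with hs₂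
  have hb₂ : Base G s₂ := hb₁.den (by decide)
  set d : ℕ → ℤ := fun k => if s.arr 0 (2 * I.m + 2 + k) = 0 then 1 else
    s.arr 0 (2 * I.m + 2 + (I.n * I.m + (I.n * I.m + k) : ℕ)) with hd
  have hD : s₂.var 11 = ∏ k ∈ Finset.range (I.m * I.n), d k := by
    have key := loop_induction (s := s₁) (x := 21) (b := 6)
      (c := .ite (.eq (.get 0 address) (.const 0)) .skip
        (.assign 11 (.mul (.var 11) (.get 0 (.add address (.add (.var 6) (.var 6)))))))
      (fun k s' => s'.var 11 = ∏ k ∈ Finset.range k, d k) (by simp [hs₁, den]) ?_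
    · rwa [hb₁.var_six, Int.toNat_natCast] at key
    · intro k s' hk hx hF ih
      have hb' := hb₁.of_frame hF (by decide)
      have ea : s'.arr 0 = s.arr 0 := hF.arr 0 (by decide)
      rw [Finset.prod_range_succ, ← ih]
      simp only [den, Expr.holds_eq, Expr.eval, address, hx, hb'.var_two, hb'.var_six, ea, e2, hd]
      simp only [e0]
      split_ifs with h <;> simp
  have hdcell : ∀ (a : Fin I.n) (p : Fin I.m), d (a * I.m + p) =
      if I.adj a p = true then ((I.w a p).den : ℤ) else 1 := fun a p => by
    simp only [hd]
    rw [h0, h2]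
    by_cases h : I.adj a p = true <;> simp [hf₀, hf₂, h]
  have ea₂ : s₂.arr 0 = s.arr 0 := (frame_den c₂ s₁).arr 0 (by decide)
  have hsp := le_space G.n G.m
  refine ⟨s₂.var 11, ?_, fun a p h => ?_, ?_⟩
  · rw [hD]
    refine Finset.prod_pos fun k hk => ?_
    obtain ⟨a, p, rfl⟩ := exists_cell (Finset.mem_range.1 hk)
    rw [hdcell]
    split_ifs
    · exact_mod_cast (I.w a p).den_pos
    · exact one_pos
  · rw [hD]
    have := Finset.dvd_prod_of_mem d (Finset.mem_range.2 (cell_lt a p))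
    rwa [hdcell, if_pos h] at this
  · have hbody : ∀ (k : ℕ) (s' : State), (k : ℤ) < s₂.var 6 → s'.var 21 = k → Base G s' →
        (k : ℤ) < s'.var 5 := fun k s' hk _ hb' => by
      rw [hb₂.var_six] at hk
      rw [hb'.var_five]
      omega
    have hcell : ∀ (a : Fin I.n) (p : Fin I.m),
        (0 : ℤ) ≤ (a : ℕ) * (I.m : ℕ) + (p : ℕ) ∧
          ((a : ℕ) * (I.m : ℕ) + (p : ℕ) : ℤ) < s₂.var 6 := fun a p => by
      refine ⟨by positivity, ?_⟩
      rw [hb₂.var_six]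
      exact_mod_cast cell_lt a p
    refine Base.data (hb.den (by decide)) (fun a p => ?_) fun a p => ?_
    · change (Prog.den (.loop 21 6 _) s₂).arr 2 _ = _
      rw [arr_loop fun i => s.arr 0 (2 * I.m + 2 + i)]
      · rw [if_pos (hcell a p)]
        have := h0 a p
        push_cast at this
        exact this
      · intro k s' hk hx hF _
        have hb' := hb₂.of_frame hF (by decide)
        have ea : s'.arr 0 = s.arr 0 := (hF.arr 0 (by decide)).trans ea₂
        have h5 := hbody k s' hk hx hb'
        simp [den, address, hx, h5, hb'.var_two, ea, e0]
    · change (Prog.den (.loop 21 6 _) s₂).arr 3 _ = _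
      -- For a non-edge the formula divides by `0` and multiplies by the encoded numerator `0`,
      -- which gives the required weight `0`.
      rw [arr_loop fun i =>
        s₂.var 11 / s.arr 0 (2 * I.m + 2 + (I.n * I.m + (I.n * I.m + i))) *
          s.arr 0 (2 * I.m + 2 + (I.n * I.m + i))]
      · rw [if_pos (hcell a p)]
        have h1' := h1 a p
        have h2' := h2 a p
        push_cast at h1' h2'
        refine (congrArg₂ (fun x y => s₂.var 11 / x * y) h2' h1').trans ?_
        simp only [scaled, hf₁, hf₂]
        split_ifs <;> simp
      · intro k s' hk hx hF _
        have hb' := hb₂.of_frame hF (by decide)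
        have ea : s'.arr 0 = s.arr 0 := (hF.arr 0 (by decide)).trans ea₂
        have h5 := hbody k s' hk hx hb'
        have h11 : s'.var 11 = s₂.var 11 := hF.var 11 (by decide)
        have e1' := e1 k
        have e2' := e2 k
        push_cast at e1' e2'
        simp [den, address, hx, h5, hb'.var_two, hb'.var_six, ea, h11, e1', e2']

/-- On an edge the division by the denominator is exact, and a matching uses only edges. Scaling by
a positive `D` then preserves the order of the weights. -/
theorem intWeight_scaled (I : WeightedMarket) {D : ℤ}
    (hD : ∀ a p, I.adj a p = true → ((I.w a p).den : ℤ) ∣ D) {M : I.Assignment}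
    (hM : I.IsMatching M) : (I.toMarket.intWeight (scaled I D) M : ℚ) = D * I.weight M := by
  rw [Market.intWeight, WeightedMarket.weight, Finset.mul_sum, Int.cast_sum]
  refine Finset.sum_congr rfl fun a _ => ?_
  rcases h : M a with _ | p
  · simp
  · have hadj := hM.edge a p h
    obtain ⟨q, rfl⟩ := hD a p hadj
    have hden : ((I.w a p).den : ℤ) ≠ 0 := by exact_mod_cast (I.w a p).den_nz
    simp only [Option.elim_some, scaled, if_pos hadj, Int.mul_ediv_cancel_left _ hden]
    push_cast
    rw [← Rat.mul_den_eq_num]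
    ring

/-- The size counts the lengths of numerators and denominators of all edges, so it bounds each of
them; the three matrices and the quotas account for the factor `3` in the length of the input. -/
theorem encode_bounds (I : WeightedMarket) :
    (I.n + 1) * (I.m + 1) ≤ I.size ∧ I.encode.length ≤ 3 * I.size ∧
      ∀ z ∈ I.encode, len z ≤ 3 * I.size + 1 := by
  have h1 : I.toMarket.size ≤ I.size := Nat.le_add_right _ _
  have h2 := I.toMarket.le_size
  refine ⟨h2.trans h1, ?_, ?_⟩
  · simp only [WeightedMarket.encode, List.length_append, Market.length_rowMajor,
      Market.length_encodeQuotas]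
    nlinarith
  · have h01 : ∀ z : ℤ, (z = 0 ∨ z = 1) → len z ≤ 3 * I.size + 1 := by
      rintro z (rfl | rfl)
      · exact (by decide : len 0 ≤ 1).trans (by omega)
      · exact (by decide : len 1 ≤ 2).trans (by nlinarith)
    have hw : ∀ a p, I.adj a p = true →
        (I.w a p).num.natAbs.size + (I.w a p).den.size ≤ I.size := fun a p h => by
      set F : Fin I.n → Fin I.m → ℕ := fun a p =>
        if I.adj a p then (I.w a p).num.natAbs.size + (I.w a p).den.size else 0 with hF
      have e1 : F a p ≤ ∑ p, F a p :=
        Finset.single_le_sum (fun _ _ => Nat.zero_le _) (Finset.mem_univ p)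
      have e2 : ∑ p, F a p ≤ ∑ a, ∑ p, F a p :=
        Finset.single_le_sum (f := fun a => ∑ p, F a p) (fun _ _ => Nat.zero_le _)
          (Finset.mem_univ a)
      have e3 : ∑ a, ∑ p, F a p ≤ I.size := Nat.le_add_left _ _
      have e4 : F a p = (I.w a p).num.natAbs.size + (I.w a p).den.size := by simp [hF, h]
      omega
    intro z hz
    simp only [WeightedMarket.encode, List.mem_append] at hz
    rcases hz with ((hz | hz) | hz) | hz
    · exact (I.toMarket.len_encodeQuotas_le z hz).trans (by omega)
    · revert z
      refine Market.forall_mem_rowMajor fun a p => h01 _ ?_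
      split_ifs <;> simp
    · revert z
      refine Market.forall_mem_rowMajor fun a p => ?_
      split_ifs with h
      · have := hw a p h
        simp only [len]; omega
      · exact h01 _ (.inl rfl)
    · revert z
      refine Market.forall_mem_rowMajor fun a p => ?_
      split_ifs with h
      · have := hw a p h
        simp only [len, Int.natAbs_natCast]; omega
      · exact h01 _ (.inl rfl)

theorem exists_maxWeight_algorithm :
    ∃ (c : Cmd) (P : Polynomial ℕ), ∀ I : WeightedMarket,
      ∃ M : I.Assignment, I.IsMaxWeight M ∧
        ComputesWithin c I.encode (I.encodeAssignment M) (2 ^ I.mQuota * P.eval I.size) := by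
  -- Array `1` already holds the assignment in its output format, so only its length `n` has to be
  -- put into variable `0`.
  obtain ⟨P, hP⟩ := solver_spec (pre := scaleWeights) (post := .assign 0 (.var 1)) (by decide)
    (by decide) (by decide)
  refine ⟨(solver scaleWeights (.assign 0 (.var 1))).compile, P, fun I => ?_⟩
  obtain ⟨h1, h2, h3⟩ := encode_bounds I
  obtain ⟨D, hD0, hD, hdata⟩ := scaleWeights_spec I
  have hbase : Base I.toMarket (setup.den (init I.encode)) := by
    rw [WeightedMarket.encode, List.append_assoc, List.append_assoc]
    exact base_start _ _
  obtain ⟨M, s, hM, hopt, hb, -, t, ht, hrun⟩ := hP I.toMarket _ I.encode I.size h1 h2 h3 hbase hdata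
  refine ⟨M, ⟨hM.isMatching, fun M' hM' => ?_⟩, t, _, hrun, ⟨?_, fun i => ?_⟩, ht⟩
  · have h4 : (I.toMarket.intWeight (scaled I D) M' : ℚ) ≤ I.toMarket.intWeight (scaled I D) M := by
      exact_mod_cast hopt M' hM'
    rw [intWeight_scaled I hD hM', intWeight_scaled I hD hM.isMatching] at h4
    exact le_of_mul_le_mul_left h4 (by exact_mod_cast hD0)
  · simp [den, hb.var_one, Market.encodeAssignment]
  · have hi : (i : ℕ) < I.n := by simpa [Market.encodeAssignment] using i.2
    refine (hM.stores ⟨i, hi⟩).trans ?_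
    rw [List.get_eq_getElem]
    simp [Market.encodeAssignment, code]

end Prog

end RAM

/-- Since the size is at least `1`, each monomial is at most its coefficient times the top power, so
`P.eval 1` and the degree serve as constants, with `f k = 2 ^ k`. The answer is described by two
implications so that programs can be verified without the classical case distinction in `FPT`. -/
theorem ParamProblem.fpt_of_algorithm {Q : ParamProblem}
    (h : ∃ (c : RAM.Cmd) (P : Polynomial ℕ), ∀ I : Q.Inst, 1 ≤ Q.size I ∧ ∀ b : ℤ,
      (Q.Yes I → b = 1) → (¬ Q.Yes I → b = 0) →
      RAM.ComputesWithin c (Q.encode I) [b] (2 ^ Q.param I * P.eval (Q.size I))) : Q.FPT := by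
  obtain ⟨c, P, h⟩ := h
  refine ⟨c, fun k => 2 ^ k, P.eval 1, P.natDegree, ?_, fun I => ?_⟩
  · exact ((Primrec₂.unpaired'.1 Nat.Primrec.pow).comp (Primrec.const 2) Primrec.id).to_comp
  · obtain ⟨h1, h2⟩ := h I
    obtain ⟨t, s, hrun, hout, ht⟩ := h2 _ (fun h => if_pos h) fun h => if_neg h
    refine ⟨t, s, hrun, hout, ht.trans ?_⟩
    have hP : P.eval (Q.size I) ≤ P.eval 1 * Q.size I ^ P.natDegree := by
      rw [Polynomial.eval_eq_sum_range, Polynomial.eval_eq_sum_range, Finset.sum_mul]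
      refine Finset.sum_le_sum fun i hi => ?_
      rw [one_pow, mul_one]
      exact Nat.mul_le_mul_left _ (Nat.pow_le_pow_right h1 (Finset.mem_range_succ_iff.1 hi))
    calc 2 ^ Q.param I * P.eval (Q.size I)
        ≤ 2 ^ Q.param I * (P.eval 1 * Q.size I ^ P.natDegree) := Nat.mul_le_mul_left _ hP
      _ = _ := by ring

/-! ### Preferences -/

namespace HouseAllocation

namespace PrefMarket

variable (I : PrefMarket)

theorem rank_pos_iff {a : Fin I.n} {p : Fin I.m} : 0 < I.rank a p ↔ I.adj a p = true := by
  rw [← I.mem_iff, rank]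
  split_ifs with h <;> simp [h]

theorem rank_le (a : Fin I.n) (p : Fin I.m) : I.rank a p ≤ I.m := by
  rw [rank]
  split_ifs with h
  · have h1 := List.idxOf_lt_length_iff.2 h
    have h2 := (I.nodup a).length_le_card
    rw [Fintype.card_fin] at h2
    omega
  · exact Nat.zero_le _

theorem prefers_some_iff {a : Fin I.n} {p q : Fin I.m} (hp : I.adj a p = true)
    (hq : I.adj a q = true) : I.Prefers a (some p) (some q) ↔ I.rank a p < I.rank a q := by
  rw [← I.mem_iff] at hp hq
  simp [Prefers, rank, hp, hq]

/-- The weight of an edge if the votes of the applicants who are worse off count `X` times. -/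
def voteWeight (M : I.Assignment) (X : ℤ) (a : Fin I.n) (p : Fin I.m) : ℤ :=
  if I.rank a p = 0 then 0 else (M a).elim 1 fun q =>
    if I.rank a p < I.rank a q then 1 + X else if I.rank a p = I.rank a q then X else 0

/-- The weight of `M` itself if the votes of the applicants who are worse off count `X` times. -/
def voteBound (M : I.Assignment) (X : ℤ) : ℤ := ∑ a, (M a).elim 0 fun _ => X

/-- An applicant matched by `M` starts from `X`: improving adds `1`, while a worse project or none
brings her down to `0`. An unmatched applicant starts from `0`, and every project is an improvement.
-/
theorem vote_eq {M M' : I.Assignment} (hM : I.IsMatching M) (hM' : I.IsMatching M') (X : ℤ)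
    (a : Fin I.n) :
    (M' a).elim 0 (I.voteWeight M X a) = ((M a).elim 0 fun _ => X) +
      (if I.Prefers a (M' a) (M a) then 1 else 0) -
      X * if I.Prefers a (M a) (M' a) then 1 else 0 := by
  rcases h : M a with _ | q <;> rcases h' : M' a with _ | p
  · simp [Prefers]
  · have hp := hM'.edge a p h'
    have h0 := I.rank_pos_iff.2 hp
    rw [← I.mem_iff] at hp
    simp [voteWeight, Prefers, h, h0.ne', hp]
  · have hq := hM.edge a q h
    rw [← I.mem_iff] at hq
    simp [Prefers, hq]
  · have hp := hM'.edge a p h'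
    have hq := hM.edge a q h
    have h0 := I.rank_pos_iff.2 hp
    simp only [Option.elim_some, voteWeight, h, h0.ne', if_false, I.prefers_some_iff hp hq,
      I.prefers_some_iff hq hp]
    rcases lt_trichotomy (I.rank a p) (I.rank a q) with h1 | h1 | h1
    · simp [h1, h1.not_gt, add_comm]
    · simp [h1]
    · simp [h1, h1.not_gt, h1.ne']

theorem intWeight_voteWeight {M M' : I.Assignment} (hM : I.IsMatching M) (hM' : I.IsMatching M')
    (X : ℤ) : I.toMarket.intWeight (I.voteWeight M X) M' = I.voteBound M X +
      (Finset.univ.filter fun a => I.Prefers a (M' a) (M a)).card -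
      X * (Finset.univ.filter fun a => I.Prefers a (M a) (M' a)).card := by
  rw [Market.intWeight, Finset.sum_congr rfl fun a _ => I.vote_eq hM hM' X a,
    Finset.sum_sub_distrib, Finset.sum_add_distrib, ← Finset.mul_sum, Finset.card_filter,
    Finset.card_filter, voteBound]
  push_cast
  rfl

/-- With `X = 1` the excess over `voteBound` is the number of votes for `M'` minus the number of
votes against it. -/
theorem morePopular_iff {M M' : I.Assignment} (hM : I.IsMatching M) (hM' : I.IsMatching M') :
    I.MorePopular M' M ↔
      I.voteBound M 1 < I.toMarket.intWeight (I.voteWeight M 1) M' := by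
  rw [I.intWeight_voteWeight hM hM', MorePopular]
  omega

/-- With `X = n + 1` a single applicant who is worse off outweighs all possible improvements, of
which there are at most `n`. The excess is positive only if nobody loses and somebody gains. -/
theorem dominates_iff {M M' : I.Assignment} (hM : I.IsMatching M) (hM' : I.IsMatching M') :
    I.Dominates M' M ↔
      I.voteBound M (I.n + 1) < I.toMarket.intWeight (I.voteWeight M (I.n + 1)) M' := by
  rw [I.intWeight_voteWeight hM hM', Dominates]
  have h1 : (∃ a, I.Prefers a (M' a) (M a)) ↔
      0 < (Finset.univ.filter fun a => I.Prefers a (M' a) (M a)).card := by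
    rw [Finset.card_pos]; simp [Finset.Nonempty]
  have h2 : (∃ a, I.Prefers a (M a) (M' a)) ↔
      0 < (Finset.univ.filter fun a => I.Prefers a (M a) (M' a)).card := by
    rw [Finset.card_pos]; simp [Finset.Nonempty]
  have h3 : (Finset.univ.filter fun a => I.Prefers a (M' a) (M a)).card ≤ I.n := by
    simpa using Finset.card_filter_le Finset.univ fun a => I.Prefers a (M' a) (M a)
  rw [h1, h2]
  generalize (Finset.univ.filter fun a => I.Prefers a (M' a) (M a)).card = x at *
  generalize (Finset.univ.filter fun a => I.Prefers a (M a) (M' a)).card = y at *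
  rcases Nat.eq_zero_or_pos y with rfl | hy
  · simp
  · constructor
    · omega
    · intro h
      nlinarith

/-- The weight `1` for all edges. -/
def unitWeight (a : Fin I.n) (p : Fin I.m) : ℤ := if I.rank a p = 0 then 0 else 1

theorem isPerfect_iff {M : I.Assignment} (hM : I.IsMatching M) :
    I.IsPerfect M ↔ (I.n : ℤ) - 1 < I.toMarket.intWeight I.unitWeight M := by
  have h : ∀ a, (M a).elim 0 (I.unitWeight a) = 1 - if M a = none then (1 : ℤ) else 0 := by
    intro a
    rcases h : M a with _ | p
    · simp
    · simp [unitWeight, (I.rank_pos_iff.2 (hM.edge a p h)).ne']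
  rw [Market.intWeight, Finset.sum_congr rfl fun a _ => h a, Finset.sum_sub_distrib]
  have h1 : ∑ a, (if M a = none then (1 : ℤ) else 0) =
      (Finset.univ.filter fun a => M a = none).card := by
    rw [Finset.card_filter]; push_cast; rfl
  have h2 : I.IsPerfect M ↔ (Finset.univ.filter fun a => M a = none).card = 0 := by
    rw [Finset.card_eq_zero, Finset.filter_eq_empty_iff]
    simp [Market.IsPerfect]
  rw [h1, h2]
  simp only [Finset.sum_const, Finset.card_univ, Fintype.card_fin, nsmul_eq_mul, mul_one]
  omega

/-- An applicant who loses her project would be worse off, which domination excludes. -/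
theorem IsPerfect.of_dominates {M M' : I.Assignment} (hM : I.IsMatching M) (h : I.IsPerfect M)
    (hd : I.Dominates M' M) : I.IsPerfect M' := by
  intro a ha
  refine hd.1 ⟨a, ?_⟩
  obtain ⟨p, hp⟩ := Option.ne_none_iff_exists'.1 (h a)
  rw [ha, hp]
  exact (I.mem_iff a p).2 (hM.edge a p hp)

/-- If all applicants can be matched, this is also possible with a Pareto optimal matching. -/
theorem exists_isParetoOptimal_isPerfect_iff :
    (∃ M : I.Assignment, I.IsParetoOptimal M ∧ I.IsPerfect M) ↔
      ∃ M : I.Assignment, I.IsMatching M ∧ I.IsPerfect M := by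
  refine ⟨fun ⟨M, h1, h2⟩ => ⟨M, h1.1, h2⟩, fun ⟨M₀, h1, h2⟩ => ?_⟩
  -- The sum of the ranks of the assigned projects. A dominating matching is again perfect and has a
  -- smaller sum, so a minimizer is Pareto optimal.
  set F : I.Assignment → ℕ := fun M => ∑ a, (M a).elim 0 (I.rank a) with hF
  obtain ⟨M, ⟨hM, hp⟩, hmin⟩ := WellFounded.has_min (measure F).wf
    {M : I.Assignment | I.IsMatching M ∧ I.IsPerfect M} ⟨M₀, h1, h2⟩
  refine ⟨M, ⟨hM, fun ⟨M', hM', hd⟩ => ?_⟩, hp⟩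
  have hp' := IsPerfect.of_dominates I hM hp hd
  refine hmin M' ⟨hM', hp'⟩ ?_
  have key : ∀ a, ∃ p q, M a = some p ∧ M' a = some q ∧ I.adj a p = true ∧ I.adj a q = true := by
    intro a
    obtain ⟨p, h⟩ := Option.ne_none_iff_exists'.1 (hp a)
    obtain ⟨q, h'⟩ := Option.ne_none_iff_exists'.1 (hp' a)
    exact ⟨p, q, h, h', hM.edge a p h, hM'.edge a q h'⟩
  obtain ⟨b, hb⟩ := hd.2
  change F M' < F M
  refine Finset.sum_lt_sum (fun a _ => ?_) ⟨b, Finset.mem_univ b, ?_⟩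
  · obtain ⟨p, q, h, h', e, e'⟩ := key a
    have : ¬ I.Prefers a (M a) (M' a) := fun h1 => hd.1 ⟨a, h1⟩
    rw [h, h', I.prefers_some_iff e e', not_lt] at this
    simpa [h, h'] using this
  · obtain ⟨p, q, h, h', e, e'⟩ := key b
    rw [h, h', I.prefers_some_iff e' e] at hb
    simpa [h, h'] using hb

theorem length_encode : I.encode.length = 2 + 2 * I.m + I.n * I.m := by
  simp [encode, Market.length_rowMajor, Market.length_encodeQuotas]

theorem len_encode_le : ∀ z ∈ I.encode, RAM.len z ≤ I.toMarket.size + 1 := by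
  intro z hz
  rcases List.mem_append.1 hz with hz | hz
  · exact I.toMarket.len_encodeQuotas_le z hz
  · refine Market.forall_mem_rowMajor (P := fun z => RAM.len z ≤ I.toMarket.size + 1)
      (fun a p => ?_) z hz
    exact I.toMarket.len_le_size (by omega) (.inr (by exact_mod_cast I.rank_le a p))

end PrefMarket

end HouseAllocation

/-! ### Decision by comparing the optimum with a threshold -/

namespace RAM

namespace Prog

open HouseAllocation

/-- The computation of a bit that tells whether the value of the optimal matching exceeds
variable `12`. -/
def answer : Prog :=
  .assign 0 (.const 1) ;;
  .ite (.lt (.var 12) (.var 10)) (.store 1 (.const 0) (.const 1)) (.store 1 (.const 0) (.const 0))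

/-- Whether some matching has a weight above a given bound can be decided. -/
theorem decides {pre : Prog} (hpre : pre.admissible = true) :
    ∃ P : Polynomial ℕ, ∀ (G : Market) (w : Fin G.n → Fin G.m → ℤ) (input : List ℤ) (S : ℕ),
      (G.n + 1) * (G.m + 1) ≤ S → input.length ≤ 3 * S → (∀ z ∈ input, len z ≤ 3 * S + 1) →
      Base G (start input) →
      Data G w ((pre.den (start input)).var 7) (pre.den (start input)) → ∀ b : ℤ,
      ((∃ M, G.IsMatching M ∧ (pre.den (start input)).var 12 < G.intWeight w M) → b = 1) →
      ((¬ ∃ M, G.IsMatching M ∧ (pre.den (start input)).var 12 < G.intWeight w M) → b = 0) →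
      ComputesWithin (solver pre answer).compile input [b] (2 ^ G.mQuota * P.eval S) := by
  obtain ⟨P, hP⟩ := solver_spec (post := answer) hpre (by decide) (by decide)
  refine ⟨P, fun G w input S h1 h2 h3 h4 h5 b hb1 hb0 => ?_⟩
  obtain ⟨M, s, hM, hopt, hb, h12, t, ht, hrun⟩ := hP G w input S h1 h2 h3 h4 h5
  refine ⟨t, _, hrun, ?_, ht⟩
  change s.var 12 = (pre.den (start input)).var 12 at h12
  have h0 : 0 < space G.n G.m := by have := le_space G.n G.m; omega
  -- `M` has maximum weight, so some matching exceeds the threshold exactly if `M` does.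
  have hiff : (∃ M, G.IsMatching M ∧ (pre.den (start input)).var 12 < G.intWeight w M) ↔
      s.var 12 < s.var 10 := by
    rw [hM.weight, h12]
    exact ⟨fun ⟨M', h, h'⟩ => h'.trans_le (hopt M' h), fun h => ⟨M, hM.isMatching, h⟩⟩
  rw [hiff] at hb1 hb0
  by_cases h : s.var 12 < s.var 10
  · obtain rfl := hb1 h
    constructor
    · simp [answer, den, h, hb.var_five, h0]
    · intro i
      obtain ⟨i, hi⟩ := i
      obtain rfl : i = 0 := by simpa using hi
      simp [answer, den, h, hb.var_five, h0]
  · obtain rfl := hb0 h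
    constructor
    · simp [answer, den, h, hb.var_five, h0]
    · intro i
      obtain ⟨i, hi⟩ := i
      obtain rfl : i = 0 := by simpa using hi
      simp [answer, den, h, hb.var_five, h0]

/-! ### Perfect matchings -/

/-- The computation of the edges with unit weights. -/
def unitWeights : Prog :=
  .assign 12 (.sub (.var 1) (.const 1)) ;;
  .loop 21 6 (.ite (.le (.get 0 address) (.const 0))
    (.store 2 (.var 21) (.const 0) ;; .store 3 (.var 21) (.const 0))
    (.store 2 (.var 21) (.const 1) ;; .store 3 (.var 21) (.const 1)))

theorem arr_rank (I : PrefMarket) (l : List ℤ) (a : Fin I.n) (p : Fin I.m) :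
    (start (I.encode ++ l)).arr 0 (2 * I.m + 2 + (a * I.m + p : ℕ)) = I.rank a p := by
  have hlt : (a : ℕ) * I.m + p < I.n * I.m := by rw [mul_comm I.n]; exact cell_lt a p
  rw [PrefMarket.encode, List.append_assoc, arr_start,
    List.getD_append _ _ _ _ (by rwa [Market.length_rowMajor]), Market.getD_rowMajor]

theorem mem_cells {G : Market} {s : State} (h : Base G s) (a : Fin G.n) (p : Fin G.m) :
    (0 : ℤ) ≤ (a : ℕ) * (G.m : ℕ) + (p : ℕ) ∧
      ((a : ℕ) * (G.m : ℕ) + (p : ℕ) : ℤ) < s.var 6 := by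
  refine ⟨by positivity, ?_⟩
  rw [h.var_six]
  exact_mod_cast cell_lt a p

theorem cell_lt_space {G : Market} {s s' : State} (h : Base G s) (h' : Base G s') {k : ℕ}
    (hk : (k : ℤ) < s.var 6) : (k : ℤ) < s'.var 5 := by
  have := le_space G.n G.m
  rw [h.var_six] at hk
  rw [h'.var_five]
  omega

theorem unitWeights_spec (I : PrefMarket) :
    Base I.toMarket (start I.encode) ∧
    (unitWeights.den (start I.encode)).var 12 = I.n - 1 ∧
    Data I.toMarket I.unitWeight ((unitWeights.den (start I.encode)).var 7)
      (unitWeights.den (start I.encode)) := by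
  set s := start I.encode with hs
  have hb : Base I.toMarket s := base_start _ _
  have h0 := fun a p => arr_rank I [] a p
  rw [List.append_nil, ← hs] at h0
  clear_value s
  set s₁ := (assign 12 (.sub (.var 1) (.const 1))).den s with hs₁
  have hb₁ : Base I.toMarket s₁ := hb.den (by decide)
  have ea₁ : s₁.arr 0 = s.arr 0 := rfl
  have e0 : ∀ k : ℕ, (I.m + I.m + 2 + k : ℤ) = 2 * I.m + 2 + k := fun k => by ring
  refine ⟨hb, ?_, Base.data (hb.den (by decide)) (fun a p => ?_) fun a p => ?_⟩
  · rw [unitWeights, den_seq, var_den _ _ (by decide)]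
    simp [den, hb.var_one]
  · change (Prog.den (.loop 21 6 _) s₁).arr 2 _ = _
    rw [arr_loop fun i => if s.arr 0 (2 * I.m + 2 + i) ≤ 0 then 0 else 1]
    · rw [if_pos (mem_cells hb₁ a p)]
      have := h0 a p
      push_cast at this
      rw [this]
      have := I.rank_pos_iff (a := a) (p := p)
      by_cases h : I.adj a p = true
      · rw [if_pos h, if_neg (by have := this.2 h; omega)]
      · rw [if_neg h, if_pos (by have := mt this.1 h; omega)]
    · intro k s' hk hx hF _
      have hb' := hb₁.of_frame hF (by decide)
      have ea : s'.arr 0 = s.arr 0 := (hF.arr 0 (by decide)).trans ea₁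
      have h5 := cell_lt_space hb₁ hb' hk
      by_cases h : s.arr 0 (2 * I.m + 2 + k) ≤ 0 <;>
        simp [den, address, hx, h5, hb'.var_two, ea, e0, h]
  · change (Prog.den (.loop 21 6 _) s₁).arr 3 _ = _
    rw [arr_loop fun i => if s.arr 0 (2 * I.m + 2 + i) ≤ 0 then 0 else 1]
    · rw [if_pos (mem_cells hb₁ a p)]
      have := h0 a p
      push_cast at this
      rw [this, PrefMarket.unitWeight]
      congr 1
      simp
    · intro k s' hk hx hF _
      have hb' := hb₁.of_frame hF (by decide)
      have ea : s'.arr 0 = s.arr 0 := (hF.arr 0 (by decide)).trans ea₁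
      have h5 := cell_lt_space hb₁ hb' hk
      by_cases h : s.arr 0 (2 * I.m + 2 + k) ≤ 0 <;>
        simp [den, address, hx, h5, hb'.var_two, ea, e0, h]

theorem fpt_perpoHA : perpoHA.FPT := by
  obtain ⟨P, hP⟩ := decides (pre := unitWeights) (by decide)
  refine ParamProblem.fpt_of_algorithm ⟨(solver unitWeights answer).compile, P,
    fun (I : PrefMarket) => ⟨?_, fun b hb1 hb0 => ?_⟩⟩
  · exact (Nat.mul_pos (Nat.succ_pos _) (Nat.succ_pos _)).trans_le I.toMarket.le_size
  · obtain ⟨h1, h2, h3⟩ := unitWeights_spec I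
    have hS := I.toMarket.le_size
    -- Pareto optimality is dropped first; what remains is a threshold on the number of matched
    -- applicants.
    have hiff : perpoHA.Yes I ↔ ∃ M, I.IsMatching M ∧
        (unitWeights.den (start I.encode)).var 12 < I.toMarket.intWeight I.unitWeight M := by
      refine I.exists_isParetoOptimal_isPerfect_iff.trans (exists_congr fun M => ?_)
      rw [h2]
      exact and_congr_right fun hM => I.isPerfect_iff hM
    refine hP I.toMarket I.unitWeight I.encode I.toMarket.size hS ?_ ?_ h1 h3 b
      (fun h => hb1 (hiff.2 h)) fun h => hb0 fun h' => h (hiff.1 h')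
    · rw [I.length_encode]; nlinarith
    · exact fun z hz => (I.len_encode_le z hz).trans (by omega)

end Prog

end RAM

namespace RAM

namespace Prog

open HouseAllocation

/-! ### Votes -/

/-- The storage of an edge and its weight: variable `13` is the weight of the votes of the
applicants who are worse off, variable `35` is not `0` if the applicant has been matched, and the
variables `36` and `37` are the ranks of the edge and of her previous project. -/
def castVote : Prog :=
  .ite (.le (.var 36) (.const 0))
    (.store 2 (.var 21) (.const 0) ;; .store 3 (.var 21) (.const 0))
    (.store 2 (.var 21) (.const 1) ;;
      .ite (.eq (.var 35) (.const 0)) (.store 3 (.var 21) (.const 1))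
        (.ite (.lt (.var 36) (.var 37)) (.store 3 (.var 21) (.add (.const 1) (.var 13)))
          (.ite (.eq (.var 36) (.var 37)) (.store 3 (.var 21) (.var 13))
            (.store 3 (.var 21) (.const 0)))))

/-- The address of the first cell behind the quotas. -/
def origin : Expr := .add (.add (.var 2) (.var 2)) (.const 2)

/-- The data for `castVote`. -/
def readVote : Prog :=
  .assign 34 (.div (.var 21) (.var 2)) ;;
  .assign 35 (.get 0 (.add (.add origin (.var 34)) (.var 6))) ;;
  .assign 36 (.get 0 (.add origin (.var 21))) ;;
  .assign 37 (.get 0 (.sub (.add (.add origin (.mul (.var 34) (.get 0 (.const 1)))) (.var 35))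
    (.const 1)))

/-- The computation of the edges, of the weights of the votes, which are given by `X` for
applicants who are worse off, and of the weight of the given matching. -/
def votes (X : Expr) : Prog :=
  .assign 13 X ;;
  .assign 12 (.const 0) ;;
  .loop 21 1 (.ite (.eq (.get 0 (.add address (.var 6))) (.const 0)) .skip
    (.assign 12 (.add (.var 12) (.var 13)))) ;;
  .loop 21 6 (readVote ;; castVote)

theorem castVote_spec {s : State} {k : ℕ} {q r r' X : ℤ} (hk : s.var 21 = k)
    (h5 : (k : ℤ) < s.var 5) (hX : s.var 13 = X) (hq : s.var 35 = q) (hr : s.var 36 = r)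
    (hr' : s.var 37 = r') :
    (castVote.den s).arr 2 = Function.update (s.arr 2) k (if r ≤ 0 then 0 else 1) ∧
    (castVote.den s).arr 3 = Function.update (s.arr 3) k (if r ≤ 0 then 0 else
      if q = 0 then 1 else if r < r' then 1 + X else if r = r' then X else 0) := by
  by_cases h1 : r ≤ 0
  · simp [castVote, den, hk, h5, hr, h1]
  · by_cases h2 : q = 0
    · simp [castVote, den, hk, h5, hr, hq, h1, h2]
    · by_cases h3 : r < r'
      · simp [castVote, den, hk, h5, hr, hr', hq, hX, h1, h2, h3]
      · by_cases h4 : r = r'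
        · have h1' : ¬ r' ≤ 0 := h4 ▸ h1
          simp [castVote, den, hk, h5, hr, hr', hq, hX, h1', h2, h4]
        · simp [castVote, den, hk, h5, hr, hr', hq, h1, h2, h3, h4]

theorem arr_rank_matched (I : MatchedMarket) (a : Fin I.n) (p : Fin I.m) :
    (start I.encode).arr 0 (2 * I.m + 2 + (a * I.m + p : ℕ)) = I.rank a p :=
  arr_rank I.toPrefMarket _ a p

theorem arr_matching (I : MatchedMarket) (a : Fin I.n) :
    (start I.encode).arr 0 (2 * I.m + 2 + (I.n * I.m + a : ℕ)) = code (I.M a) := by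
  rw [MatchedMarket.encode, PrefMarket.encode, List.append_assoc, arr_start,
    List.getD_append_right _ _ _ _ (by rw [Market.length_rowMajor]; omega),
    Market.length_rowMajor, Nat.add_sub_cancel_left, Market.encodeAssignment,
    List.getD_eq_getElem _ _ (by simp), List.getElem_ofFn]
  rfl

/-- For the cell of `a` and `p`, the program looks up the code of the old project of `a`, the rank
of `p`, and the rank of the old project. These determine the vote, while a separate loop accumulates
the threshold. -/
theorem votes_spec (I : MatchedMarket) (X : Expr) {x : ℤ}
    (hx : X.eval (start I.encode) = x) :
    Base I.toMarket (start I.encode) ∧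
    ((votes X).den (start I.encode)).var 12 = I.voteBound I.M x ∧
    Data I.toMarket (I.voteWeight I.M x) (((votes X).den (start I.encode)).var 7)
      ((votes X).den (start I.encode)) := by
  have hr := arr_rank_matched I
  have hM := arr_matching I
  have hb : Base I.toMarket (start I.encode) := by
    rw [MatchedMarket.encode, PrefMarket.encode, List.append_assoc]
    exact base_start _ _
  generalize start I.encode = s at *
  set s₂ := (assign 12 (.const 0)).den ((assign 13 X).den s) with hs₂
  have hb₂ : Base I.toMarket s₂ := (hb.den (by simp [keepsBase, vars, arrs]; decide)).den (by decide)
  have h13₂ : s₂.var 13 = x := by simp [hs₂, den, hx]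
  set c₃ : Prog := .loop 21 1 (.ite (.eq (.get 0 (.add address (.var 6))) (.const 0)) .skip
    (.assign 12 (.add (.var 12) (.var 13)))) with hc₃
  set s₃ := c₃.den s₂ with hs₃
  have hb₃ : Base I.toMarket s₃ := hb₂.den (by decide)
  have h13₃ : s₃.var 13 = x := (var_den c₃ s₂ (by decide)).trans h13₂
  have ea₃ : s₃.arr 0 = s.arr 0 := arr_den c₃ s₂ (by decide)
  have hZ : s₃.var 12 = I.voteBound I.M x := by
    have key := loop_induction (s := s₂) (x := 21) (b := 1)
      (c := .ite (.eq (.get 0 (.add address (.var 6))) (.const 0)) .skip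
        (.assign 12 (.add (.var 12) (.var 13))))
      (fun k s' => s'.var 12 = Fin.sumBelow (fun a => (I.M a).elim 0 fun _ => x) k)
      (by rw [Fin.sumBelow_zero]; simp [hs₂, den]) ?_
    · rwa [hb₂.var_one, Int.toNat_natCast, Fin.sumBelow_self] at key
    · intro k s' hk hx' hF ih
      rw [hb₂.var_one] at hk
      have hkn : k < I.n := by exact_mod_cast hk
      have hb' := hb₂.of_frame hF (by decide)
      have h13' : s'.var 13 = x := (hF.var 13 (by decide)).trans h13₂
      have ea : s'.arr 0 = s.arr 0 := hF.arr 0 (by decide)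
      have hcode := hM ⟨k, hkn⟩
      have e1 : (I.m + I.m + 2 + k + I.m * I.n : ℤ) = 2 * I.m + 2 + (I.n * I.m + k : ℕ) := by
        push_cast; ring
      have hsucc := Fin.sumBelow_succ (fun a => (I.M a).elim 0 fun _ => x) ⟨k, hkn⟩
      push_cast at hcode e1
      simp only at hsucc
      rw [hsucc, ← ih]
      rcases hMk : I.M ⟨k, hkn⟩ with _ | p
      · rw [hMk] at hcode
        simp [den, address, hx', hb'.var_two, hb'.var_six, ea, e1, hcode, code]
      · rw [hMk] at hcode
        have : ((p : ℕ) : ℤ) + 1 ≠ 0 := by omega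
        simp [den, address, hx', hb'.var_two, hb'.var_six, ea, e1, hcode, code, this, h13']
  set q : ℤ → ℤ := fun i => s.arr 0 (2 * I.m + 2 + (I.n * I.m + i / I.m)) with hq
  set r : ℤ → ℤ := fun i => s.arr 0 (2 * I.m + 2 + i) with hr_def
  -- The code of a project is its number plus `1`, hence the `- 1`. For an unmatched applicant the
  -- address is meaningless, but the value is then ignored because `q` is `0`.
  set r' : ℤ → ℤ := fun i => s.arr 0 (2 * I.m + 2 + (i / I.m * I.m + (q i - 1))) with hr'
  have hbody : ∀ (k : ℕ) (s' : State), (k : ℤ) < s₃.var 6 → s'.var 21 = k →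
      Frame (loop 21 6 (readVote ;; castVote)) s₃ s' →
      ((readVote ;; castVote).den s').arr 2 =
        Function.update (s'.arr 2) k (if r k ≤ 0 then 0 else 1) ∧
      ((readVote ;; castVote).den s').arr 3 = Function.update (s'.arr 3) k (if r k ≤ 0 then 0 else
        if q k = 0 then 1 else if r k < r' k then 1 + x else if r k = r' k then x else 0) := by
    intro k s' hk hx' hF
    have hb' := hb₃.of_frame hF (by decide)
    have h13' : s'.var 13 = x := (hF.var 13 (by decide)).trans h13₃
    have ea : s'.arr 0 = s.arr 0 := (hF.arr 0 (by decide)).trans ea₃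
    have e3 : s.arr 0 1 = I.m := hb.input_one
    have e35 : s'.arr 0 (I.m + I.m + 2 + k / I.m + (I.m * I.n : ℕ)) = q k := by
      rw [ea, hq]; simp only; congr 1; push_cast; ring
    have e36 : s'.arr 0 (I.m + I.m + 2 + k) = r k := by
      rw [ea, hr_def]; simp only; congr 1; ring
    have e37 : s'.arr 0 (I.m + I.m + 2 + k / I.m * I.m + q k - 1) = r' k := by
      rw [ea, hr']; simp only; congr 1; ring
    have h35 : (readVote.den s').var 35 = q k := by
      rw [← e35]
      simp [readVote, den, origin, hx', hb'.var_two, hb'.var_six]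
    have h36 : (readVote.den s').var 36 = r k := by
      rw [← e36]
      simp [readVote, den, origin, hx', hb'.var_two]
    have h37 : (readVote.den s').var 37 = r' k := by
      have e35' := e35
      push_cast at e35'
      rw [← e37]
      simp [readVote, den, origin, hx', hb'.var_two, hb'.var_six, hb'.input_one, e35']
    exact castVote_spec ((var_den readVote s' (by decide)).trans hx')
      ((cell_lt_space hb₃ hb' hk).trans_eq (var_den readVote s' (by decide)).symm)
      ((var_den readVote s' (by decide)).trans h13') h35 h36 h37
  have hrcell : ∀ (a : Fin I.n) (p : Fin I.m), r ((a : ℕ) * (I.m : ℕ) + (p : ℕ)) = I.rank a p :=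
    fun a p => by
      have := hr a p
      push_cast at this
      exact this
  have hdiv : ∀ (a : Fin I.n) (p : Fin I.m),
      ((a : ℕ) * (I.m : ℕ) + (p : ℕ) : ℤ) / I.m = (a : ℕ) := fun a p => by
    have hm : 0 < I.m := by have := p.2; omega
    have : ((a : ℕ) * I.m + p) / I.m = a := by
      rw [add_comm, Nat.add_mul_div_right _ _ hm, Nat.div_eq_of_lt p.2, zero_add]
    exact_mod_cast this
  have hqcell : ∀ (a : Fin I.n) (p : Fin I.m),
      q ((a : ℕ) * (I.m : ℕ) + (p : ℕ)) = code (I.M a) := fun a p => by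
    have := hM a
    push_cast at this
    rw [hq]
    simp only
    rw [hdiv, this]
  have hr'cell : ∀ (a : Fin I.n) (p q' : Fin I.m), I.M a = some q' →
      r' ((a : ℕ) * (I.m : ℕ) + (p : ℕ)) = I.rank a q' := fun a p q' h => by
    have := hr a q'
    push_cast at this
    rw [hr']
    simp only
    rw [hdiv, hqcell, h, code, Option.elim_some, add_sub_cancel_right, this]
  have hb₄ : Base I.toMarket ((loop 21 6 (readVote ;; castVote)).den s₃) := hb₃.den (by decide)
  refine ⟨hb, ?_, ?_⟩
  · exact (var_den (loop 21 6 (readVote ;; castVote)) s₃ (by decide)).trans hZ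
  · refine Base.data (s := (loop 21 6 (readVote ;; castVote)).den s₃) hb₄ (fun a p => ?_)
      fun a p => ?_
    · rw [arr_loop (fun i => if r i ≤ 0 then 0 else 1)
        (fun k s' hk hx' hF _ => (hbody k s' hk hx' hF).1), if_pos (mem_cells hb₃ a p)]
      refine (congrArg (fun z : ℤ => if z ≤ 0 then (0 : ℤ) else 1) (hrcell a p)).trans ?_
      have := I.rank_pos_iff (a := a) (p := p)
      by_cases h : I.adj a p = true
      · rw [if_pos h, if_neg (by have := this.2 h; omega)]
      · rw [if_neg h, if_pos (by have := mt this.1 h; omega)]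
    · rw [arr_loop (fun i => if r i ≤ 0 then 0 else
        if q i = 0 then 1 else if r i < r' i then 1 + x else if r i = r' i then x else 0)
        (fun k s' hk hx' hF _ => (hbody k s' hk hx' hF).2), if_pos (mem_cells hb₃ a p)]
      have h1 := hrcell a p
      have h2 := hqcell a p
      have h3 := hr'cell a p
      change (if r ((a : ℕ) * (I.m : ℕ) + (p : ℕ)) ≤ 0 then (0 : ℤ) else
        if q ((a : ℕ) * (I.m : ℕ) + (p : ℕ)) = 0 then 1 else
        if r ((a : ℕ) * (I.m : ℕ) + (p : ℕ)) < r' ((a : ℕ) * (I.m : ℕ) + (p : ℕ)) then 1 + x else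
        if r ((a : ℕ) * (I.m : ℕ) + (p : ℕ)) = r' ((a : ℕ) * (I.m : ℕ) + (p : ℕ)) then x else 0) = _
      rw [h1, h2, PrefMarket.voteWeight]
      rcases hMa : I.M a with _ | q'
      · simp [code]
      · rw [h3 q' hMa]
        have : ((q' : ℕ) : ℤ) + 1 ≠ 0 := by omega
        simp [code, this]

theorem matched_bounds (I : MatchedMarket) :
    I.encode.length ≤ 3 * I.toMarket.size ∧
      ∀ z ∈ I.encode, len z ≤ 3 * I.toMarket.size + 1 := by
  constructor
  · have hS := I.toMarket.le_size
    simp only [MatchedMarket.encode, List.length_append, PrefMarket.length_encode,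
      Market.encodeAssignment, List.length_ofFn]
    nlinarith
  · intro z hz
    rcases List.mem_append.1 hz with hz | hz
    · exact (I.toPrefMarket.len_encode_le z hz).trans (by omega)
    · obtain ⟨a, rfl⟩ := List.mem_ofFn.1 hz
      obtain ⟨h1, h2⟩ := code_bounds (I.M a)
      exact (I.toMarket.len_le_size h1 (.inr h2)).trans (by omega)

/-- Problems that ask for a matching for which the applicants vote are fixed-parameter
tractable. -/
theorem fpt_votes {Yes : MatchedMarket → Prop} (X : Expr) (x : MatchedMarket → ℤ)
    (hX : (votes X).admissible = true)
    (hx : ∀ I : MatchedMarket, Base I.toMarket (start I.encode) →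
      X.eval (start I.encode) = x I)
    (hYes : ∀ I : MatchedMarket, Yes I ↔ ∃ M, I.IsMatching M ∧
      I.voteBound I.M (x I) < I.toMarket.intWeight (I.voteWeight I.M (x I)) M) :
    ParamProblem.FPT ⟨MatchedMarket, fun I => I.encode, fun I => I.toMarket.size,
      fun I => I.mQuota, Yes⟩ := by
  obtain ⟨P, hP⟩ := decides hX
  refine ParamProblem.fpt_of_algorithm ⟨(solver (votes X) answer).compile, P,
    fun (I : MatchedMarket) => ⟨?_, fun b hb1 hb0 => ?_⟩⟩
  · exact (Nat.mul_pos (Nat.succ_pos _) (Nat.succ_pos _)).trans_le I.toMarket.le_size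
  · have hb : Base I.toMarket (start I.encode) := by
      rw [MatchedMarket.encode, PrefMarket.encode, List.append_assoc]
      exact base_start _ _
    obtain ⟨-, h2, h3⟩ := votes_spec I X (hx I hb)
    obtain ⟨h4, h5⟩ := matched_bounds I
    have hiff := hYes I
    rw [← h2] at hiff
    exact hP I.toMarket _ I.encode I.toMarket.size I.toMarket.le_size h4 h5 hb h3 b
      (fun h => hb1 (hiff.2 h)) fun h => hb0 fun h' => h (hiff.1 h')

theorem fpt_popvHA : popvHA.FPT :=
  fpt_votes (.const 1) (fun _ => 1) (by decide) (fun _ _ => rfl) fun I =>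
    exists_congr fun _ => and_congr_right fun hM => I.morePopular_iff I.isMatching hM

theorem fpt_povHA : povHA.FPT :=
  fpt_votes (.add (.var 1) (.const 1)) (fun I => I.n + 1) (by decide)
    (fun I h => by simp [h.var_one]) fun I =>
    exists_congr fun _ => and_congr_right fun hM => I.dominates_iff I.isMatching hM

end Prog

end RAM

theorem mainTheorem9 :
    (∃ (c : RAM.Cmd) (P : Polynomial ℕ), ∀ I : HouseAllocation.WeightedMarket,
      ∃ M : I.Assignment, I.IsMaxWeight M ∧
        RAM.ComputesWithin c I.encode (I.encodeAssignment M)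
          (2 ^ I.mQuota * P.eval I.size)) ∧
    HouseAllocation.popvHA.FPT ∧
    HouseAllocation.perpoHA.FPT ∧
    HouseAllocation.povHA.FPT :=
  ⟨RAM.Prog.exists_maxWeight_algorithm, RAM.Prog.fpt_popvHA, RAM.Prog.fpt_perpoHA,
    RAM.Prog.fpt_povHA⟩
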